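/- Setting. Let $\Omega=(0,1)^2$, let $\kappa$ be a measurable function on $\Omega$ with $1\le\kappa\le\beta$ a.e. (for instance piecewise constant with minimum $1$ and maximum $\beta$), and put $a(u,v)=\int_\Omega\kappa\nabla u\cdot\nabla v\,dx$, $\|v\|_a=\sqrt{a(v,v)}$, $\|v\|_{L^2(\Omega;\kappa)}^2=\int_\Omega\kappa v^2dx$. Let $\mathcal T_H$ be the mesh of $N\times N$ equal closed squares $K_1,\dots,K_m$ ($m=N^2$, $N\ge1$) with edge length $H=1/N$, let $\mathcal T_h$ be the mesh obtained by dividing each $K_i$ into $r\times r$ equal squares ($r\ge1$), and let $V_h\subset H^1_0(\Omega)$ be the $Q_1$ finite element space of $\mathcal T_h$. For $f\in L^2(\Omega)$ and a subspace $V\subseteq V_h$, the Galerkin solution in $V$ is the $u\in V$ with $a(u,v)=\int_\Omega fv\,dx$ for all $v\in V$; let $u_h$ be the Galerkin solution in $V_h$. Auxiliary space and ideal method. Let $V_h(K_i)$ be the space of restrictions of functions of $V_h$ to $K_i$, $n_i=\dim V_h(K_i)$, $a_i(v,w)=\int_{K_i}\kappa\nabla v\cdot\nabla w\,dx$, $s_i(v,w)=H^{-2}\int_{K_i}\kappa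 vw\,dx$. Let $\lambda^{(i)}_1\le\dots\le\lambda^{(i)}_{n_i}$ and $\psi^{(i)}_1,\dots,\psi^{(i)}_{n_i}\in V_h(K_i)$ be eigenvalues and $s_i$-orthonormal eigenfunctions: $a_i(\psi^{(i)}_j,w)=\lambda^{(i)}_js_i(\psi^{(i)}_j,w)$ for all $w\in V_h(K_i)$. Let $\mu_i$ be the first nonzero eigenvalue of the same problem with $\kappa$ replaced by $1$, and let $0\le L_i\le n_i$ be such that $\lambda^{(i)}_j>\frac12\mu_i$ for $j>L_i$. Put $L=\sum_iL_i$, $\Pi^{(i)}_{aux}v=\sum_{j\le L_i}s_i(v,\psi^{(i)}_j)\psi^{(i)}_j$, $\mathrm{Ker}\,\Pi_{aux}=\{v\in V_h:\Pi^{(i)}_{aux}(v|_{K_i})=0\ \forall i\}$, $V^{ms,h}_{aux}=\{v\in V_h:a(v,w)=0\ \forall w\in\mathrm{Ker}\,\Pi_{aux}\}$, and let $u^{ms,h}_{aux}$ be the Galerkin solution in $V^{ms,h}_{aux}$. Let $C_*=2^{3/2}/\pi$. Localized method. Let $\hat p^{(i)}_1,\dots,\hat p^{(i)}_{L_i}$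 (the dual nodes) be vertices of $\mathcal T_h$ in the interior of $K_i$, with hat functions $\hat\phi^{(i)}_j$ normalized by $a_i(\hat\phi^{(i)}_j,\hat\phi^{(i)}_j)=1$, such that each matrix $S_i=\big(s_i(\hat\phi^{(i)}_j,\psi^{(i)}_k)\big)_{1\le j,k\le L_i}$ is nonsingular and such that each square of $\mathcal T_h$ has at most one dual node as a vertex. Let $\tilde\phi^{(i)}_j=\sum_\ell(S_i^{-1})_{j\ell}\hat\phi^{(i)}_\ell$, let $M_i$ be the 2-norm of the matrix $\big(a(\tilde\phi^{(i)}_j,\tilde\phi^{(i)}_\ell)\big)_{j,\ell}$, and $M=\max_iM_i$. For an interior vertex $p$ of $\mathcal T_h$ that is not a dual node let $\phi_p$ be its hat function with $\|\phi_p\|_a=1$ and $g_p=\phi_p-\sum_{i}\sum_{j\le L_i}s_i(\phi_p,\psi^{(i)}_j)\tilde\phi^{(i)}_j\in\mathrm{Ker}\,\Pi_{aux}$. A basis $\chi_1,\dots,\chi_\ell$ of $\mathrm{Ker}\,\Pi_{aux}$ is built from the $g_p$ as follows, the vertices being enumerated in any order: (1) for each $K_i$, the $g_p$ with $p$ interior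 to $K_i$ are $a$-orthonormalized by the modified Gram-Schmidt algorithm; (2) for each interior edge of $\mathcal T_H$, the $g_p$ with $p$ in the interior of the edge are made $a$-orthogonal to the functions of step (1) of the two adjacent elements, and then $a$-orthonormalized by the modified Gram-Schmidt algorithm; (3) for each interior vertex $p$ of $\mathcal T_H$, $g_p$ is made $a$-orthogonal to the functions of steps (1) and (2) of the four elements and the four edges that meet at $p$, and normalized in $\|\cdot\|_a$. Let $\mathbf G=\big(a(\chi_s,\chi_t)\big)_{s,t}$, $\mathfrak K=\lambda_{\max}(\mathbf G)/\lambda_{\min}(\mathbf G)$ and $q=(\sqrt{\mathfrak K}-1)/(\sqrt{\mathfrak K}+1)$ (with $\mathfrak K=0$ if $\mathrm{Ker}\,\Pi_{aux}=\{0\}$). For $k\ge0$ let $\mathfrak C_{h,k}\hat\phi^{(i)}_j=\sum_sx_s\chi_s$, where $\mathbf x$ is the result of $k$ iterations of the conjugate gradient algorithm with initial guess $\mathbf 0$ for $\mathbf G\mathbf x=\big(a(\chi_s,\hat\phi^{(i)}_j)\big)_s$. Let $V^{ms,h}_{aux,k}$ be the span of all $\hat\phi^{(i)}_j-\mathfrak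 C_{h,k}\hat\phi^{(i)}_j$, and $u^{ms,h}_{aux,k}$ the Galerkin solution in $V^{ms,h}_{aux,k}$. Claim. (i) If $2q^k\sqrt L\sqrt M\sqrt\beta\le H^2$, then $$\|u_h-u^{ms,h}_{aux,k}\|_{L^2(\Omega)}\le[(C_*+1)H]^2\|f\|_{L^2(\Omega)}.$$ (ii) For the ideal method (no dual nodes and no condition on $k$ are needed), $$\|u_h-u^{ms,h}_{aux}\|_{L^2(\Omega;\kappa)}\le(C_*H)^2\|\kappa^{-1/2}f\|_{L^2(\Omega)}\le(C_*H)^2\|f\|_{L^2(\Omega)},$$ and also $\|u_h-u^{ms,h}_{aux}\|_{L^2(\Omega)}\le(C_*H)^2\|f\|_{L^2(\Omega)}$. -/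

import Mathlib

open MeasureTheory

namespace SpectralLOD

noncomputable section

/-! ### Domain, meshes, bilinear forms, norms -/

/-- Real functions of two variables. -/
abbrev Fn : Type := ℝ × ℝ → ℝ

/-- The open unit square `(0,1) × (0,1)`. -/
def Omega : Set (ℝ × ℝ) := Set.Ioo 0 1 ×ˢ Set.Ioo 0 1

/-- The closed square number `c` of the uniform subdivision of the unit square into `n × n`
squares; the relevant numbers are `c.1 < n`, `c.2 < n`. -/
def cell (n : ℕ) (c : ℕ × ℕ) : Set (ℝ × ℝ) :=
  Set.Icc ((c.1 : ℝ) / n) (((c.1 : ℝ) + 1) / n) ×ˢ Set.Icc ((c.2 : ℝ) / n) (((c.2 : ℝ) + 1) / n)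

/-- The numbers of the `n × n` squares. -/
def cells (n : ℕ) : Finset (ℕ × ℕ) := Finset.range n ×ˢ Finset.range n

/-- The edge length of the squares. -/
def meshSize (n : ℕ) : ℝ := 1 / (n : ℝ)

/-- `p` is the (grid) number of an interior vertex `(p.1 / n, p.2 / n)` of the `n × n` mesh. -/
def IsInteriorNode (n : ℕ) (p : ℕ × ℕ) : Prop := 0 < p.1 ∧ p.1 < n ∧ 0 < p.2 ∧ p.2 < n

/-- The grid point `p` is one of the four vertices of the square number `c` of the same mesh. -/
def IsVertexOf (p c : ℕ × ℕ) : Prop :=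
  (p.1 = c.1 ∨ p.1 = c.1 + 1) ∧ (p.2 = c.2 ∨ p.2 = c.2 + 1)

/-- The `Q₁` finite element subspace of `H¹₀` of the unit square for the uniform `n × n` mesh:
continuous functions, zero outside the open square, bilinear on each closed mesh square. -/
def Vh (n : ℕ) : Submodule ℝ Fn where
  carrier := {v | Continuous v ∧ (∀ x, x ∉ Omega → v x = 0) ∧
    ∀ c ∈ cells n, ∃ α β γ δ : ℝ, ∀ x ∈ cell n c,
      v x = α + β * x.1 + γ * x.2 + δ * (x.1 * x.2)}
  add_mem' := by
    rintro u v ⟨hu, hu0, hub⟩ ⟨hv, hv0, hvb⟩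
    refine ⟨hu.add hv, fun x hx => by simp [hu0 x hx, hv0 x hx], fun c hc => ?_⟩
    obtain ⟨a, b, g, d, h⟩ := hub c hc
    obtain ⟨a', b', g', d', h'⟩ := hvb c hc
    refine ⟨a + a', b + b', g + g', d + d', fun x hx => ?_⟩
    rw [Pi.add_apply, h x hx, h' x hx]; ring
  zero_mem' := ⟨continuous_const, fun _ _ => rfl, fun _ _ => ⟨0, 0, 0, 0, fun _ _ => by simp⟩⟩
  smul_mem' := by
    rintro t v ⟨hv, hv0, hvb⟩
    refine ⟨hv.const_smul t, fun x hx => by simp [hv0 x hx], fun c hc => ?_⟩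
    obtain ⟨a, b, g, d, h⟩ := hvb c hc
    refine ⟨t * a, t * b, t * g, t * d, fun x hx => ?_⟩
    rw [Pi.smul_apply, smul_eq_mul, h x hx]; ring

/-- The partial derivative with respect to the first variable.  For the piecewise bilinear functions used here
the partial derivatives exist off the mesh
lines (a null set) and represent the weak gradient on the square or mesh square considered. -/
def pd1 (v : Fn) (x : ℝ × ℝ) : ℝ := deriv (fun t => v (t, x.2)) x.1

/-- The partial derivative with respect to the second variable. -/
def pd2 (v : Fn) (x : ℝ × ℝ) : ℝ := deriv (fun t => v (x.1, t)) x.2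

/-- `∫_D κ ∇u · ∇v dx`. -/
def energyForm (D : Set (ℝ × ℝ)) (κ u v : Fn) : ℝ :=
  ∫ x in D, κ x * (pd1 u x * pd1 v x + pd2 u x * pd2 v x)

/-- The form `a(u,v) = ∫_Ω κ ∇u · ∇v dx`. -/
def aForm (κ u v : Fn) : ℝ := energyForm Omega κ u v

/-- The local form `a_i(u,v) = ∫_{K_i} κ ∇u · ∇v dx`, where `K_i = cell N i`. -/
def aLoc (N : ℕ) (κ : Fn) (i : ℕ × ℕ) (u v : Fn) : ℝ := energyForm (cell N i) κ u v

/-- The local form `s_i(u,v) = H⁻² ∫_{K_i} κ u v dx`, where `H = 1 / N`. -/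
def sLoc (N : ℕ) (κ : Fn) (i : ℕ × ℕ) (u v : Fn) : ℝ :=
  (meshSize N ^ 2)⁻¹ * ∫ x in cell N i, κ x * u x * v x

/-- The norm of `L²(Ω)`. -/
def l2Norm (v : Fn) : ℝ := √(∫ x in Omega, v x ^ 2)

/-- The weighted norm of `L²(Ω; κ)`. -/
def l2NormW (κ v : Fn) : ℝ := √(∫ x in Omega, κ x * v x ^ 2)

/-- `u` is the Galerkin solution in `V`: `u ∈ V` and `a(u,v) = ∫_Ω f v dx` for all `v ∈ V`. -/
def IsGalerkin (κ f : Fn) (V : Set Fn) (u : Fn) : Prop :=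
  u ∈ V ∧ ∀ v ∈ V, aForm κ u v = ∫ x in Omega, f x * v x

/-! ### The local eigenvalue problems and the auxiliary space

Throughout the coarse mesh is the `N × N` mesh (`H = 1 / N`), and the fine mesh is the
`(N * r) × (N * r)` mesh, which divides each coarse square into `r × r` squares. -/

/-- Restriction to a set, the result being extended by zero. -/
def restrictTo (D : Set (ℝ × ℝ)) : Fn →ₗ[ℝ] Fn where
  toFun v := D.indicator v
  map_add' u v := Set.indicator_add D u v
  map_smul' t v := Set.indicator_const_smul D t v

/-- `V_h(K_i)`, the space of the restrictions to `K_i` of the functions in `V_h`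
(extended by zero). -/
def VhLoc (N r : ℕ) (i : ℕ × ℕ) : Submodule ℝ Fn := (Vh (N * r)).map (restrictTo (cell N i))

/-- `n_i = dim V_h(K_i)`. -/
def dimLoc (N r : ℕ) (i : ℕ × ℕ) : ℕ := Module.finrank ℝ (VhLoc N r i)

/-- `μ_i`: the first nonzero eigenvalue of the eigenvalue problem
`∫_{K_i} ∇ψ · ∇w dx = μ H⁻² ∫_{K_i} ψ w dx` for all `w ∈ V_h(K_i)`.
(All eigenvalues are nonnegative and there are finitely many of them.) -/
def muLoc (N r : ℕ) (i : ℕ × ℕ) : ℝ :=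
  sInf {μ : ℝ | 0 < μ ∧ ∃ v ∈ VhLoc N r i, v ≠ 0 ∧
    ∀ w ∈ VhLoc N r i, aLoc N (fun _ => 1) i v w = μ * sLoc N (fun _ => 1) i v w}

/-- A choice of the eigensystems of all the coarse squares `K_i` and of the numbers `L_i`.
Indices start from `0`; `lam i j` and `psi i j` are used for `j < dimLoc N r i` only. -/
structure SpectralData (N r : ℕ) (κ : Fn) where
  /-- the eigenvalues -/
  lam : ℕ × ℕ → ℕ → ℝ
  /-- the eigenfunctions -/
  psi : ℕ × ℕ → ℕ → Fn
  /-- the numbers `L_i` of eigenfunctions that are kept -/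
  L : ℕ × ℕ → ℕ
  psi_mem : ∀ i ∈ cells N, ∀ j < dimLoc N r i, psi i j ∈ VhLoc N r i
  eigen : ∀ i ∈ cells N, ∀ j < dimLoc N r i, ∀ w ∈ VhLoc N r i,
    aLoc N κ i (psi i j) w = lam i j * sLoc N κ i (psi i j) w
  orthonormal : ∀ i ∈ cells N, ∀ j < dimLoc N r i, ∀ k < dimLoc N r i,
    sLoc N κ i (psi i j) (psi i k) = if j = k then 1 else 0
  lam_mono : ∀ i ∈ cells N, ∀ j k, j ≤ k → k < dimLoc N r i → lam i j ≤ lam i k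
  L_le : ∀ i ∈ cells N, L i ≤ dimLoc N r i
  choice : ∀ i ∈ cells N, ∀ j, L i ≤ j → j < dimLoc N r i → 1 / 2 * muLoc N r i < lam i j

variable {N r : ℕ} {κ : Fn}

/-- `Π_aux^{(i)} v`, the `s_i`-orthogonal projection of `v|_{K_i}` on
`span {ψ_1^{(i)}, …, ψ_{L_i}^{(i)}}`. -/
def SpectralData.proj (S : SpectralData N r κ) (i : ℕ × ℕ) (v : Fn) : Fn :=
  ∑ j ∈ Finset.range (S.L i), sLoc N κ i v (S.psi i j) • S.psi i j

/-- `Ker Π_aux ⊆ V_h`. -/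
def SpectralData.kerPi (S : SpectralData N r κ) : Set Fn :=
  {v | v ∈ Vh (N * r) ∧ ∀ i ∈ cells N, S.proj i v = 0}

/-- The ideal multiscale finite element space, the `a`-orthogonal complement of `Ker Π_aux`
in `V_h`. -/
def SpectralData.idealSpace (S : SpectralData N r κ) : Set Fn :=
  {v | v ∈ Vh (N * r) ∧ ∀ w ∈ S.kerPi, aForm κ v w = 0}

/-- `L = ∑_i L_i`. -/
def SpectralData.totalL (S : SpectralData N r κ) : ℕ := ∑ i ∈ cells N, S.L i

/-- The constant `C_* = 2^{3/2} / π`. -/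
def Cstar : ℝ := (2 : ℝ) ^ (3 / 2 : ℝ) / Real.pi

/-! ### Dual nodes and dual functions -/

/-- The `Q₁` nodal basis ("hat") function of the vertex `p` of the `n × n` mesh. -/
def hat (n : ℕ) (p : ℕ × ℕ) : Fn :=
  fun x => max 0 (1 - |n * x.1 - p.1|) * max 0 (1 - |n * x.2 - p.2|)

/-- The fine vertex number `p` lies in the interior of the coarse square `K_i`. -/
def InInterior (r : ℕ) (i p : ℕ × ℕ) : Prop :=
  i.1 * r < p.1 ∧ p.1 < (i.1 + 1) * r ∧ i.2 * r < p.2 ∧ p.2 < (i.2 + 1) * r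

/-- The hat function of the fine vertex `p`, normalized by `a_i(φ,φ) = 1`. -/
def hatLocNormalized (N r : ℕ) (κ : Fn) (i p : ℕ × ℕ) : Fn :=
  (√(aLoc N κ i (hat (N * r) p) (hat (N * r) p)))⁻¹ • hat (N * r) p

/-- The matrix `S_i` with components `s_i(φ̂_j^{(i)}, ψ_k^{(i)})`, where `φ̂_j^{(i)}` is the
normalized hat function of the vertex `node i j`. -/
def SpectralData.dualMatrix (S : SpectralData N r κ) (node : ℕ × ℕ → ℕ → ℕ × ℕ) (i : ℕ × ℕ) :
    Matrix (Fin (S.L i)) (Fin (S.L i)) ℝ :=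
  Matrix.of fun j k => sLoc N κ i (hatLocNormalized N r κ i (node i j)) (S.psi i k)

/-- A choice of dual nodes `node i j` (`j < L_i`) in the interiors of the coarse squares `K_i`
such that the matrices `S_i` are nonsingular and the dual nodes are separated: no fine square has
two of them as vertices. -/
structure DualNodes (S : SpectralData N r κ) where
  node : ℕ × ℕ → ℕ → ℕ × ℕ
  interior : ∀ i ∈ cells N, ∀ j < S.L i, InInterior r i (node i j)
  nonsingular : ∀ i ∈ cells N, (S.dualMatrix node i).det ≠ 0
  separated : ∀ c ∈ cells (N * r), ∀ i ∈ cells N, ∀ j < S.L i, ∀ i' ∈ cells N, ∀ j' < S.L i',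
    IsVertexOf (node i j) c → IsVertexOf (node i' j') c → i = i' ∧ j = j'

variable {S : SpectralData N r κ}

/-- The normalized hat function `φ̂_j^{(i)}` of a dual node. -/
def DualNodes.dualHat (D : DualNodes S) (i : ℕ × ℕ) (j : ℕ) : Fn :=
  hatLocNormalized N r κ i (D.node i j)

/-- The dual functions `φ̃_j^{(i)} = ∑_l (S_i⁻¹)_{jl} φ̂_l^{(i)}`. -/
def DualNodes.dualFun (D : DualNodes S) (i : ℕ × ℕ) (j : Fin (S.L i)) : Fn :=
  ∑ l : Fin (S.L i), (S.dualMatrix D.node i)⁻¹ j l • D.dualHat i l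

/-- `M_i`: the 2-norm of the matrix with components `a(φ̃_j^{(i)}, φ̃_l^{(i)})`. -/
def DualNodes.MLoc (D : DualNodes S) (i : ℕ × ℕ) : NNReal :=
  ‖Matrix.toEuclideanCLM (𝕜 := ℝ) (n := Fin (S.L i))
    (Matrix.of fun j l => aForm κ (D.dualFun i j) (D.dualFun i l))‖₊

/-- `M = max_i M_i`. -/
def DualNodes.M (D : DualNodes S) : NNReal := (cells N).sup D.MLoc

/-- `p` is a dual node. -/
def DualNodes.IsDual (D : DualNodes S) (p : ℕ × ℕ) : Prop :=
  ∃ i ∈ cells N, ∃ j < S.L i, D.node i j = p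

/-- The hat function `φ_p` of the fine vertex `p`, normalized by `‖φ_p‖_a = 1`. -/
def hatNormalized (N r : ℕ) (κ : Fn) (p : ℕ × ℕ) : Fn :=
  (√(aForm κ (hat (N * r) p) (hat (N * r) p)))⁻¹ • hat (N * r) p

/-- `φ_p - φ̃_p`, where `φ̃_p = ∑_i ∑_j s_i(φ_p, ψ_j^{(i)}) φ̃_j^{(i)}`. -/
def DualNodes.kerFun (D : DualNodes S) (p : ℕ × ℕ) : Fn :=
  hatNormalized N r κ p -
    ∑ i ∈ cells N, ∑ j : Fin (S.L i),
      sLoc N κ i (hatNormalized N r κ p) (S.psi i j) • D.dualFun i j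

/-! ### The special basis of `Ker Π_aux` -/

/-- The modified Gram-Schmidt algorithm for the inner product `a`. -/
def mgs (κ : Fn) : List Fn → List Fn
  | [] => []
  | v :: vs =>
    let e : Fn := (√(aForm κ v v))⁻¹ • v
    e :: mgs κ (vs.map fun w => w - aForm κ e w • e)
termination_by l => l.length

/-- `g` minus its components along the members of the `a`-orthonormal list `B`. -/
def residual (κ : Fn) (B : List Fn) (g : Fn) : Fn := g - (B.map fun e => aForm κ e g • e).sum

/-- Make the members of `gs` orthogonal to the span of `prev`, and then apply the modified
Gram-Schmidt algorithm to them. -/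
def orthonormalizeAfter (κ : Fn) (prev gs : List Fn) : List Fn :=
  mgs κ (gs.map (residual κ (mgs κ prev)))

open Classical in
/-- The basis functions associated with the interior of the coarse square `K_i`.
The list `order` is an enumeration of the interior vertices of the fine mesh. -/
def DualNodes.elemBasis (D : DualNodes S) (order : List (ℕ × ℕ)) (i : ℕ × ℕ) : List Fn :=
  mgs κ ((order.filter fun p => InInterior r i p ∧ ¬ D.IsDual p).map D.kerFun)

open Classical in
/-- The basis functions associated with the interior of the vertical edge shared by the coarse
squares `e` and `e + (1, 0)`. -/
def DualNodes.vEdgeBasis (D : DualNodes S) (order : List (ℕ × ℕ)) (e : ℕ × ℕ) : List Fn :=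
  orthonormalizeAfter κ (D.elemBasis order e ++ D.elemBasis order (e.1 + 1, e.2))
    ((order.filter fun p => p.1 = (e.1 + 1) * r ∧ e.2 * r < p.2 ∧ p.2 < (e.2 + 1) * r).map
      D.kerFun)

open Classical in
/-- The basis functions associated with the interior of the horizontal edge shared by the coarse
squares `e` and `e + (0, 1)`. -/
def DualNodes.hEdgeBasis (D : DualNodes S) (order : List (ℕ × ℕ)) (e : ℕ × ℕ) : List Fn :=
  orthonormalizeAfter κ (D.elemBasis order e ++ D.elemBasis order (e.1, e.2 + 1))
    ((order.filter fun p => e.1 * r < p.1 ∧ p.1 < (e.1 + 1) * r ∧ p.2 = (e.2 + 1) * r).map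
      D.kerFun)

/-- The basis function (as a list of length one) associated with the vertex shared by the four
coarse squares `c`, `c + (1, 0)`, `c + (0, 1)`, `c + (1, 1)`: made orthogonal to the functions of
these squares and of the four edges that meet at the vertex, and normalized. -/
def DualNodes.vertexBasis (D : DualNodes S) (order : List (ℕ × ℕ)) (c : ℕ × ℕ) : List Fn :=
  orthonormalizeAfter κ
    (D.elemBasis order c ++ D.elemBasis order (c.1 + 1, c.2) ++
      D.elemBasis order (c.1, c.2 + 1) ++ D.elemBasis order (c.1 + 1, c.2 + 1) ++
      D.vEdgeBasis order c ++ D.vEdgeBasis order (c.1, c.2 + 1) ++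
      D.hEdgeBasis order c ++ D.hEdgeBasis order (c.1 + 1, c.2))
    [D.kerFun ((c.1 + 1) * r, (c.2 + 1) * r)]

/-- The special basis of `Ker Π_aux`: the columns of the matrix `K`. -/
def DualNodes.kerBasis (D : DualNodes S) (order : List (ℕ × ℕ)) : List Fn :=
  (List.range N ×ˢ List.range N).flatMap (D.elemBasis order) ++
    (List.range (N - 1) ×ˢ List.range N).flatMap (D.vEdgeBasis order) ++
    (List.range N ×ˢ List.range (N - 1)).flatMap (D.hEdgeBasis order) ++
    (List.range (N - 1) ×ˢ List.range (N - 1)).flatMap (D.vertexBasis order)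

/-- The matrix `KᵀAK`, where `A` is the stiffness matrix of `a`: its components are the values
of `a` at pairs of members of the special basis. -/
def DualNodes.gram (D : DualNodes S) (order : List (ℕ × ℕ)) :
    Matrix (Fin (D.kerBasis order).length) (Fin (D.kerBasis order).length) ℝ :=
  Matrix.of fun s t => aForm κ ((D.kerBasis order).get s) ((D.kerBasis order).get t)

/-- The condition number `λ_max / λ_min` of a symmetric positive definite matrix. -/
def condNumber {l : ℕ} (G : Matrix (Fin l) (Fin l) ℝ) : ℝ :=
  sSup (spectrum ℝ G) / sInf (spectrum ℝ G)

/-- `q = (√𝔎 - 1) / (√𝔎 + 1)`, where `𝔎` is the condition number of `KᵀAK`. -/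
def DualNodes.q (D : DualNodes S) (order : List (ℕ × ℕ)) : ℝ :=
  (√(condNumber (D.gram order)) - 1) / (√(condNumber (D.gram order)) + 1)

/-! ### The conjugate gradient algorithm and the localized multiscale method -/

/-- A state of the conjugate gradient algorithm: approximate solution, residual, direction. -/
structure CGState (l : ℕ) where
  x : Fin l → ℝ
  res : Fin l → ℝ
  dir : Fin l → ℝ

/-- The conjugate gradient algorithm for `G x = b` with initial guess `0`.  Once the residual
vanishes, the approximate solution no longer changes (by the convention `0 / 0 = 0`). -/
def cg {l : ℕ} (G : Matrix (Fin l) (Fin l) ℝ) (b : Fin l → ℝ) : ℕ → CGState l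
  | 0 => ⟨0, b, b⟩
  | k + 1 =>
    let s := cg G b k
    let step : ℝ := (s.res ⬝ᵥ s.res) / (s.dir ⬝ᵥ G.mulVec s.dir)
    let res' : Fin l → ℝ := s.res - step • G.mulVec s.dir
    ⟨s.x + step • s.dir, res', res' + ((res' ⬝ᵥ res') / (s.res ⬝ᵥ s.res)) • s.dir⟩

/-- The approximate correction of `φ̂_j^{(i)}`: the function represented by `K x`, where `x` is
the result of `k` conjugate gradient iterations for `KᵀAK x = KᵀA f_j^{(i)}` and the vector
`f_j^{(i)}` represents `φ̂_j^{(i)}`. -/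
def DualNodes.corrector (D : DualNodes S) (order : List (ℕ × ℕ)) (k : ℕ) (i : ℕ × ℕ) (j : ℕ) :
    Fn :=
  ∑ s, (cg (D.gram order) (fun t => aForm κ ((D.kerBasis order).get t) (D.dualHat i j)) k).x s •
    (D.kerBasis order).get s

/-- The localized multiscale finite element space. -/
def DualNodes.msSpace (D : DualNodes S) (order : List (ℕ × ℕ)) (k : ℕ) : Submodule ℝ Fn :=
  Submodule.span ℝ
    {v | ∃ i ∈ cells N, ∃ j < S.L i, v = D.dualHat i j - D.corrector order k i j}

end

end SpectralLOD

/-! Everything rests on one inequality: every v in Ker Π_aux satisfies ‖v‖_{L²(κ)} ≤ C_* H ‖v‖_a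
(`massForm_le_of_mem_kerPi`). On each K_i such a v has no components along the first L_i
eigenfunctions, so expanding s_i(v,v) and a_i(v,v) in the eigenbasis gives s_i(v,v) ≤ (2/μ_i)
a_i(v,v). The bound μ_i ≥ π²/4 (`muLoc_ge`) is a Poincaré inequality with constant 2H/π. If K_i
touches ∂Ω, functions in V_h vanish on one of its sides. If it does not, the constants belong to
V_h(K_i), so an eigenfunction with positive eigenvalue has mean zero. Hence C_*² = 2 · 4/π².

Ideal method. V_h is the a-orthogonal sum of Ker Π_aux and the ideal space, and the Galerkin error e
is the kernel component of u_h (`sub_mem_kerPi_of_isGalerkin`). Then a(e,e) = ∫ f e, and the kernel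
inequality gives ‖e‖_a ≤ C_* H ‖κ^{-1/2} f‖. Applying it once more to e itself gives the second
factor C_* H, so no duality argument is needed.

Localized method. A function w of the ideal space is recovered from its local moments s_i(w, ψ_j):
it equals Σ d_x (φ̂_x - 𝔠 φ̂_x), where 𝔠 is the exact a-projection onto Ker Π_aux and the d_x are
the coefficients of the dual interpolant of w. The dual hats are a-orthonormal, because dual nodes
are separated, so Σ d_x² ≤ M Σ_i s_i(w,w) ≤ M H⁻² β ‖w‖_a². Replacing 𝔠 by k conjugate gradient
steps costs at most 2 q^k for each dual hat, and Cauchy-Schwarz over the L terms gives an error of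
at most 2 q^k √L √M √β H⁻¹ ‖w‖_a ≤ H ‖w‖_a (`exists_msSpace_approx`). With the kernel component this
makes every finite element solution approximable in energy to within (C_* + 1) H times its load
(`exists_msSpace_energy_approx`). Céa's lemma and an Aubin-Nitsche argument inside V_h square the
factor (`l2Norm_localized_error_le`).

The conjugate gradient rate is the classical one: optimality over Krylov spaces (`cg_optimal`) and a
shifted Chebyshev polynomial (`exists_chebyshev_polynomial`). It needs **G** to be positive
definite, hence the constructed functions to form a basis of Ker Π_aux (`listSpan_kerBasis`,
`linearIndependent_kerBasis`). Beyond that, no orthogonality produced by Gram-Schmidt enters. -/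

namespace SpectralLOD

/-! ### The mesh, the nodal basis of V_h, and partial derivatives off the mesh lines. -/

/-! ### The mesh lines -/

/-- The coordinates of the mesh lines of the `n × n` mesh. -/
def grid (n : ℕ) : Set ℝ := Set.range fun k : ℕ => (k : ℝ) / n

theorem countable_grid (n : ℕ) : (grid n).Countable := Set.countable_range _

/-- The part of the open unit square that lies off the mesh lines. -/
def offGrid (n : ℕ) : Set (ℝ × ℝ) := {x | x ∈ Omega ∧ x.1 ∉ grid n ∧ x.2 ∉ grid n}

theorem measurableSet_Omega : MeasurableSet Omega := measurableSet_Ioo.prod measurableSet_Ioo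

theorem isOpen_Omega : IsOpen Omega := isOpen_Ioo.prod isOpen_Ioo

theorem measurableSet_cell (n : ℕ) (c : ℕ × ℕ) : MeasurableSet (cell n c) :=
  measurableSet_Icc.prod measurableSet_Icc

theorem ae_notMem_grid (n : ℕ) : ∀ᵐ x : ℝ × ℝ, x.1 ∉ grid n ∧ x.2 ∉ grid n := by
  have h : ∀ᵐ t : ℝ, t ∉ grid n :=
    compl_mem_ae_iff.2 ((countable_grid n).measure_zero volume)
  have h1 : ∀ᵐ x : ℝ × ℝ, x.1 ∉ grid n :=
    (Measure.quasiMeasurePreserving_fst (μ := (volume : Measure ℝ))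
      (ν := (volume : Measure ℝ))).ae h
  have h2 : ∀ᵐ x : ℝ × ℝ, x.2 ∉ grid n :=
    (Measure.quasiMeasurePreserving_snd (μ := (volume : Measure ℝ))
      (ν := (volume : Measure ℝ))).ae h
  filter_upwards [h1, h2] with x hx hy using ⟨hx, hy⟩

theorem ae_mem_offGrid (n : ℕ) : ∀ᵐ x ∂(volume.restrict Omega), x ∈ offGrid n := by
  filter_upwards [ae_restrict_of_ae (ae_notMem_grid n), ae_restrict_mem measurableSet_Omega]
    with x hx hO using ⟨hO, hx⟩

theorem exists_Icc_of_mem {n : ℕ} (hn : 0 < n) {t : ℝ} (ht : t ∈ Set.Icc (0 : ℝ) 1) :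
    ∃ k < n, t ∈ Set.Icc ((k : ℝ) / n) (((k : ℝ) + 1) / n) := by
  have hn' : (0 : ℝ) < n := Nat.cast_pos.2 hn
  rcases eq_or_lt_of_le ht.2 with h1 | h1
  · refine ⟨n - 1, by omega, ?_, ?_⟩
    · rw [div_le_iff₀ hn', h1, Nat.cast_sub (by omega)]; simp
    · rw [le_div_iff₀ hn', h1, Nat.cast_sub (by omega)]; simp
  · refine ⟨⌊t * n⌋₊, ?_, ?_, ?_⟩
    · rw [Nat.floor_lt (mul_nonneg ht.1 hn'.le)]; nlinarith
    · rw [div_le_iff₀ hn']; exact Nat.floor_le (mul_nonneg ht.1 hn'.le)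
    · rw [le_div_iff₀ hn']; exact (Nat.lt_floor_add_one _).le

theorem exists_Ioo_of_notMem_grid {n : ℕ} (hn : 0 < n) {t : ℝ} (ht : t ∈ Set.Icc (0 : ℝ) 1)
    (hg : t ∉ grid n) : ∃ k < n, t ∈ Set.Ioo ((k : ℝ) / n) (((k : ℝ) + 1) / n) := by
  obtain ⟨k, hk, h⟩ := exists_Icc_of_mem hn ht
  refine ⟨k, hk, lt_of_le_of_ne h.1 fun h' => hg ⟨k, h'⟩, lt_of_le_of_ne h.2 fun h' => hg ⟨k + 1, ?_⟩⟩
  simp [h']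

/-- The open square number `c` of the `n × n` mesh. -/
def ocell (n : ℕ) (c : ℕ × ℕ) : Set (ℝ × ℝ) :=
  Set.Ioo ((c.1 : ℝ) / n) (((c.1 : ℝ) + 1) / n) ×ˢ Set.Ioo ((c.2 : ℝ) / n) (((c.2 : ℝ) + 1) / n)

theorem isOpen_ocell (n : ℕ) (c : ℕ × ℕ) : IsOpen (ocell n c) := isOpen_Ioo.prod isOpen_Ioo

theorem ocell_subset_cell (n : ℕ) (c : ℕ × ℕ) : ocell n c ⊆ cell n c :=
  Set.prod_mono Set.Ioo_subset_Icc_self Set.Ioo_subset_Icc_self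

theorem exists_ocell_of_mem_offGrid {n : ℕ} (hn : 0 < n) {x : ℝ × ℝ} (hx : x ∈ offGrid n) :
    ∃ c ∈ cells n, x ∈ ocell n c := by
  obtain ⟨⟨h1, h2⟩, g1, g2⟩ := hx
  obtain ⟨k, hk, h⟩ := exists_Ioo_of_notMem_grid hn (Set.Ioo_subset_Icc_self h1) g1
  obtain ⟨l, hl, h'⟩ := exists_Ioo_of_notMem_grid hn (Set.Ioo_subset_Icc_self h2) g2
  exact ⟨(k, l), by simp [cells, hk, hl], h, h'⟩

theorem exists_cell_of_mem {n : ℕ} (hn : 0 < n) {x : ℝ × ℝ}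
    (hx : x ∈ Set.Icc (0 : ℝ) 1 ×ˢ Set.Icc (0 : ℝ) 1) : ∃ c ∈ cells n, x ∈ cell n c := by
  obtain ⟨k, hk, h⟩ := exists_Icc_of_mem hn hx.1
  obtain ⟨l, hl, h'⟩ := exists_Icc_of_mem hn hx.2
  exact ⟨(k, l), by simp [cells, hk, hl], h, h'⟩

theorem Ioo_subset_Ioo_zero_one {n k : ℕ} (hk : k < n) :
    Set.Ioo ((k : ℝ) / n) (((k : ℝ) + 1) / n) ⊆ Set.Ioo 0 1 := by
  have hn' : (0 : ℝ) < n := Nat.cast_pos.2 (by omega)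
  apply Set.Ioo_subset_Ioo (by positivity)
  rw [div_le_one hn']; exact_mod_cast hk

theorem ocell_subset_Omega {n : ℕ} {c : ℕ × ℕ} (hc : c ∈ cells n) : ocell n c ⊆ Omega := by
  simp only [cells, Finset.mem_product, Finset.mem_range] at hc
  exact Set.prod_mono (Ioo_subset_Ioo_zero_one hc.1) (Ioo_subset_Ioo_zero_one hc.2)

theorem ocell_ae_eq_cell (n : ℕ) (c : ℕ × ℕ) : ocell n c =ᵐ[volume] cell n c :=
  Measure.set_prod_ae_eq Ioo_ae_eq_Icc Ioo_ae_eq_Icc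

theorem Omega_ae_eq : Omega =ᵐ[volume] Set.Icc (0 : ℝ) 1 ×ˢ Set.Icc (0 : ℝ) 1 :=
  Measure.set_prod_ae_eq Ioo_ae_eq_Icc Ioo_ae_eq_Icc

theorem index_eq_of_mem_Ioo {n k l : ℕ} {t : ℝ}
    (hk : t ∈ Set.Ioo ((k : ℝ) / n) (((k : ℝ) + 1) / n))
    (hl : t ∈ Set.Ioo ((l : ℝ) / n) (((l : ℝ) + 1) / n)) : k = l := by
  rcases Nat.eq_zero_or_pos n with rfl | hn
  · simp at hk
  have hn' : (0 : ℝ) < n := Nat.cast_pos.2 hn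
  have h1 : (k : ℝ) < l + 1 := (div_lt_div_iff_of_pos_right hn').1 (hk.1.trans hl.2)
  have h2 : (l : ℝ) < k + 1 := (div_lt_div_iff_of_pos_right hn').1 (hl.1.trans hk.2)
  have h1' : k < l + 1 := by exact_mod_cast h1
  have h2' : l < k + 1 := by exact_mod_cast h2
  omega

theorem cell_eq_of_mem_ocell {n : ℕ} {c d : ℕ × ℕ} {x : ℝ × ℝ} (hc : x ∈ ocell n c)
    (hd : x ∈ ocell n d) : c = d :=
  Prod.ext (index_eq_of_mem_Ioo hc.1 hd.1) (index_eq_of_mem_Ioo hc.2 hd.2)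

/-! ### Piecewise bilinear functions -/

/-- Interpolation at the corners of a rectangle: the multipliers of the four equations are the
unnormalized nodal basis functions. -/
theorem bilinear_eq_zero {a a' b b' α β γ δ : ℝ} (ha : a ≠ a') (hb : b ≠ b')
    (h1 : α + β * a + γ * b + δ * (a * b) = 0) (h2 : α + β * a' + γ * b + δ * (a' * b) = 0)
    (h3 : α + β * a + γ * b' + δ * (a * b') = 0) (h4 : α + β * a' + γ * b' + δ * (a' * b') = 0)
    (x y : ℝ) : α + β * x + γ * y + δ * (x * y) = 0 := by
  have h : (a' - a) * (b' - b) * (α + β * x + γ * y + δ * (x * y)) = 0 := by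
    linear_combination (a' - x) * (b' - y) * h1 + (x - a) * (b' - y) * h2 +
      (a' - x) * (y - b) * h3 + (x - a) * (y - b) * h4
  have h' : (a' - a) * (b' - b) ≠ 0 := mul_ne_zero (sub_ne_zero.2 ha.symm) (sub_ne_zero.2 hb.symm)
  exact (mul_eq_zero.1 h).resolve_left h'

/-- The grid point number `p` of the `n × n` mesh. -/
noncomputable def gridPt (n : ℕ) (p : ℕ × ℕ) : ℝ × ℝ := ((p.1 : ℝ) / n, (p.2 : ℝ) / n)

theorem eq_zero_on_cell {n : ℕ} (hn : 0 < n) {v : Fn} {c : ℕ × ℕ}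
    (hv : ∃ α β γ δ : ℝ, ∀ x ∈ cell n c, v x = α + β * x.1 + γ * x.2 + δ * (x.1 * x.2))
    (h0 : ∀ p, IsVertexOf p c → v (gridPt n p) = 0) : ∀ x ∈ cell n c, v x = 0 := by
  obtain ⟨α, β, γ, δ, h⟩ := hv
  have hn' : (0 : ℝ) < n := Nat.cast_pos.2 hn
  have key : ∀ e f : ℕ, e ≤ 1 → f ≤ 1 →
      α + β * (((c.1 : ℝ) + e) / n) + γ * (((c.2 : ℝ) + f) / n) +
        δ * ((((c.1 : ℝ) + e) / n) * (((c.2 : ℝ) + f) / n)) = 0 := by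
    intro e f he hf
    have hv : IsVertexOf (c.1 + e, c.2 + f) c := by
      constructor
      · show c.1 + e = _ ∨ c.1 + e = _
        omega
      · show c.2 + f = _ ∨ c.2 + f = _
        omega
    have h1 := h0 _ hv
    have he' : (e : ℝ) ≤ 1 := by exact_mod_cast he
    have hf' : (f : ℝ) ≤ 1 := by exact_mod_cast hf
    rw [h] at h1
    · simpa [gridPt] using h1
    · simp only [cell, gridPt, Set.mem_prod, Set.mem_Icc, Nat.cast_add]
      refine ⟨⟨?_, ?_⟩, ?_, ?_⟩ <;> apply div_le_div_of_nonneg_right _ hn'.le <;>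
        linarith
  intro x hx
  rw [h x hx]
  have hne : ∀ k : ℕ, ((k : ℝ) + (0 : ℕ)) / n ≠ ((k : ℝ) + (1 : ℕ)) / n := by
    intro k hk
    rw [div_left_inj' hn'.ne'] at hk
    simp at hk
  exact bilinear_eq_zero (hne c.1) (hne c.2) (key 0 0 (by simp) (by simp))
    (key 1 0 (by simp) (by simp)) (key 0 1 (by simp) (by simp)) (key 1 1 (by simp) (by simp)) _ _

theorem Vh_zero_of_notMem {n : ℕ} {v : Fn} (hv : v ∈ Vh n) {x : ℝ × ℝ} (hx : x ∉ Omega) :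
    v x = 0 := hv.2.1 x hx

theorem Vh_bilinear {n : ℕ} {v : Fn} (hv : v ∈ Vh n) {c : ℕ × ℕ} (hc : c ∈ cells n) :
    ∃ α β γ δ : ℝ, ∀ x ∈ cell n c, v x = α + β * x.1 + γ * x.2 + δ * (x.1 * x.2) := hv.2.2 c hc

theorem gridPt_mem_Omega {n : ℕ} {p : ℕ × ℕ} : gridPt n p ∈ Omega ↔ IsInteriorNode n p := by
  rcases Nat.eq_zero_or_pos n with rfl | hn
  · simp only [gridPt, Omega, IsInteriorNode]
    simp
  have hn' : (0 : ℝ) < n := Nat.cast_pos.2 hn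
  simp only [gridPt, Omega, IsInteriorNode, Set.mem_prod, Set.mem_Ioo, div_lt_one hn',
    div_pos_iff_of_pos_right hn', Nat.cast_pos, Nat.cast_lt]
  tauto

/-- A function in `V_h` is determined by its values at the interior vertices. -/
theorem Vh_eq_zero {n : ℕ} (hn : 0 < n) {v : Fn} (hv : v ∈ Vh n)
    (h0 : ∀ p, IsInteriorNode n p → v (gridPt n p) = 0) : v = 0 := by
  funext x
  by_cases hx : x ∈ Omega
  · obtain ⟨c, hc, hxc⟩ := exists_cell_of_mem hn
      (Set.prod_mono Set.Ioo_subset_Icc_self Set.Ioo_subset_Icc_self hx)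
    refine eq_zero_on_cell hn (Vh_bilinear hv hc) (fun p _ => ?_) x hxc
    by_cases hp : IsInteriorNode n p
    · exact h0 p hp
    · exact Vh_zero_of_notMem hv (fun h => hp (gridPt_mem_Omega.1 h))
  · exact Vh_zero_of_notMem hv hx

/-! ### Hat functions -/

/-- A hat is a product of two such profiles, so its bilinearity on cells and its support are read
off one variable at a time. -/
theorem hat_one_dim_affine {n : ℕ} (hn : 0 < n) (p k : ℕ) :
    ∃ α β : ℝ, (∀ t ∈ Set.Icc ((k : ℝ) / n) (((k : ℝ) + 1) / n),
      max 0 (1 - |(n : ℝ) * t - p|) = α + β * t) ∧ (p ≠ k → p ≠ k + 1 → α = 0 ∧ β = 0) ∧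
      (p = k → α = 1 + k ∧ β = -n) := by
  have hn' : (0 : ℝ) < n := Nat.cast_pos.2 hn
  have hs : ∀ t ∈ Set.Icc ((k : ℝ) / n) (((k : ℝ) + 1) / n),
      (k : ℝ) ≤ n * t ∧ (n : ℝ) * t ≤ k + 1 := fun t ht => by
    rw [Set.mem_Icc, div_le_iff₀ hn', le_div_iff₀ hn'] at ht
    constructor <;> nlinarith [ht.1, ht.2]
  rcases lt_trichotomy p k with h | h | h
  · refine ⟨0, 0, fun t ht => ?_, fun _ _ => ⟨rfl, rfl⟩, fun h' => by omega⟩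
    have h1 : (p : ℝ) + 1 ≤ k := by exact_mod_cast h
    rw [max_eq_left] <;> [simp; skip]
    rw [abs_of_nonneg] <;> linarith [(hs t ht).1]
  · refine ⟨1 + k, -n, fun t ht => ?_, fun h' => absurd h h', fun _ => ⟨rfl, rfl⟩⟩
    have h1 := hs t ht
    subst h
    rw [abs_of_nonneg (by linarith), max_eq_right (by linarith)]; ring
  · rcases Nat.eq_or_lt_of_le (Nat.succ_le_of_lt h) with h' | h'
    · refine ⟨-k, n, fun t ht => ?_, fun _ h'' => absurd h'.symm h'', fun h'' => by omega⟩
      have h1 := hs t ht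
      have h2 : (p : ℝ) = k + 1 := by rw [← h']; push_cast; ring
      rw [h2, abs_of_nonpos (by linarith), max_eq_right (by linarith)]; ring
    · refine ⟨0, 0, fun t ht => ?_, fun _ _ => ⟨rfl, rfl⟩, fun h' => by omega⟩
      have h1 : (k : ℝ) + 1 + 1 ≤ p := by exact_mod_cast h'
      rw [max_eq_left] <;> [simp; skip]
      rw [abs_of_nonpos] <;> linarith [(hs t ht).2]

theorem hat_eq_zero_on_cell {n : ℕ} (hn : 0 < n) {p c : ℕ × ℕ} (h : ¬ IsVertexOf p c) :
    ∀ x ∈ cell n c, hat n p x = 0 := by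
  intro x hx
  obtain ⟨α, β, h1, h2, -⟩ := hat_one_dim_affine hn p.1 c.1
  obtain ⟨α', β', h1', h2', -⟩ := hat_one_dim_affine hn p.2 c.2
  simp only [hat, h1 _ hx.1, h1' _ hx.2]
  rcases not_and_or.1 h with h' | h' <;> rw [not_or] at h'
  · obtain ⟨rfl, rfl⟩ := h2 h'.1 h'.2; simp
  · obtain ⟨rfl, rfl⟩ := h2' h'.1 h'.2; simp

theorem hat_mem_Vh {n : ℕ} (hn : 0 < n) {p : ℕ × ℕ} (hp : IsInteriorNode n p) : hat n p ∈ Vh n := by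
  refine ⟨by unfold hat; fun_prop, fun x hx => ?_, fun c _ => ?_⟩
  · have hn' : (0 : ℝ) < n := Nat.cast_pos.2 hn
    have key : ∀ (t : ℝ) (q : ℕ), 0 < q → q < n → t ∉ Set.Ioo (0 : ℝ) 1 →
        max 0 (1 - |(n : ℝ) * t - q|) = 0 := by
      intro t q hq hq' ht
      have h1 : (1 : ℝ) ≤ q := by exact_mod_cast hq
      have h2 : (q : ℝ) + 1 ≤ n := by exact_mod_cast hq'
      apply max_eq_left
      rw [Set.mem_Ioo, not_and_or, not_lt, not_lt] at ht
      rcases ht with ht | ht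
      · rw [abs_of_nonpos] <;> nlinarith
      · rw [abs_of_nonneg] <;> nlinarith
    simp only [hat]
    rw [Omega, Set.mem_prod, not_and_or] at hx
    rcases hx with hx | hx
    · rw [key _ _ hp.1 hp.2.1 hx, zero_mul]
    · rw [key _ _ hp.2.2.1 hp.2.2.2 hx, mul_zero]
  · obtain ⟨α, β, h, -⟩ := hat_one_dim_affine hn p.1 c.1
    obtain ⟨α', β', h', -⟩ := hat_one_dim_affine hn p.2 c.2
    refine ⟨α * α', β * α', α * β', β * β', fun x hx => ?_⟩
    rw [hat, h _ hx.1, h' _ hx.2]; ring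

theorem hat_gridPt {n : ℕ} (hn : 0 < n) (p q : ℕ × ℕ) :
    hat n p (gridPt n q) = if p = q then 1 else 0 := by
  have hn' : (n : ℝ) ≠ 0 := (Nat.cast_pos.2 hn).ne'
  have key : ∀ k l : ℕ, max 0 (1 - |(n : ℝ) * (l / n) - k|) = if k = l then (1 : ℝ) else 0 := by
    intro k l
    rw [mul_div_cancel₀ _ hn']
    split_ifs with h
    · simp [h]
    · apply max_eq_left
      have h1 : (1 : ℤ) ≤ |(l : ℤ) - k| := Int.one_le_abs (by omega)
      have h2 : (1 : ℝ) ≤ |(l : ℝ) - k| := by exact_mod_cast h1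
      linarith
  simp only [hat, gridPt, key, Prod.ext_iff]
  split_ifs <;> simp_all

/-- The numbers of the interior vertices. -/
def nodes (n : ℕ) : Finset (ℕ × ℕ) := Finset.Ioo 0 n ×ˢ Finset.Ioo 0 n

theorem mem_nodes {n : ℕ} {p : ℕ × ℕ} : p ∈ nodes n ↔ IsInteriorNode n p := by
  simp [nodes, IsInteriorNode, and_assoc]

theorem Vh_eq_sum_hat {n : ℕ} (hn : 0 < n) {v : Fn} (hv : v ∈ Vh n) :
    v = ∑ p ∈ nodes n, v (gridPt n p) • hat n p := by
  rw [← sub_eq_zero]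
  apply Vh_eq_zero hn
  · exact sub_mem hv (sum_mem fun p hp => (Vh n).smul_mem _ (hat_mem_Vh hn (mem_nodes.1 hp)))
  · intro q hq
    have hq' := mem_nodes.2 hq
    simp [Finset.sum_apply, hat_gridPt hn, hq']

theorem Vh_eq_span {n : ℕ} (hn : 0 < n) : Vh n = Submodule.span ℝ (hat n '' (nodes n : Set (ℕ × ℕ))) := by
  apply le_antisymm
  · intro v hv
    rw [Vh_eq_sum_hat hn hv]
    exact sum_mem fun p hp => Submodule.smul_mem _ _ (Submodule.subset_span ⟨p, hp, rfl⟩)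
  · rw [Submodule.span_le]
    rintro _ ⟨p, hp, rfl⟩
    exact hat_mem_Vh hn (mem_nodes.1 hp)

theorem finiteDimensional_Vh {n : ℕ} (hn : 0 < n) : FiniteDimensional ℝ (Vh n) := by
  rw [Vh_eq_span hn]
  exact FiniteDimensional.span_of_finite ℝ ((nodes n).finite_toSet.image _)

/-! ### Partial derivatives -/

/-- Interchanging the coordinates preserves V_h and exchanges `pd1` with `pd2`, so facts about `pd2`
need no separate proof. -/
theorem Vh_swap {n : ℕ} {v : Fn} (hv : v ∈ Vh n) : v ∘ Prod.swap ∈ Vh n := by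
  refine ⟨hv.1.comp continuous_swap, fun x hx => hv.2.1 _ fun h => hx ⟨h.2, h.1⟩, fun c hc => ?_⟩
  have hc' : c.swap ∈ cells n := by
    simp only [cells, Finset.mem_product] at hc ⊢
    exact ⟨hc.2, hc.1⟩
  obtain ⟨a, b, g, d, h⟩ := hv.2.2 _ hc'
  refine ⟨a, g, b, d, fun x hx => ?_⟩
  rw [Function.comp, h x.swap ⟨hx.2, hx.1⟩, Prod.fst_swap, Prod.snd_swap]; ring

theorem measurable_pd1 {v : Fn} (hv : Continuous v) : Measurable (pd1 v) :=
  (measurable_deriv_with_param (𝕜 := ℝ) (f := fun (y t : ℝ) => v (t, y))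
    (hv.comp continuous_swap)).comp measurable_swap

theorem measurable_pd2 {v : Fn} (hv : Continuous v) : Measurable (pd2 v) :=
  (measurable_pd1 (hv.comp continuous_swap)).comp measurable_swap

/-- A uniform bound for the difference quotients in the first variable. -/
theorem exists_bound_pd1 {n : ℕ} (hn : 0 < n) {v : Fn} (hv : v ∈ Vh n) :
    ∃ C : ℝ, ∀ y ∈ Set.Icc (0 : ℝ) 1, ∀ t ∈ Set.Icc (0 : ℝ) 1, t ∉ grid n →
      HasDerivAt (fun s => v (s, y)) (pd1 v (t, y)) t ∧ |pd1 v (t, y)| ≤ C := by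
  choose! α β γ δ h using fun c hc => Vh_bilinear hv (c := c) hc
  -- On a cell the derivative is β + δ y with 0 ≤ y ≤ 1. Only the variable of differentiation must
  -- avoid the mesh lines; y may lie on one, so that every horizontal slice is covered.
  refine ⟨∑ c ∈ cells n, (|β c| + |δ c|), fun y hy t ht hg => ?_⟩
  obtain ⟨k, hk, hk'⟩ := exists_Ioo_of_notMem_grid hn ht hg
  obtain ⟨l, hl, hl'⟩ := exists_Icc_of_mem hn hy
  have hc : (k, l) ∈ cells n := by simp [cells, hk, hl]
  have hd : HasDerivAt (fun s => v (s, y)) (β (k, l) + δ (k, l) * y) t := by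
    have h1 : HasDerivAt (fun s => α (k, l) + β (k, l) * s + γ (k, l) * y + δ (k, l) * (s * y))
        (β (k, l) + δ (k, l) * y) t := by
      have := ((((hasDerivAt_id t).const_mul (β (k, l))).const_add (α (k, l))).add_const
        (γ (k, l) * y)).add (((hasDerivAt_id t).mul_const y).const_mul (δ (k, l)))
      exact this.congr_deriv (by simp)
    refine h1.congr_of_eventuallyEq ?_
    filter_upwards [isOpen_Ioo.mem_nhds hk'] with s hs
    exact h _ hc _ ⟨Set.Ioo_subset_Icc_self hs, hl'⟩
  have he : pd1 v (t, y) = β (k, l) + δ (k, l) * y := hd.deriv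
  refine ⟨he ▸ hd, ?_⟩
  rw [he]
  calc |β (k, l) + δ (k, l) * y| ≤ |β (k, l)| + |δ (k, l)| * |y| := by
        rw [← abs_mul]; exact abs_add_le _ _
    _ ≤ |β (k, l)| + |δ (k, l)| := by
        have : |y| ≤ 1 := abs_le.2 ⟨by linarith [hy.1], hy.2⟩
        nlinarith [abs_nonneg (δ (k, l))]
    _ ≤ _ := Finset.single_le_sum (f := fun c => |β c| + |δ c|)
        (fun c _ => by positivity) hc

theorem hasDerivAt_pd1 {n : ℕ} (hn : 0 < n) {v : Fn} (hv : v ∈ Vh n) {x : ℝ × ℝ}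
    (hx : x ∈ offGrid n) : HasDerivAt (fun s => v (s, x.2)) (pd1 v x) x.1 :=
  ((exists_bound_pd1 hn hv).choose_spec x.2 (Set.Ioo_subset_Icc_self hx.1.2) x.1
    (Set.Ioo_subset_Icc_self hx.1.1) hx.2.1).1

theorem swap_mem_offGrid {n : ℕ} {x : ℝ × ℝ} (hx : x ∈ offGrid n) : x.swap ∈ offGrid n :=
  ⟨⟨hx.1.2, hx.1.1⟩, hx.2.2, hx.2.1⟩

theorem pd1_add {n : ℕ} (hn : 0 < n) {u v : Fn} (hu : u ∈ Vh n) (hv : v ∈ Vh n) {x : ℝ × ℝ}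
    (hx : x ∈ offGrid n) : pd1 (u + v) x = pd1 u x + pd1 v x :=
  ((hasDerivAt_pd1 hn hu hx).add (hasDerivAt_pd1 hn hv hx)).deriv

theorem pd2_add {n : ℕ} (hn : 0 < n) {u v : Fn} (hu : u ∈ Vh n) (hv : v ∈ Vh n) {x : ℝ × ℝ}
    (hx : x ∈ offGrid n) : pd2 (u + v) x = pd2 u x + pd2 v x :=
  pd1_add hn (Vh_swap hu) (Vh_swap hv) (swap_mem_offGrid hx)

theorem pd1_smul {n : ℕ} (hn : 0 < n) (t : ℝ) {v : Fn} (hv : v ∈ Vh n) {x : ℝ × ℝ}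
    (hx : x ∈ offGrid n) : pd1 (t • v) x = t * pd1 v x :=
  ((hasDerivAt_pd1 hn hv hx).const_mul t).deriv

theorem pd2_smul {n : ℕ} (hn : 0 < n) (t : ℝ) {v : Fn} (hv : v ∈ Vh n) {x : ℝ × ℝ}
    (hx : x ∈ offGrid n) : pd2 (t • v) x = t * pd2 v x :=
  pd1_smul hn t (Vh_swap hv) (swap_mem_offGrid hx)

theorem pd1_congr {u v : Fn} {x : ℝ × ℝ} (h : u =ᶠ[nhds x] v) : pd1 u x = pd1 v x := by
  apply Filter.EventuallyEq.deriv_eq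
  have hc : Filter.Tendsto (fun t : ℝ => (t, x.2)) (nhds x.1) (nhds x) := by
    have : Continuous fun t : ℝ => (t, x.2) := by fun_prop
    simpa using this.tendsto x.1
  exact hc.eventually h

theorem pd2_congr {u v : Fn} {x : ℝ × ℝ} (h : u =ᶠ[nhds x] v) : pd2 u x = pd2 v x := by
  apply Filter.EventuallyEq.deriv_eq
  have hc : Filter.Tendsto (fun t : ℝ => (x.1, t)) (nhds x.2) (nhds x) := by
    have : Continuous fun t : ℝ => (x.1, t) := by fun_prop
    simpa using this.tendsto x.2
  exact hc.eventually h

theorem pd1_const (a : ℝ) (x : ℝ × ℝ) : pd1 (fun _ => a) x = 0 := by simp [pd1]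

theorem pd2_const (a : ℝ) (x : ℝ × ℝ) : pd2 (fun _ => a) x = 0 := by simp [pd2]

end SpectralLOD


/-! ### The energy and mass forms: bilinearity, comparison, splitting over cells, definiteness. -/

namespace SpectralLOD

/-! ### Integrability and bilinearity of the forms -/

/-- The standing assumption on the coefficient: `1 ≤ κ ≤ β` almost everywhere. -/
structure CoeffBounds (κ : Fn) (β : ℝ) : Prop where
  aemeasurable : AEMeasurable κ (volume.restrict Omega)
  bounds : ∀ᵐ x ∂(volume.restrict Omega), 1 ≤ κ x ∧ κ x ≤ β

theorem coeffBounds_one : CoeffBounds (fun _ => 1) 1 :=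
  ⟨aemeasurable_const, Filter.Eventually.of_forall fun _ => ⟨le_rfl, le_rfl⟩⟩

instance : IsFiniteMeasure (volume.restrict Omega) := by
  refine ⟨?_⟩
  rw [Measure.restrict_apply_univ]
  exact (measure_mono (Set.prod_mono Set.Ioo_subset_Icc_self Set.Ioo_subset_Icc_self)).trans_lt
    (isCompact_Icc.prod isCompact_Icc).measure_lt_top

variable {n : ℕ} {κ : Fn} {β : ℝ} {D : Set (ℝ × ℝ)}

theorem restrict_ocell_eq (n : ℕ) (c : ℕ × ℕ) :
    (volume : Measure (ℝ × ℝ)).restrict (ocell n c) = volume.restrict (cell n c) :=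
  Measure.restrict_congr_set (ocell_ae_eq_cell n c)

theorem restrict_cell_le {c : ℕ × ℕ} (hc : c ∈ cells n) :
    (volume : Measure (ℝ × ℝ)).restrict (cell n c) ≤ volume.restrict Omega := by
  rw [← restrict_ocell_eq]
  exact Measure.restrict_mono (ocell_subset_Omega hc) le_rfl

theorem CoeffBounds.memLp (hκ : CoeffBounds κ β) : MemLp κ ⊤ (volume.restrict Omega) := by
  refine memLp_top_of_bound hκ.aemeasurable.aestronglyMeasurable β ?_
  filter_upwards [hκ.bounds] with x hx
  rw [Real.norm_eq_abs, abs_of_nonneg (by linarith [hx.1])]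
  exact hx.2

theorem memLp_top_of_continuous {v : Fn} (hv : Continuous v) :
    MemLp v ⊤ (volume.restrict Omega) := by
  obtain ⟨C, hC⟩ := (isCompact_Icc.prod isCompact_Icc).exists_bound_of_continuousOn
    (s := Set.Icc (0 : ℝ) 1 ×ˢ Set.Icc (0 : ℝ) 1) hv.continuousOn
  refine memLp_top_of_bound hv.aestronglyMeasurable C ?_
  filter_upwards [ae_restrict_mem measurableSet_Omega] with x hx
  exact hC x (Set.prod_mono Set.Ioo_subset_Icc_self Set.Ioo_subset_Icc_self hx)

theorem memLp_top_pd1 (hn : 0 < n) {v : Fn} (hv : v ∈ Vh n) :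
    MemLp (pd1 v) ⊤ (volume.restrict Omega) := by
  obtain ⟨C, hC⟩ := exists_bound_pd1 hn hv
  refine memLp_top_of_bound (measurable_pd1 hv.1).aestronglyMeasurable C ?_
  filter_upwards [ae_mem_offGrid n] with x hx
  exact (hC x.2 (Set.Ioo_subset_Icc_self hx.1.2) x.1 (Set.Ioo_subset_Icc_self hx.1.1) hx.2.1).2

theorem memLp_top_pd2 (hn : 0 < n) {v : Fn} (hv : v ∈ Vh n) :
    MemLp (pd2 v) ⊤ (volume.restrict Omega) := by
  obtain ⟨C, hC⟩ := exists_bound_pd1 hn (Vh_swap hv)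
  refine memLp_top_of_bound (measurable_pd2 hv.1).aestronglyMeasurable C ?_
  filter_upwards [ae_mem_offGrid n] with x hx
  exact (hC x.1 (Set.Ioo_subset_Icc_self hx.1.1) x.2 (Set.Ioo_subset_Icc_self hx.1.2) hx.2.2).2

theorem memLp_mul_top {α : Type*} [MeasurableSpace α] {μ : Measure α} {f g : α → ℝ}
    (hf : MemLp f ⊤ μ) (hg : MemLp g ⊤ μ) : MemLp (fun x => f x * g x) ⊤ μ :=
  MemLp.mul' (p := ⊤) (q := ⊤) (r := ⊤) hg hf

theorem integrable_energy (hn : 0 < n) (hκ : CoeffBounds κ β)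
    (hD : volume.restrict D ≤ volume.restrict Omega) {u v : Fn} (hu : u ∈ Vh n) (hv : v ∈ Vh n) :
    IntegrableOn (fun x => κ x * (pd1 u x * pd1 v x + pd2 u x * pd2 v x)) D := by
  have h : MemLp (fun x => κ x * (pd1 u x * pd1 v x + pd2 u x * pd2 v x)) ⊤
      (volume.restrict Omega) :=
    memLp_mul_top hκ.memLp ((memLp_mul_top (memLp_top_pd1 hn hu) (memLp_top_pd1 hn hv)).add
      (memLp_mul_top (memLp_top_pd2 hn hu) (memLp_top_pd2 hn hv)))
  exact (h.integrable le_top).mono_measure hD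

theorem integrable_mass (hκ : CoeffBounds κ β)
    (hD : volume.restrict D ≤ volume.restrict Omega) {u v : Fn} (hu : Continuous u)
    (hv : Continuous v) : IntegrableOn (fun x => κ x * u x * v x) D := by
  have h : MemLp (fun x => κ x * u x * v x) ⊤ (volume.restrict Omega) :=
    memLp_mul_top (memLp_mul_top hκ.memLp (memLp_top_of_continuous hu))
      (memLp_top_of_continuous hv)
  exact (h.integrable le_top).mono_measure hD

/-- `∫_D κ u v dx`. -/
noncomputable def massForm (D : Set (ℝ × ℝ)) (κ u v : Fn) : ℝ := ∫ x in D, κ x * u x * v x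

theorem energyForm_comm (u v : Fn) : energyForm D κ u v = energyForm D κ v u := by
  unfold energyForm; congr 1; funext x; ring

theorem massForm_comm (u v : Fn) : massForm D κ u v = massForm D κ v u := by
  unfold massForm; congr 1; funext x; ring

theorem ae_offGrid_of_le (n : ℕ) (hD : volume.restrict D ≤ volume.restrict Omega) :
    ∀ᵐ x ∂(volume.restrict D), x ∈ offGrid n := ae_mono hD (ae_mem_offGrid n)

theorem energyForm_add (hn : 0 < n) (hκ : CoeffBounds κ β)
    (hD : volume.restrict D ≤ volume.restrict Omega) {u v w : Fn} (hu : u ∈ Vh n) (hv : v ∈ Vh n)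
    (hw : w ∈ Vh n) : energyForm D κ (u + v) w = energyForm D κ u w + energyForm D κ v w := by
  unfold energyForm
  rw [← integral_add (integrable_energy hn hκ hD hu hw) (integrable_energy hn hκ hD hv hw)]
  apply integral_congr_ae
  filter_upwards [ae_offGrid_of_le n hD] with x hx
  rw [pd1_add hn hu hv hx, pd2_add hn hu hv hx]; ring

theorem energyForm_smul (hn : 0 < n) (hD : volume.restrict D ≤ volume.restrict Omega) (t : ℝ)
    {u w : Fn} (hu : u ∈ Vh n) : energyForm D κ (t • u) w = t * energyForm D κ u w := by
  unfold energyForm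
  rw [← integral_const_mul]
  apply integral_congr_ae
  filter_upwards [ae_offGrid_of_le n hD] with x hx
  rw [pd1_smul hn t hu hx, pd2_smul hn t hu hx]; ring

theorem massForm_add (hκ : CoeffBounds κ β)
    (hD : volume.restrict D ≤ volume.restrict Omega) {u v w : Fn} (hu : Continuous u)
    (hv : Continuous v) (hw : Continuous w) :
    massForm D κ (u + v) w = massForm D κ u w + massForm D κ v w := by
  unfold massForm
  rw [← integral_add (integrable_mass hκ hD hu hw) (integrable_mass hκ hD hv hw)]
  congr 1; funext x; simp only [Pi.add_apply]; ring

theorem massForm_smul (t : ℝ) (u w : Fn) : massForm D κ (t • u) w = t * massForm D κ u w := by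
  unfold massForm
  rw [← integral_const_mul]
  congr 1; funext x; simp only [Pi.smul_apply, smul_eq_mul]; ring

/-- The energy form as a bilinear form on `V_h`. -/
noncomputable def energyB (hn : 0 < n) (hκ : CoeffBounds κ β)
    (hD : volume.restrict D ≤ volume.restrict Omega) : LinearMap.BilinForm ℝ (Vh n) :=
  LinearMap.mk₂ ℝ (fun u v => energyForm D κ u v)
    (fun u v w => energyForm_add hn hκ hD u.2 v.2 w.2)
    (fun t u _ => energyForm_smul hn hD t u.2)
    (fun u v w => by
      rw [energyForm_comm, energyForm_comm (u : Fn), energyForm_comm (u : Fn)]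
      exact energyForm_add hn hκ hD v.2 w.2 u.2)
    (fun t u v => by
      rw [energyForm_comm, energyForm_comm (u : Fn)]
      exact energyForm_smul hn hD t v.2)

theorem energyForm_one_le (hn : 0 < n) (hκ : CoeffBounds κ β)
    (hD : volume.restrict D ≤ volume.restrict Omega) {v : Fn} (hv : v ∈ Vh n) :
    energyForm D (fun _ => 1) v v ≤ energyForm D κ v v := by
  apply integral_mono_ae (integrable_energy hn coeffBounds_one hD hv hv)
    (integrable_energy hn hκ hD hv hv)
  filter_upwards [ae_mono hD hκ.bounds] with x hx
  exact mul_le_mul_of_nonneg_right hx.1 (add_nonneg (mul_self_nonneg _) (mul_self_nonneg _))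

theorem energyForm_one_self_nonneg (v : Fn) : 0 ≤ energyForm D (fun _ => 1) v v :=
  integral_nonneg fun _ =>
    mul_nonneg zero_le_one (add_nonneg (mul_self_nonneg _) (mul_self_nonneg _))

theorem energyForm_self_nonneg (hn : 0 < n) (hκ : CoeffBounds κ β)
    (hD : volume.restrict D ≤ volume.restrict Omega) {v : Fn} (hv : v ∈ Vh n) :
    0 ≤ energyForm D κ v v :=
  (energyForm_one_self_nonneg v).trans (energyForm_one_le hn hκ hD hv)

theorem massForm_one_self_nonneg (v : Fn) : 0 ≤ massForm D (fun _ => 1) v v :=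
  integral_nonneg fun x => by
    simp only [one_mul]; exact mul_self_nonneg _

theorem massForm_one_le (hκ : CoeffBounds κ β)
    (hD : volume.restrict D ≤ volume.restrict Omega) {v : Fn} (hv : Continuous v) :
    massForm D (fun _ => 1) v v ≤ massForm D κ v v := by
  apply integral_mono_ae (integrable_mass coeffBounds_one hD hv hv) (integrable_mass hκ hD hv hv)
  filter_upwards [ae_mono hD hκ.bounds] with x hx
  nlinarith [mul_self_nonneg (v x), hx.1]

theorem massForm_le (hκ : CoeffBounds κ β)
    (hD : volume.restrict D ≤ volume.restrict Omega) {v : Fn} (hv : Continuous v) :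
    massForm D κ v v ≤ β * massForm D (fun _ => 1) v v := by
  unfold massForm
  rw [← integral_const_mul]
  apply integral_mono_ae (integrable_mass hκ hD hv hv)
    ((integrable_mass coeffBounds_one hD hv hv).const_mul β)
  filter_upwards [ae_mono hD hκ.bounds] with x hx
  nlinarith [mul_self_nonneg (v x), hx.2]

theorem CoeffBounds.one_le (hκ : CoeffBounds κ β) : 1 ≤ β := by
  have h0 : volume Omega ≠ 0 :=
    (isOpen_Omega.measure_pos volume ⟨(1 / 2, 1 / 2), by constructor <;> norm_num⟩).ne'
  have : (volume.restrict Omega) ≠ 0 := by simpa using h0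
  have := ae_neBot.2 this
  obtain ⟨x, hx⟩ := hκ.bounds.exists
  exact hx.1.trans hx.2

/-! ### Decomposition into the coarse squares -/

theorem Omega_ae_eq_iUnion (hn : 0 < n) : Omega =ᵐ[volume] ⋃ c ∈ cells n, ocell n c := by
  refine Filter.EventuallyLE.antisymm ?_ ?_
  · filter_upwards [ae_notMem_grid n] with x hx hO
    obtain ⟨c, hc, hxc⟩ := exists_ocell_of_mem_offGrid hn ⟨hO, hx⟩
    exact Set.mem_biUnion hc hxc
  · refine Filter.Eventually.of_forall fun x hx => ?_
    obtain ⟨c, hc, hxc⟩ := Set.mem_iUnion₂.1 hx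
    exact ocell_subset_Omega hc hxc

/-- The additivity is applied to the open squares, which are disjoint; the closed ones overlap in
null sets. -/
theorem setIntegral_Omega_eq_sum (hn : 0 < n) {g : Fn} (hg : IntegrableOn g Omega) :
    ∫ x in Omega, g x = ∑ c ∈ cells n, ∫ x in cell n c, g x := by
  have hd : (cells n : Set (ℕ × ℕ)).PairwiseDisjoint (ocell n) := by
    intro c _ d _ hcd
    change Disjoint (ocell n c) (ocell n d)
    rw [Set.disjoint_left]
    intro x hx hx'
    exact hcd (cell_eq_of_mem_ocell hx hx')
  rw [setIntegral_congr_set (Omega_ae_eq_iUnion hn), integral_biUnion_finset (s := ocell n)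
    (cells n) (fun c _ => (isOpen_ocell n c).measurableSet) hd
    (fun c hc => hg.mono_set (ocell_subset_Omega hc))]
  exact Finset.sum_congr rfl fun c _ => by rw [restrict_ocell_eq]

theorem energyForm_Omega_eq_sum {N : ℕ} (hN : 0 < N) (hn : 0 < n) (hκ : CoeffBounds κ β) {u v : Fn}
    (hu : u ∈ Vh n) (hv : v ∈ Vh n) :
    energyForm Omega κ u v = ∑ i ∈ cells N, energyForm (cell N i) κ u v :=
  setIntegral_Omega_eq_sum hN (integrable_energy hn hκ le_rfl hu hv)

theorem massForm_Omega_eq_sum {N : ℕ} (hN : 0 < N) (hκ : CoeffBounds κ β) {u v : Fn}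
    (hu : Continuous u) (hv : Continuous v) :
    massForm Omega κ u v = ∑ i ∈ cells N, massForm (cell N i) κ u v :=
  setIntegral_Omega_eq_sum hN (integrable_mass hκ le_rfl hu hv)

/-! ### Definiteness of the mass forms -/

theorem eq_zero_of_massForm_one_eq_zero {U : Set (ℝ × ℝ)} (hU : IsOpen U)
    (hU' : volume.restrict U ≤ volume.restrict Omega) {v : Fn} (hv : Continuous v)
    (h : massForm U (fun _ => 1) v v = 0) : ∀ x ∈ U, v x = 0 := by
  have h1 := (integral_eq_zero_iff_of_nonneg (fun x => by
    simp only [one_mul]; exact mul_self_nonneg _)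
    (integrable_mass coeffBounds_one hU' hv hv)).1 h
  have h2 := Measure.eqOn_open_of_ae_eq h1 hU
    ((continuous_const.mul hv).mul hv).continuousOn continuousOn_const
  intro x hx
  have := h2 hx
  simpa using this

theorem cell_subset_closure_ocell (hn : 0 < n) (c : ℕ × ℕ) : cell n c ⊆ closure (ocell n c) := by
  have hn' : (0 : ℝ) < n := Nat.cast_pos.2 hn
  have h : ∀ k : ℕ, (k : ℝ) / n ≠ ((k : ℝ) + 1) / n := fun k hk => by
    rw [div_left_inj' hn'.ne'] at hk; linarith
  rw [ocell, closure_prod_eq, closure_Ioo (h _), closure_Ioo (h _)]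
  rfl

theorem eq_zero_on_cell_of_massForm_one {c : ℕ × ℕ} (hc : c ∈ cells n) {v : Fn} (hv : Continuous v)
    (h : massForm (cell n c) (fun _ => 1) v v = 0) : ∀ x ∈ cell n c, v x = 0 := by
  have hn : 0 < n := by
    simp only [cells, Finset.mem_product, Finset.mem_range] at hc; omega
  have h1 : ∀ x ∈ ocell n c, v x = 0 := by
    refine eq_zero_of_massForm_one_eq_zero (isOpen_ocell n c) ?_ hv ?_
    · exact Measure.restrict_mono (ocell_subset_Omega hc) le_rfl
    · unfold massForm at h ⊢
      rwa [restrict_ocell_eq]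
  intro x hx
  exact closure_minimal (t := {x | v x = 0}) h1 (isClosed_eq hv continuous_const)
    (cell_subset_closure_ocell hn c hx)

theorem eq_zero_of_massForm_one_Omega {v : Fn} (hv : v ∈ Vh n)
    (h : massForm Omega (fun _ => 1) v v = 0) : v = 0 := by
  funext x
  by_cases hx : x ∈ Omega
  · exact eq_zero_of_massForm_one_eq_zero isOpen_Omega le_rfl hv.1 h x hx
  · exact hv.2.1 x hx

/-! ### Restriction to a coarse square -/

theorem restrictTo_eventuallyEq {N : ℕ} {i : ℕ × ℕ} (u : Fn) {x : ℝ × ℝ} (hx : x ∈ ocell N i) :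
    restrictTo (cell N i) u =ᶠ[nhds x] u := by
  filter_upwards [(isOpen_ocell N i).mem_nhds hx] with z hz
  exact Set.indicator_of_mem (ocell_subset_cell N i hz) u

theorem ae_mem_ocell (N : ℕ) (i : ℕ × ℕ) :
    ∀ᵐ x ∂((volume : Measure (ℝ × ℝ)).restrict (cell N i)), x ∈ ocell N i := by
  rw [← restrict_ocell_eq]
  exact ae_restrict_mem (isOpen_ocell N i).measurableSet

/-- The extension by zero may jump across the boundary of the square, but inside the open square it
agrees locally with the original function, and the boundary is a null set. -/
theorem energyForm_restrictTo {N : ℕ} {i : ℕ × ℕ} (u w : Fn) :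
    energyForm (cell N i) κ (restrictTo (cell N i) u) w = energyForm (cell N i) κ u w := by
  apply integral_congr_ae
  filter_upwards [ae_mem_ocell N i] with x hx
  rw [pd1_congr (restrictTo_eventuallyEq u hx), pd2_congr (restrictTo_eventuallyEq u hx)]

theorem energyForm_restrictTo_right {N : ℕ} {i : ℕ × ℕ} (u w : Fn) :
    energyForm (cell N i) κ w (restrictTo (cell N i) u) = energyForm (cell N i) κ w u := by
  rw [energyForm_comm, energyForm_restrictTo, energyForm_comm]

theorem massForm_restrictTo {N : ℕ} {i : ℕ × ℕ} (u w : Fn) :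
    massForm (cell N i) κ (restrictTo (cell N i) u) w = massForm (cell N i) κ u w := by
  apply integral_congr_ae
  filter_upwards [ae_mem_ocell N i] with x hx
  rw [(restrictTo_eventuallyEq u hx).eq_of_nhds]

theorem massForm_restrictTo_right {N : ℕ} {i : ℕ × ℕ} (u w : Fn) :
    massForm (cell N i) κ w (restrictTo (cell N i) u) = massForm (cell N i) κ w u := by
  rw [massForm_comm, massForm_restrictTo, massForm_comm]

end SpectralLOD


/-! ### Poincaré inequalities with explicit constants on intervals, rectangles and squares. -/

namespace SpectralLOD

/-! ### One-dimensional Poincaré inequalities -/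

theorem intervalIntegrable_of_bound {a b : ℝ} (hab : a ≤ b) {S : Set ℝ} (hS : S.Countable)
    {g : ℝ → ℝ} (hm : Measurable g) {C : ℝ} (hb : ∀ t ∈ Set.Ioo a b \ S, |g t| ≤ C) :
    IntervalIntegrable g volume a b := by
  rw [intervalIntegrable_iff_integrableOn_Ioo_of_le hab]
  refine Measure.integrableOn_of_bounded (M := C) (by simp) hm.aestronglyMeasurable ?_
  have h : ∀ᵐ t : ℝ, t ∉ S := compl_mem_ae_iff.2 (hS.measure_zero volume)
  filter_upwards [ae_restrict_of_ae h, ae_restrict_mem measurableSet_Ioo] with t ht ht'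
  exact hb t ⟨ht', ht⟩

theorem intervalIntegrable_sq_of_bound {a b : ℝ} (hab : a ≤ b) {S : Set ℝ} (hS : S.Countable)
    {g : ℝ → ℝ} (hm : Measurable g) {C : ℝ} (hb : ∀ t ∈ Set.Ioo a b \ S, |g t| ≤ C) :
    IntervalIntegrable (fun t => g t ^ 2) volume a b := by
  refine intervalIntegrable_of_bound hab hS (hm.pow_const 2) (C := C ^ 2) fun t ht => ?_
  rw [abs_pow]
  exact pow_le_pow_left₀ (abs_nonneg _) (hb t ht) 2

/-- The Poincaré inequality for functions that vanish at one end point of an interval, with a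
constant that is smaller than the best one. -/
theorem poincare_one_end_aux {a b e ω : ℝ} (hab : a < b) {S : Set ℝ} (hS : S.Countable)
    {g g' : ℝ → ℝ} (hg : Continuous g) (hm : Measurable g') {C : ℝ}
    (hd : ∀ t ∈ Set.Ioo a b \ S, HasDerivAt g (g' t) t ∧ |g' t| ≤ C)
    (he : e = b ∧ g a = 0 ∨ e = a ∧ g b = 0) (hω : 0 < ω)
    (hω' : ω < Real.pi / (2 * (b - a))) :
    ω ^ 2 * ∫ t in a..b, g t ^ 2 ≤ ∫ t in a..b, g' t ^ 2 := by
  have hba : 0 < b - a := sub_pos.2 hab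
  have hlt : ω * (b - a) < Real.pi / 2 := by
    rw [lt_div_iff₀ (by positivity)] at hω'
    linarith
  have hcos : ∀ t ∈ Set.Icc a b, 0 < Real.cos (ω * (e - t)) := by
    intro t ht
    apply Real.cos_pos_of_mem_Ioo
    rcases he with ⟨rfl, -⟩ | ⟨rfl, -⟩ <;> constructor <;> nlinarith [ht.1, ht.2]
  -- A Riccati-type substitution: T = tan(ω(e - t)) solves T' = -ω(1 + T²), so F' + ω² g² = 2ω g g'
  -- T - ω² g² T², which is at most g'² by completing the square. Since ω(b - a) < π/2, the tangent
  -- has no pole on [a, b].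
  let F : ℝ → ℝ := fun t => ω * g t ^ 2 * Real.tan (ω * (e - t))
  let F' : ℝ → ℝ := fun t => 2 * ω * g t * g' t * Real.tan (ω * (e - t)) -
    ω ^ 2 * g t ^ 2 * (1 + Real.tan (ω * (e - t)) ^ 2)
  have hT : ContinuousOn (fun t => Real.tan (ω * (e - t))) (Set.Icc a b) := by
    intro t ht
    apply ContinuousAt.continuousWithinAt
    exact ContinuousAt.comp (f := fun t => ω * (e - t)) (Real.continuousAt_tan.2 (hcos t ht).ne')
      (by fun_prop)
  have hFc : ContinuousOn F (Set.Icc a b) :=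
    (continuousOn_const.mul (hg.continuousOn.pow 2)).mul hT
  have hFd : ∀ t ∈ Set.Ioo a b \ S, HasDerivAt F (F' t) t := by
    intro t ht
    have hc := (hcos t (Set.Ioo_subset_Icc_self ht.1)).ne'
    have h1 : HasDerivAt (fun t => ω * (e - t)) (-ω) t := by
      have := ((hasDerivAt_id t).const_sub e).const_mul ω
      exact this.congr_deriv (by ring)
    have h2 := (Real.hasDerivAt_tan hc).comp t h1
    have h3 := (((hd t ht).1.pow 2).const_mul ω).mul h2
    refine h3.congr_deriv ?_
    have h4 : 1 / Real.cos (ω * (e - t)) ^ 2 = 1 + Real.tan (ω * (e - t)) ^ 2 := by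
      rw [Real.tan_eq_sin_div_cos, div_pow, eq_comm, ← sub_eq_zero]
      field_simp
      linarith [Real.sin_sq_add_cos_sq (ω * (e - t))]
    rw [h4]
    simp only [F', Function.comp, Pi.pow_apply]
    push_cast
    ring
  have hg'i : IntervalIntegrable g' volume a b :=
    intervalIntegrable_of_bound hab.le hS hm fun t ht => (hd t ht).2
  have hTu : ContinuousOn (fun t => Real.tan (ω * (e - t))) (Set.uIcc a b) := by
    rwa [Set.uIcc_of_le hab.le]
  have hF'i : IntervalIntegrable F' volume a b := by
    apply IntervalIntegrable.sub
    · have := (hg'i.continuousOn_mul (hTu.mul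
        (continuousOn_const.mul hg.continuousOn : ContinuousOn (fun t => 2 * ω * g t) _)))
      refine this.congr ?_
      intro t _
      simp only [Pi.mul_apply]
      ring
    · apply ContinuousOn.intervalIntegrable
      exact (continuousOn_const.mul (hg.continuousOn.pow 2)).mul
        (continuousOn_const.add (hTu.pow 2))
  -- F vanishes at both ends: at e because tan 0 = 0, at the other end because g does.
  have hF : ∫ t in a..b, F' t = 0 := by
    rw [integral_eq_of_hasDerivAt_off_countable_of_le F F' hab.le hS hFc hFd hF'i]
    rcases he with ⟨rfl, h⟩ | ⟨rfl, h⟩ <;> simp [F, h]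
  have hsq := intervalIntegrable_sq_of_bound hab.le hS hm fun t ht => (hd t ht).2
  have hgsq : IntervalIntegrable (fun t => ω ^ 2 * g t ^ 2) volume a b :=
    (continuous_const.mul (hg.pow 2)).intervalIntegrable a b
  have key : ∫ t in a..b, (F' t + ω ^ 2 * g t ^ 2) ≤ ∫ t in a..b, g' t ^ 2 := by
    apply intervalIntegral.integral_mono_on hab.le (hF'i.add hgsq) hsq
    intro t _
    have := sq_nonneg (g' t - ω * g t * Real.tan (ω * (e - t)))
    simp only [F']
    linarith
  rwa [intervalIntegral.integral_add hF'i hgsq, hF, zero_add,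
    intervalIntegral.integral_const_mul] at key

/-- The Poincaré inequality for functions that vanish at one end point of an interval. -/
theorem poincare_one_end {a b : ℝ} (hab : a < b) {S : Set ℝ} (hS : S.Countable)
    {g g' : ℝ → ℝ} (hg : Continuous g) (hm : Measurable g') {C : ℝ}
    (hd : ∀ t ∈ Set.Ioo a b \ S, HasDerivAt g (g' t) t ∧ |g' t| ≤ C)
    (h0 : g a = 0 ∨ g b = 0) :
    ∫ t in a..b, g t ^ 2 ≤ (2 * (b - a) / Real.pi) ^ 2 * ∫ t in a..b, g' t ^ 2 := by
  have hba : 0 < b - a := sub_pos.2 hab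
  have hpos : 0 < Real.pi / (2 * (b - a)) := by positivity
  obtain ⟨e, he⟩ : ∃ e, e = b ∧ g a = 0 ∨ e = a ∧ g b = 0 := by
    rcases h0 with h | h
    · exact ⟨b, Or.inl ⟨rfl, h⟩⟩
    · exact ⟨a, Or.inr ⟨rfl, h⟩⟩
  have h1 : (Real.pi / (2 * (b - a))) ^ 2 * ∫ t in a..b, g t ^ 2 ≤ ∫ t in a..b, g' t ^ 2 := by
    -- At the optimal frequency the tangent has a pole at an end point, so the sharp constant is
    -- reached only as a limit from below.
    have ht : Filter.Tendsto (fun ω : ℝ => ω ^ 2 * ∫ t in a..b, g t ^ 2)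
        (nhdsWithin (Real.pi / (2 * (b - a))) (Set.Iio (Real.pi / (2 * (b - a)))))
        (nhds ((Real.pi / (2 * (b - a))) ^ 2 * ∫ t in a..b, g t ^ 2)) :=
      (Continuous.tendsto (by fun_prop) _).mono_left nhdsWithin_le_nhds
    refine le_of_tendsto ht ?_
    filter_upwards [Ioo_mem_nhdsLT hpos] with ω hω
    exact poincare_one_end_aux hab hS hg hm hd he hω.1 hω.2
  have h2 : (2 * (b - a) / Real.pi) ^ 2 * (Real.pi / (2 * (b - a))) ^ 2 = 1 := by
    rw [← mul_pow, div_mul_div_comm, mul_comm, div_self, one_pow]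
    have := Real.pi_pos
    positivity
  calc ∫ t in a..b, g t ^ 2
      = (2 * (b - a) / Real.pi) ^ 2 * ((Real.pi / (2 * (b - a))) ^ 2 * ∫ t in a..b, g t ^ 2) := by
        rw [← mul_assoc, h2, one_mul]
    _ ≤ _ := mul_le_mul_of_nonneg_left h1 (sq_nonneg _)

/-- The right side exceeds the left by (k(b - a) - ∫ g)² / (b - a). Thus k need not be the mean;
below it is the value at the midpoint. -/
theorem intervalIntegral_sq_le {a b : ℝ} (hab : a < b) {g : ℝ → ℝ}
    (hg : IntervalIntegrable g volume a b)
    (hg2 : IntervalIntegrable (fun t => g t ^ 2) volume a b) (k : ℝ) :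
    ∫ t in a..b, g t ^ 2 ≤ (∫ t in a..b, (g t - k) ^ 2) + (∫ t in a..b, g t) ^ 2 / (b - a) := by
  have hba : 0 < b - a := sub_pos.2 hab
  have h : ∫ t in a..b, (g t - k) ^ 2 =
      (∫ t in a..b, g t ^ 2) - 2 * k * (∫ t in a..b, g t) + k ^ 2 * (b - a) := by
    have h1 : ∀ t, (g t - k) ^ 2 = g t ^ 2 - 2 * k * g t + k ^ 2 := fun t => by ring
    simp only [h1]
    rw [intervalIntegral.integral_add (hg2.sub (hg.const_mul _)) intervalIntegrable_const,
      intervalIntegral.integral_sub hg2 (hg.const_mul _), intervalIntegral.integral_const_mul,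
      intervalIntegral.integral_const]
    simp only [smul_eq_mul]; ring
  rw [h]
  have h2 : 0 ≤ (k * (b - a) - ∫ t in a..b, g t) ^ 2 / (b - a) := by positivity
  have h3 : (k * (b - a) - ∫ t in a..b, g t) ^ 2 / (b - a) =
      k ^ 2 * (b - a) - 2 * k * (∫ t in a..b, g t) + (∫ t in a..b, g t) ^ 2 / (b - a) := by
    field_simp
    ring
  linarith

theorem sq_intervalIntegral_le {a b : ℝ} (hab : a < b) {g : ℝ → ℝ}
    (hg : IntervalIntegrable g volume a b)
    (hg2 : IntervalIntegrable (fun t => g t ^ 2) volume a b) :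
    (∫ t in a..b, g t) ^ 2 ≤ (b - a) * ∫ t in a..b, g t ^ 2 := by
  have hba : 0 < b - a := sub_pos.2 hab
  set k := (∫ t in a..b, g t) / (b - a) with hk
  have h : ∫ t in a..b, (g t - k) ^ 2 =
      (∫ t in a..b, g t ^ 2) - 2 * k * (∫ t in a..b, g t) + k ^ 2 * (b - a) := by
    have h1 : ∀ t, (g t - k) ^ 2 = g t ^ 2 - 2 * k * g t + k ^ 2 := fun t => by ring
    simp only [h1]
    rw [intervalIntegral.integral_add (hg2.sub (hg.const_mul _)) intervalIntegrable_const,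
      intervalIntegral.integral_sub hg2 (hg.const_mul _), intervalIntegral.integral_const_mul,
      intervalIntegral.integral_const]
    simp only [smul_eq_mul]; ring
  have h0 : 0 ≤ ∫ t in a..b, (g t - k) ^ 2 :=
    intervalIntegral.integral_nonneg hab.le fun t _ => sq_nonneg _
  have hk' : ∫ t in a..b, g t = k * (b - a) := by rw [hk]; field_simp
  rw [h, hk'] at h0
  rw [hk']
  nlinarith

/-- The Poincaré-Wirtinger inequality on an interval. -/
theorem poincare_mean {a b : ℝ} (hab : a < b) {S : Set ℝ} (hS : S.Countable)
    {g g' : ℝ → ℝ} (hg : Continuous g) (hm : Measurable g') {C : ℝ}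
    (hd : ∀ t ∈ Set.Ioo a b \ S, HasDerivAt g (g' t) t ∧ |g' t| ≤ C) :
    ∫ t in a..b, g t ^ 2 ≤
      ((b - a) / Real.pi) ^ 2 * (∫ t in a..b, g' t ^ 2) + (∫ t in a..b, g t) ^ 2 / (b - a) := by
  -- After subtraction of g(c) the function vanishes at one end of each half interval, and halving
  -- the length turns the constant 2(b - a)/π into (b - a)/π.
  obtain ⟨c, hc⟩ : ∃ c, c = (a + b) / 2 := ⟨_, rfl⟩
  have hac : a < c := by linarith
  have hcb : c < b := by linarith
  have hgc : Continuous fun t => g t - g c := hg.sub continuous_const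
  have hsq : ∀ p q, p ≤ q → a ≤ p → q ≤ b →
      IntervalIntegrable (fun t => g' t ^ 2) volume p q := fun p q h hp hq =>
    intervalIntegrable_sq_of_bound h hS hm fun t ht =>
      (hd t ⟨⟨hp.trans_lt ht.1.1, ht.1.2.trans_le hq⟩, ht.2⟩).2
  have h1 := poincare_one_end hac hS hgc hm (C := C) (fun t ht =>
    ⟨(hd t ⟨⟨ht.1.1, ht.1.2.trans hcb⟩, ht.2⟩).1.sub_const _,
      (hd t ⟨⟨ht.1.1, ht.1.2.trans hcb⟩, ht.2⟩).2⟩) (Or.inr (sub_self _))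
  have h2 := poincare_one_end hcb hS hgc hm (C := C) (fun t ht =>
    ⟨(hd t ⟨⟨hac.trans ht.1.1, ht.1.2⟩, ht.2⟩).1.sub_const _,
      (hd t ⟨⟨hac.trans ht.1.1, ht.1.2⟩, ht.2⟩).2⟩) (Or.inl (sub_self _))
  have e1 : 2 * (c - a) / Real.pi = (b - a) / Real.pi := by rw [hc]; ring
  have e2 : 2 * (b - c) / Real.pi = (b - a) / Real.pi := by rw [hc]; ring
  rw [e1] at h1
  rw [e2] at h2
  have h3 := intervalIntegral_sq_le hab (hg.intervalIntegrable a b)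
    ((hg.pow 2).intervalIntegrable a b) (g c)
  have h4 : ∫ t in a..b, (g t - g c) ^ 2 =
      (∫ t in a..c, (g t - g c) ^ 2) + ∫ t in c..b, (g t - g c) ^ 2 :=
    (intervalIntegral.integral_add_adjacent_intervals ((hgc.pow 2).intervalIntegrable _ _)
      ((hgc.pow 2).intervalIntegrable _ _)).symm
  have h5 : ∫ t in a..b, g' t ^ 2 = (∫ t in a..c, g' t ^ 2) + ∫ t in c..b, g' t ^ 2 :=
    (intervalIntegral.integral_add_adjacent_intervals (hsq a c hac.le le_rfl hcb.le)
      (hsq c b hcb.le hac.le le_rfl)).symm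
  rw [h5, mul_add]
  linarith

/-! ### Poincaré inequalities on rectangles -/

theorem restrict_rect_le {a b c d : ℝ} (ha : 0 ≤ a) (hb : b ≤ 1) (hc : 0 ≤ c) (hd : d ≤ 1) :
    (volume : Measure (ℝ × ℝ)).restrict (Set.Icc a b ×ˢ Set.Icc c d) ≤ volume.restrict Omega := by
  rw [Measure.restrict_congr_set Omega_ae_eq]
  exact Measure.restrict_mono (Set.prod_mono (Set.Icc_subset_Icc ha hb)
    (Set.Icc_subset_Icc hc hd)) le_rfl

theorem setIntegral_rect {a b c d : ℝ} (hab : a ≤ b) (hcd : c ≤ d) {F : Fn}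
    (hF : IntegrableOn F (Set.Icc a b ×ˢ Set.Icc c d)) :
    ∫ z in Set.Icc a b ×ˢ Set.Icc c d, F z = ∫ y in c..d, ∫ x in a..b, F (x, y) := by
  have hF' : Integrable F ((volume.restrict (Set.Icc a b)).prod (volume.restrict (Set.Icc c d))) := by
    rwa [Measure.prod_restrict]
  rw [Measure.volume_eq_prod, ← Measure.prod_restrict, integral_prod_symm F hF',
    intervalIntegral.integral_of_le hcd, integral_Icc_eq_integral_Ioc]
  simp only [intervalIntegral.integral_of_le hab, integral_Icc_eq_integral_Ioc]

theorem intervalIntegrable_rect {a b c d : ℝ} (hab : a ≤ b) (hcd : c ≤ d) {F : Fn}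
    (hF : IntegrableOn F (Set.Icc a b ×ˢ Set.Icc c d)) :
    IntervalIntegrable (fun y => ∫ x in a..b, F (x, y)) volume c d := by
  have hF' : Integrable F ((volume.restrict (Set.Icc a b)).prod (volume.restrict (Set.Icc c d))) := by
    rwa [Measure.prod_restrict]
  rw [intervalIntegrable_iff_integrableOn_Icc_of_le hcd]
  have := hF'.integral_prod_right
  simp only [integral_Icc_eq_integral_Ioc] at this
  simp only [intervalIntegral.integral_of_le hab]
  exact this

variable {n : ℕ}

theorem integrableOn_sq {D : Set (ℝ × ℝ)} (hD : volume.restrict D ≤ volume.restrict Omega) {g : Fn}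
    (hg : MemLp g ⊤ (volume.restrict Omega)) : IntegrableOn (fun x => g x ^ 2) D := by
  have h := ((memLp_mul_top hg hg).integrable le_top).mono_measure hD
  simp only [← pow_two] at h
  exact h

theorem energyForm_one_eq (hn : 0 < n) {D : Set (ℝ × ℝ)}
    (hD : volume.restrict D ≤ volume.restrict Omega) {v : Fn} (hv : v ∈ Vh n) :
    energyForm D (fun _ => 1) v v = (∫ x in D, pd1 v x ^ 2) + ∫ x in D, pd2 v x ^ 2 := by
  rw [← integral_add (integrableOn_sq hD (memLp_top_pd1 hn hv))
    (integrableOn_sq hD (memLp_top_pd2 hn hv))]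
  unfold energyForm; congr 1; funext x; simp only; ring

theorem massForm_one_eq (D : Set (ℝ × ℝ)) (v : Fn) :
    massForm D (fun _ => 1) v v = ∫ x in D, v x ^ 2 := by
  simp only [massForm, one_mul, pow_two]

theorem slice_deriv (hn : 0 < n) {v : Fn} (hv : v ∈ Vh n) : ∃ C : ℝ, ∀ y ∈ Set.Icc (0 : ℝ) 1,
    ∀ a b : ℝ, 0 ≤ a → b ≤ 1 → ∀ t ∈ Set.Ioo a b \ grid n,
      HasDerivAt (fun s => v (s, y)) (pd1 v (t, y)) t ∧ |pd1 v (t, y)| ≤ C := by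
  obtain ⟨C, hC⟩ := exists_bound_pd1 hn hv
  exact ⟨C, fun y hy a b ha hb t ht =>
    hC y hy t ⟨ha.trans ht.1.1.le, ht.1.2.le.trans hb⟩ ht.2⟩

/-- The interval inequality is integrated over the horizontal slices; the energy of the other
partial derivative is simply added. -/
theorem poincare_rect_one_side (hn : 0 < n) {v : Fn} (hv : v ∈ Vh n) {a b c d : ℝ} (ha : 0 ≤ a)
    (hab : a < b) (hb : b ≤ 1) (hc : 0 ≤ c) (hcd : c < d) (hd : d ≤ 1)
    (h0 : ∀ y, v (a, y) = 0 ∨ v (b, y) = 0) :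
    massForm (Set.Icc a b ×ˢ Set.Icc c d) (fun _ => 1) v v ≤ (2 * (b - a) / Real.pi) ^ 2 *
      energyForm (Set.Icc a b ×ˢ Set.Icc c d) (fun _ => 1) v v := by
  have hD := restrict_rect_le ha hb hc hd
  have i0 := integrableOn_sq hD (memLp_top_of_continuous hv.1)
  have i1 := integrableOn_sq hD (memLp_top_pd1 hn hv)
  obtain ⟨C, hC⟩ := slice_deriv hn hv
  have h1 : massForm (Set.Icc a b ×ˢ Set.Icc c d) (fun _ => 1) v v ≤
      (2 * (b - a) / Real.pi) ^ 2 * ∫ x in Set.Icc a b ×ˢ Set.Icc c d, pd1 v x ^ 2 := by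
    rw [massForm_one_eq, setIntegral_rect hab.le hcd.le i0, setIntegral_rect hab.le hcd.le i1,
      ← intervalIntegral.integral_const_mul]
    apply intervalIntegral.integral_mono_on hcd.le (intervalIntegrable_rect hab.le hcd.le i0)
      ((intervalIntegrable_rect hab.le hcd.le i1).const_mul _)
    intro y hy
    exact poincare_one_end (g := fun t => v (t, y)) (g' := fun t => pd1 v (t, y)) hab
      (countable_grid n) (hv.1.comp (by fun_prop))
      ((measurable_pd1 hv.1).comp (by fun_prop)) (hC y ⟨hc.trans hy.1, hy.2.trans hd⟩ a b ha hb)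
      (h0 y)
  refine h1.trans (mul_le_mul_of_nonneg_left ?_ (sq_nonneg _))
  rw [energyForm_one_eq hn hD hv]
  exact le_add_of_nonneg_right (integral_nonneg fun x => sq_nonneg _)

theorem massForm_swap {s t : Set ℝ} (v : Fn) :
    massForm (s ×ˢ t) (fun _ => 1) (v ∘ Prod.swap) (v ∘ Prod.swap) =
      massForm (t ×ˢ s) (fun _ => 1) v v := by
  rw [massForm_one_eq, massForm_one_eq, Measure.volume_eq_prod]
  exact setIntegral_prod_swap t s fun x => v x ^ 2

theorem energyForm_swap {s t : Set ℝ} (v : Fn) :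
    energyForm (s ×ˢ t) (fun _ => 1) (v ∘ Prod.swap) (v ∘ Prod.swap) =
      energyForm (t ×ˢ s) (fun _ => 1) v v := by
  unfold energyForm
  rw [Measure.volume_eq_prod, ← setIntegral_prod_swap]
  congr 1; funext x
  have e1 : pd1 (v ∘ Prod.swap) x.swap = pd2 v x := rfl
  have e2 : pd2 (v ∘ Prod.swap) x.swap = pd1 v x := rfl
  rw [e1, e2]; ring

theorem Ioo_disjoint_grid (hn : 0 < n) (k : ℕ) {t : ℝ}
    (ht : t ∈ Set.Ioo ((k : ℝ) / n) (((k : ℝ) + 1) / n)) : t ∉ grid n := by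
  rintro ⟨l, rfl⟩
  have hn' : (0 : ℝ) < n := Nat.cast_pos.2 hn
  have h1 : (k : ℝ) < l := (div_lt_div_iff_of_pos_right hn').1 ht.1
  have h2 : (l : ℝ) < k + 1 := (div_lt_div_iff_of_pos_right hn').1 ht.2
  have h1' : k < l := by exact_mod_cast h1
  have h2' : l < k + 1 := by exact_mod_cast h2
  omega

/-- Differentiation under the integral sign inside a mesh strip, where the uniform derivative bound
dominates. It prepares the one-dimensional inequality for the slice integrals. -/
theorem hasDerivAt_integral_slice (hn : 0 < n) {v : Fn} (hv : v ∈ Vh n) {a b : ℝ} (ha : 0 ≤ a)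
    (hab : a ≤ b) (hb : b ≤ 1) : ∃ C : ℝ, ∀ y ∈ Set.Icc (0 : ℝ) 1 \ grid n,
      HasDerivAt (fun y => ∫ x in a..b, v (x, y)) (∫ x in a..b, pd2 v (x, y)) y ∧
        |∫ x in a..b, pd2 v (x, y)| ≤ C := by
  obtain ⟨C, hC⟩ := exists_bound_pd1 hn (Vh_swap hv)
  have hC' : ∀ x ∈ Set.uIoc a b, ∀ y ∈ Set.Icc (0 : ℝ) 1, y ∉ grid n →
      HasDerivAt (fun s => v (x, s)) (pd2 v (x, y)) y ∧ |pd2 v (x, y)| ≤ C := by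
    intro x hx y hy hg
    rw [Set.uIoc_of_le hab] at hx
    exact hC x ⟨ha.trans hx.1.le, hx.2.trans hb⟩ y hy hg
  refine ⟨C * |b - a|, fun y hy => ⟨?_, ?_⟩⟩
  · obtain ⟨k, hk, hk'⟩ := exists_Ioo_of_notMem_grid hn hy.1 hy.2
    refine (intervalIntegral.hasDerivAt_integral_of_dominated_loc_of_deriv_le
      (F := fun y x => v (x, y)) (F' := fun y x => pd2 v (x, y)) (bound := fun _ => C)
      (isOpen_Ioo.mem_nhds hk') ?_ ?_ ?_ ?_ ?_ ?_).2
    · exact Filter.Eventually.of_forall fun y =>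
        (hv.1.comp (by fun_prop : Continuous fun x : ℝ => (x, y))).aestronglyMeasurable
    · exact (hv.1.comp (by fun_prop : Continuous fun x : ℝ => (x, y))).intervalIntegrable _ _
    · exact ((measurable_pd2 hv.1).comp
        (by fun_prop : Measurable fun x : ℝ => (x, y))).aestronglyMeasurable
    · refine Filter.Eventually.of_forall fun x hx z hz => ?_
      exact (hC' x hx z (Set.Ioo_subset_Icc_self (Ioo_subset_Ioo_zero_one hk hz))
        (Ioo_disjoint_grid hn k hz)).2
    · exact intervalIntegrable_const
    · refine Filter.Eventually.of_forall fun x hx z hz => ?_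
      exact (hC' x hx z (Set.Ioo_subset_Icc_self (Ioo_subset_Ioo_zero_one hk hz))
        (Ioo_disjoint_grid hn k hz)).1
  · rw [← Real.norm_eq_abs]
    exact intervalIntegral.norm_integral_le_of_norm_le_const fun x hx => by
      rw [Real.norm_eq_abs]; exact (hC' x hx y hy.1 hy.2).2

/-- With W(y) = ∫ v(x, y) dx, the slicewise inequality leaves the remainder ∫ W² / (b - a). Since W
has integral zero, the interval inequality applies to W, and W'² ≤ (b - a) ∫ (∂₂v)² dx by
Cauchy-Schwarz cancels the denominator. Equal side lengths make the two constants agree. -/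
theorem poincare_square_mean (hn : 0 < n) {v : Fn} (hv : v ∈ Vh n) {a b c d : ℝ} (ha : 0 ≤ a)
    (hab : a < b) (hb : b ≤ 1) (hc : 0 ≤ c) (hcd : c < d) (hd : d ≤ 1) (hsq : d - c = b - a)
    (h0 : ∫ z in Set.Icc a b ×ˢ Set.Icc c d, v z = 0) :
    massForm (Set.Icc a b ×ˢ Set.Icc c d) (fun _ => 1) v v ≤ ((b - a) / Real.pi) ^ 2 *
      energyForm (Set.Icc a b ×ˢ Set.Icc c d) (fun _ => 1) v v := by
  have hba : 0 < b - a := sub_pos.2 hab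
  have hD := restrict_rect_le ha hb hc hd
  have iv : IntegrableOn v (Set.Icc a b ×ˢ Set.Icc c d) :=
    ((memLp_top_of_continuous hv.1).integrable le_top).mono_measure hD
  have i0 := integrableOn_sq hD (memLp_top_of_continuous hv.1)
  have i1 := integrableOn_sq hD (memLp_top_pd1 hn hv)
  have i2 := integrableOn_sq hD (memLp_top_pd2 hn hv)
  obtain ⟨C, hC⟩ := slice_deriv hn hv
  obtain ⟨C₂, hC₂⟩ := exists_bound_pd1 hn (Vh_swap hv)
  obtain ⟨C', hC'⟩ := hasDerivAt_integral_slice hn hv ha hab.le hb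
  have hW : Continuous fun y => ∫ x in a..b, v (x, y) :=
    intervalIntegral.continuous_parametric_intervalIntegral_of_continuous'
      (f := fun y x => v (x, y)) (hv.1.comp (by fun_prop : Continuous fun z : ℝ × ℝ => (z.2, z.1))) a b
  have hW' : Measurable fun y => ∫ x in a..b, pd2 v (x, y) := by
    simp only [intervalIntegral.integral_of_le hab.le]
    exact (((measurable_pd2 hv.1).stronglyMeasurable).integral_prod_left'
      (μ := volume.restrict (Set.Ioc a b))).measurable
  have iW : IntervalIntegrable (fun y => (∫ x in a..b, v (x, y)) ^ 2) volume c d :=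
    (hW.pow 2).intervalIntegrable c d
  have hCd : ∀ y ∈ Set.Ioo c d \ grid n, y ∈ Set.Icc (0 : ℝ) 1 \ grid n := fun y hy =>
    ⟨⟨hc.trans hy.1.1.le, hy.1.2.le.trans hd⟩, hy.2⟩
  have iW' := intervalIntegrable_sq_of_bound hcd.le (countable_grid n) hW'
    fun y hy => (hC' y (hCd y hy)).2
  have s1 : massForm (Set.Icc a b ×ˢ Set.Icc c d) (fun _ => 1) v v ≤
      ((b - a) / Real.pi) ^ 2 * (∫ x in Set.Icc a b ×ˢ Set.Icc c d, pd1 v x ^ 2) +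
        (∫ y in c..d, (∫ x in a..b, v (x, y)) ^ 2) / (b - a) := by
    rw [massForm_one_eq, setIntegral_rect hab.le hcd.le i0, setIntegral_rect hab.le hcd.le i1,
      ← intervalIntegral.integral_const_mul, ← intervalIntegral.integral_div,
      ← intervalIntegral.integral_add ((intervalIntegrable_rect hab.le hcd.le i1).const_mul _)
        (iW.div_const _)]
    apply intervalIntegral.integral_mono_on hcd.le (intervalIntegrable_rect hab.le hcd.le i0)
      (((intervalIntegrable_rect hab.le hcd.le i1).const_mul _).add (iW.div_const _))
    intro y hy
    exact poincare_mean (g := fun t => v (t, y)) (g' := fun t => pd1 v (t, y)) hab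
      (countable_grid n) (hv.1.comp (by fun_prop))
      ((measurable_pd1 hv.1).comp (by fun_prop)) (hC y ⟨hc.trans hy.1, hy.2.trans hd⟩ a b ha hb)
  have s2 := poincare_mean hcd (countable_grid n) hW hW' fun y hy => hC' y (hCd y hy)
  rw [← setIntegral_rect hab.le hcd.le iv, h0, hsq] at s2
  have s3 : ∫ y in c..d, (∫ x in a..b, pd2 v (x, y)) ^ 2 ≤
      (b - a) * ∫ x in Set.Icc a b ×ˢ Set.Icc c d, pd2 v x ^ 2 := by
    rw [setIntegral_rect hab.le hcd.le i2, ← intervalIntegral.integral_const_mul]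
    have hae : ∀ᵐ y : ℝ, y ∉ grid n :=
      compl_mem_ae_iff.2 ((countable_grid n).measure_zero volume)
    apply intervalIntegral.integral_mono_ae_restrict hcd.le iW'
      ((intervalIntegrable_rect hab.le hcd.le i2).const_mul _)
    filter_upwards [ae_restrict_of_ae hae, ae_restrict_mem measurableSet_Icc] with y hy hy'
    have hb2 : ∀ x ∈ Set.Ioo a b \ (∅ : Set ℝ), |pd2 v (x, y)| ≤ C₂ := fun x hx =>
      (hC₂ x ⟨ha.trans hx.1.1.le, hx.1.2.le.trans hb⟩ y ⟨hc.trans hy'.1, hy'.2.trans hd⟩ hy).2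
    have hm2 : Measurable fun x => pd2 v (x, y) := (measurable_pd2 hv.1).comp (by fun_prop)
    exact sq_intervalIntegral_le hab
      (intervalIntegrable_of_bound hab.le Set.countable_empty hm2 hb2)
      (intervalIntegrable_sq_of_bound hab.le Set.countable_empty hm2 hb2)
  rw [energyForm_one_eq hn hD hv, mul_add]
  refine s1.trans (add_le_add_right ?_ _)
  rw [div_le_iff₀ hba]
  refine s2.trans ?_
  have := mul_le_mul_of_nonneg_left s3 (sq_nonneg ((b - a) / Real.pi))
  simp only [ne_eq, OfNat.ofNat_ne_zero, not_false_eq_true, zero_pow, zero_div, add_zero]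
  linarith

end SpectralLOD


/-! ### The local eigenvalue problems: the lower bound for μ_i and the estimate on Ker Π_aux. -/

namespace SpectralLOD

/-! ### Linear algebra -/

/-- Used to show that the set defining μ_i is not empty. In the inner product s the form a is
represented by a symmetric operator T; in its eigenbasis a(v,v) is a combination of the eigenvalues
with nonnegative weights, so some eigenvalue is positive. -/
theorem exists_pos_eigenvalue {E : Type*} [AddCommGroup E] [Module ℝ E] [FiniteDimensional ℝ E]
    (a s : LinearMap.BilinForm ℝ E) (ha : ∀ v w, a v w = a w v) (hs : ∀ v w, s v w = s w v)
    (hpos : ∀ v, v ≠ 0 → 0 < s v v) (hne : ∃ v, 0 < a v v) :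
    ∃ μ : ℝ, 0 < μ ∧ ∃ v, v ≠ 0 ∧ ∀ w, a v w = μ * s v w := by
  have hs0 : ∀ v, 0 ≤ s v v := fun v => by
    by_cases h : v = 0
    · simp [h]
    · exact (hpos v h).le
  let core : InnerProductSpace.Core ℝ E :=
    { inner := fun v w => s v w
      conj_inner_symm := fun v w => by simp [hs v w]
      re_inner_nonneg := fun v => by simpa using hs0 v
      add_left := fun u v w => by simp
      smul_left := fun u v t => by simp
      definite := fun v hv => by
        by_contra h
        exact (hpos v h).ne' hv }
  let : NormedAddCommGroup E := core.toNormedAddCommGroup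
  let : InnerProductSpace ℝ E := InnerProductSpace.ofCore core.toCore
  have hin : ∀ v w : E, inner ℝ v w = s v w := fun _ _ => rfl
  have hnd : s.Nondegenerate := by
    refine ⟨fun v hv => ?_, fun v hv => ?_⟩ <;>
    · by_contra h
      exact (hpos v h).ne' (hv v)
  let T : E →ₗ[ℝ] E := (LinearMap.BilinForm.toDual s hnd).symm.toLinearMap ∘ₗ a
  have hT : ∀ v w, s (T v) w = a v w := fun v w =>
    LinearMap.BilinForm.apply_toDual_symm_apply (hB := hnd) (a v) w
  have hsym : T.IsSymmetric := fun v w => by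
    rw [hin, hin, hT, hs, hT, ha]
  obtain ⟨v, hv⟩ := hne
  let b := hsym.eigenvectorBasis rfl
  have hsum : a v v = ∑ i, hsym.eigenvalues rfl i * (inner ℝ v (b i) * inner ℝ v (b i)) := by
    rw [← hT, ← hin, ← b.sum_inner_mul_inner]
    refine Finset.sum_congr rfl fun i _ => ?_
    rw [hsym, hsym.apply_eigenvectorBasis, inner_smul_right, real_inner_comm v (b i)]
    simp only [RCLike.ofReal_real_eq_id, id]
    ring
  obtain ⟨i, hi⟩ : ∃ i, 0 < hsym.eigenvalues rfl i := by
    by_contra! h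
    rw [hsum] at hv
    exact absurd hv (not_lt.2 (Finset.sum_nonpos fun i _ =>
      mul_nonpos_of_nonpos_of_nonneg (h i) (mul_self_nonneg _)))
  refine ⟨_, hi, b i, b.toBasis.ne_zero i |> fun h => by simpa using h, fun w => ?_⟩
  rw [← hT, hsym.apply_eigenvectorBasis]
  simp [b]

/-- Orthonormal vectors are independent, so as many of them as the dimension form a basis, and
pairing with ψ_k recovers the coefficients. -/
theorem eq_sum_of_orthonormal {E : Type*} [AddCommGroup E] [Module ℝ E] [FiniteDimensional ℝ E]
    (s : LinearMap.BilinForm ℝ E) {d : ℕ} (hd : Module.finrank ℝ E = d) (ψ : ℕ → E)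
    (hψ : ∀ j < d, ∀ k < d, s (ψ j) (ψ k) = if j = k then 1 else 0) (v : E) :
    v = ∑ j ∈ Finset.range d, s v (ψ j) • ψ j := by
  have key : ∀ c : Fin d → ℝ, ∀ k : Fin d, s (∑ j, c j • ψ j) (ψ k) = c k := by
    intro c k
    simp [hψ _ (Fin.is_lt _) _ (Fin.is_lt _), ← Fin.ext_iff]
  have hli : LinearIndependent ℝ fun j : Fin d => ψ j := by
    rw [Fintype.linearIndependent_iff]
    intro c hc k
    rw [← key c k, hc]; simp
  have hspan := hli.span_eq_top_of_card_eq_finrank' (by simp [hd])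
  have hv : v ∈ Submodule.span ℝ (Set.range fun j : Fin d => ψ j) := hspan ▸ Submodule.mem_top
  obtain ⟨c, hc⟩ := (Submodule.mem_span_range_iff_exists_fun ℝ).1 hv
  rw [Finset.sum_range fun j => s v (ψ j) • ψ j]
  conv_lhs => rw [← hc]
  exact Finset.sum_congr rfl fun k _ => by rw [← hc, key c k]

/-! ### The local spaces -/

theorem meshSize_pos {N : ℕ} (hN : 0 < N) : 0 < meshSize N :=
  one_div_pos.2 (Nat.cast_pos.2 hN)

variable {n N r : ℕ} {κ : Fn} {β : ℝ} {i : ℕ × ℕ}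

/-- The square `K_i` touches the boundary of the unit square. -/
def IsBoundaryCell (N : ℕ) (i : ℕ × ℕ) : Prop := i.1 = 0 ∨ i.1 + 1 = N ∨ i.2 = 0 ∨ i.2 + 1 = N

/-- The constant is dictated by the boundary squares, where v vanishes on one whole side. Squares
with mean zero would allow H/π, which is enlarged to have one constant for both cases. -/
theorem poincare_cell (hN : 0 < N) (hr : 0 < r) (hi : i ∈ cells N) {v : Fn} (hv : v ∈ Vh (N * r))
    (h : IsBoundaryCell N i ∨ ∫ x in cell N i, v x = 0) :
    massForm (cell N i) (fun _ => 1) v v ≤ (2 * meshSize N / Real.pi) ^ 2 *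
      energyForm (cell N i) (fun _ => 1) v v := by
  have hN' : (0 : ℝ) < N := Nat.cast_pos.2 hN
  have hn : 0 < N * r := Nat.mul_pos hN hr
  simp only [cells, Finset.mem_product, Finset.mem_range] at hi
  have hlen : ∀ k : ℕ, ((k : ℝ) + 1) / N - k / N = meshSize N := fun k => by
    rw [meshSize]; ring
  have hlt : ∀ k : ℕ, (k : ℝ) / N < ((k : ℝ) + 1) / N := fun k => by
    have := hlen k
    have := meshSize_pos hN
    linarith
  have h0 : ∀ k : ℕ, (0 : ℝ) ≤ (k : ℝ) / N := fun k => by positivity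
  have h1 : ∀ k : ℕ, k < N → ((k : ℝ) + 1) / N ≤ 1 := fun k hk => by
    rw [div_le_one hN']; exact_mod_cast hk
  have side : ∀ k : ℕ, k = 0 ∨ k + 1 = N → (k : ℝ) / N = 0 ∨ ((k : ℝ) + 1) / N = 1 := by
    rintro k (rfl | hk)
    · left; simp
    · right
      rw [div_eq_one_iff_eq hN'.ne', ← hk]; push_cast; ring
  have vanish : ∀ {u : Fn}, u ∈ Vh (N * r) → ∀ k : ℕ, k = 0 ∨ k + 1 = N →
      ∀ y, u ((k : ℝ) / N, y) = 0 ∨ u (((k : ℝ) + 1) / N, y) = 0 := by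
    intro u hu k hk y
    refine (side k hk).imp (fun h => ?_) (fun h => ?_) <;>
    · rw [h]
      exact hu.2.1 _ fun h' => by simp [Omega] at h'
  rcases h with h | h
  · rcases (or_assoc.2 h : (i.1 = 0 ∨ i.1 + 1 = N) ∨ i.2 = 0 ∨ i.2 + 1 = N) with h | h
    · have := poincare_rect_one_side hn hv (h0 i.1) (hlt i.1) (h1 _ hi.1) (h0 i.2) (hlt i.2)
        (h1 _ hi.2) (vanish hv _ h)
      rwa [hlen] at this
    · have := poincare_rect_one_side hn (Vh_swap hv) (h0 i.2) (hlt i.2) (h1 _ hi.2) (h0 i.1)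
        (hlt i.1) (h1 _ hi.1) (vanish (Vh_swap hv) _ h)
      rwa [hlen, massForm_swap, energyForm_swap] at this
  · have := poincare_square_mean hn hv (h0 i.1) (hlt i.1) (h1 _ hi.1) (h0 i.2) (hlt i.2)
      (h1 _ hi.2) (by rw [hlen, hlen]) h
    rw [hlen] at this
    refine this.trans (mul_le_mul_of_nonneg_right ?_ (energyForm_one_self_nonneg v))
    have := meshSize_pos hN
    have := Real.pi_pos
    gcongr
    linarith

/-- The fine interval is found inside the prescribed coarse interval, also when t lies on a coarse
mesh line where a fine interval of the neighbour would contain t too. -/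
theorem exists_fine_Icc (hN : 0 < N) (hr : 0 < r) {k : ℕ} {t : ℝ}
    (ht : t ∈ Set.Icc ((k : ℝ) / N) (((k : ℝ) + 1) / N)) : ∃ l, k * r ≤ l ∧ l < (k + 1) * r ∧
      t ∈ Set.Icc ((l : ℝ) / (N * r : ℕ)) (((l : ℝ) + 1) / (N * r : ℕ)) := by
  have hN' : (0 : ℝ) < N := Nat.cast_pos.2 hN
  have hr' : (0 : ℝ) < r := Nat.cast_pos.2 hr
  rw [Set.mem_Icc, div_le_iff₀ hN', le_div_iff₀ hN'] at ht
  obtain ⟨l, hl, h⟩ := exists_Icc_of_mem hr (t := t * N - k) ⟨by linarith, by linarith⟩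
  rw [Set.mem_Icc, div_le_iff₀ hr', le_div_iff₀ hr'] at h
  refine ⟨k * r + l, by omega, by rw [add_mul]; omega, ?_, ?_⟩ <;> push_cast
  · rw [div_le_iff₀ (by positivity)]; linarith [h.1]
  · rw [le_div_iff₀ (by positivity)]; linarith [h.2]

/-- Some function in `V_h` equals `1` on a coarse square that does not touch the boundary. -/
theorem exists_one_on_cell (hN : 0 < N) (hr : 0 < r) (hi : i ∈ cells N)
    (hb : ¬ IsBoundaryCell N i) : ∃ w ∈ Vh (N * r), ∀ x ∈ cell N i, w x = 1 := by
  have hn : 0 < N * r := Nat.mul_pos hN hr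
  simp only [cells, Finset.mem_product, Finset.mem_range] at hi
  simp only [IsBoundaryCell, not_or] at hb
  obtain ⟨b1, b2, b3, b4⟩ := hb
  -- The witness is the sum of the hats at all fine vertices of the closed square, which are
  -- interior nodes as the square avoids the boundary. On each fine cell of K_i it is bilinear with
  -- value 1 at all four corners.
  let P : Finset (ℕ × ℕ) := Finset.Icc (i.1 * r) ((i.1 + 1) * r) ×ˢ
    Finset.Icc (i.2 * r) ((i.2 + 1) * r)
  have hPi : ∀ p ∈ P, IsInteriorNode (N * r) p := by
    intro p hp
    simp only [P, Finset.mem_product, Finset.mem_Icc] at hp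
    have aux : ∀ k : ℕ, k ≠ 0 → k + 1 ≠ N → k < N → 0 < k * r ∧ (k + 1) * r < N * r :=
      fun k h h' h'' => ⟨Nat.mul_pos (by omega) hr, Nat.mul_lt_mul_of_pos_right (by omega) hr⟩
    have a1 := aux i.1 b1 b2 hi.1
    have a2 := aux i.2 b3 b4 hi.2
    exact ⟨a1.1.trans_le hp.1.1, hp.1.2.trans_lt a1.2, a2.1.trans_le hp.2.1,
      hp.2.2.trans_lt a2.2⟩
  have hw : ∑ p ∈ P, hat (N * r) p ∈ Vh (N * r) := sum_mem fun p hp => hat_mem_Vh hn (hPi p hp)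
  refine ⟨_, hw, fun x hx => ?_⟩
  obtain ⟨l, hl1, hl2, hl⟩ := exists_fine_Icc hN hr hx.1
  obtain ⟨m, hm1, hm2, hm⟩ := exists_fine_Icc hN hr hx.2
  have hlm : (l, m) ∈ cells (N * r) := by
    simp only [cells, Finset.mem_product, Finset.mem_range]
    exact ⟨hl2.trans_le (Nat.mul_le_mul_right r hi.1), hm2.trans_le (Nat.mul_le_mul_right r hi.2)⟩
  obtain ⟨α, β, γ, δ, h⟩ := Vh_bilinear hw hlm
  have := eq_zero_on_cell hn (v := fun x => (∑ p ∈ P, hat (N * r) p) x - 1) (c := (l, m))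
    ⟨α - 1, β, γ, δ, fun x hx => by rw [h x hx]; ring⟩ (fun p hp => by
      have hpP : p ∈ P := by
        simp only [IsVertexOf] at hp
        simp only [P, Finset.mem_product, Finset.mem_Icc]
        omega
      simp [Finset.sum_apply, hat_gridPt hn, hpP]) x ⟨hl, hm⟩
  linarith

/-- The local energy form on `V_h(K_i)`. -/
noncomputable def energyLocB (hn : 0 < N * r) (hκ : CoeffBounds κ β) (hi : i ∈ cells N) :
    LinearMap.BilinForm ℝ (VhLoc N r i) :=
  have hadd : ∀ u v w : VhLoc N r i, energyForm (cell N i) κ (u + v : Fn) w =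
      energyForm (cell N i) κ u w + energyForm (cell N i) κ v w := by
    rintro ⟨_, u, hu, rfl⟩ ⟨_, v, hv, rfl⟩ ⟨_, w, hw, rfl⟩
    simp only [← map_add, energyForm_restrictTo, energyForm_restrictTo_right]
    exact energyForm_add hn hκ (restrict_cell_le hi) hu hv hw
  have hsmul : ∀ (t : ℝ) (u w : VhLoc N r i), energyForm (cell N i) κ (t • (u : Fn)) w =
      t * energyForm (cell N i) κ u w := by
    rintro t ⟨_, u, hu, rfl⟩ w
    simp only [← map_smul, energyForm_restrictTo]
    exact energyForm_smul hn (restrict_cell_le hi) t hu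
  LinearMap.mk₂ ℝ (fun u v => energyForm (cell N i) κ u v) hadd hsmul
    (fun u v w => by
      rw [energyForm_comm, energyForm_comm (u : Fn), energyForm_comm (u : Fn)]
      exact hadd v w u)
    (fun t u v => by
      rw [energyForm_comm, energyForm_comm (u : Fn)]
      exact hsmul t v u)

/-- The local mass form on `V_h(K_i)`. -/
noncomputable def massLocB (r : ℕ) (hκ : CoeffBounds κ β) (hi : i ∈ cells N) :
    LinearMap.BilinForm ℝ (VhLoc N r i) :=
  have hadd : ∀ u v w : VhLoc N r i, massForm (cell N i) κ (u + v : Fn) w =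
      massForm (cell N i) κ u w + massForm (cell N i) κ v w := by
    rintro ⟨_, u, hu, rfl⟩ ⟨_, v, hv, rfl⟩ ⟨_, w, hw, rfl⟩
    simp only [← map_add, massForm_restrictTo, massForm_restrictTo_right]
    exact massForm_add hκ (restrict_cell_le hi) hu.1 hv.1 hw.1
  have hsmul : ∀ (t : ℝ) (u w : VhLoc N r i), massForm (cell N i) κ (t • (u : Fn)) w =
      t * massForm (cell N i) κ u w := fun t u w => massForm_smul t u.1 w.1
  LinearMap.mk₂ ℝ (fun u v => massForm (cell N i) κ u v) hadd hsmul
    (fun u v w => by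
      rw [massForm_comm, massForm_comm (u : Fn), massForm_comm (u : Fn)]
      exact hadd v w u)
    (fun t u v => by
      rw [massForm_comm, massForm_comm (u : Fn)]
      exact hsmul t v u)

@[simp] theorem energyLocB_apply (hn : 0 < N * r) (hκ : CoeffBounds κ β) (hi : i ∈ cells N)
    (u v : VhLoc N r i) : energyLocB hn hκ hi u v = energyForm (cell N i) κ u v := rfl

@[simp] theorem massLocB_apply (hκ : CoeffBounds κ β) (hi : i ∈ cells N)
    (u v : VhLoc N r i) : massLocB r hκ hi u v = massForm (cell N i) κ u v := rfl

theorem finiteDimensional_VhLoc (hn : 0 < N * r) (i : ℕ × ℕ) :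
    FiniteDimensional ℝ (VhLoc N r i) := by
  have := finiteDimensional_Vh hn
  unfold VhLoc
  infer_instance

theorem restrictTo_eq_zero_iff {D : Set (ℝ × ℝ)} {v : Fn} :
    restrictTo D v = 0 ↔ ∀ x ∈ D, v x = 0 := by
  constructor
  · intro h x hx
    have := congrFun h x
    rwa [show restrictTo D v x = D.indicator v x from rfl, Set.indicator_of_mem hx] at this
  · intro h
    funext x
    by_cases hx : x ∈ D
    · exact (Set.indicator_of_mem hx v).trans (h x hx)
    · exact Set.indicator_of_notMem hx v

theorem massForm_one_pos_of_restrict_ne_zero (hi : i ∈ cells N) {v : Fn} (hv : v ∈ Vh (N * r))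
    (h : restrictTo (cell N i) v ≠ 0) : 0 < massForm (cell N i) (fun _ => 1) v v := by
  refine lt_of_le_of_ne (massForm_one_self_nonneg v) fun h0 => h ?_
  exact restrictTo_eq_zero_iff.2 (eq_zero_on_cell_of_massForm_one hi hv.1 h0.symm)

/-- The gradient of w vanishes in the open square. The case a = 1 serves to test eigenfunctions with
constants, the case a = 0 to discard other squares. -/
theorem energyForm_one_const_on_cell (u : Fn) {w : Fn} {a : ℝ} (hw : ∀ x ∈ cell N i, w x = a) :
    energyForm (cell N i) κ u w = 0 := by
  rw [energyForm, ← integral_zero (ℝ × ℝ) ℝ (μ := volume.restrict (cell N i))]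
  apply integral_congr_ae
  filter_upwards [ae_mem_ocell N i] with x hx
  have h : w =ᶠ[nhds x] fun _ => a := by
    filter_upwards [(isOpen_ocell N i).mem_nhds hx] with z hz
    exact hw z (ocell_subset_cell N i hz)
  rw [pd1_congr h, pd2_congr h, pd1_const, pd2_const]
  simp

/-- By the Poincaré inequality a nonzero restriction has positive energy once it vanishes on a side
or has mean zero. On an interior square the witness is the hat of the lower left corner minus its
mean; it is not zero because the hat takes different values at two corners of the square. -/
theorem exists_pos_energy (hN : 0 < N) (hr : 0 < r) (hi : i ∈ cells N)
    (hdim : 0 < dimLoc N r i) : ∃ v ∈ Vh (N * r), 0 < energyForm (cell N i) (fun _ => 1) v v := by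
  have hn : 0 < N * r := Nat.mul_pos hN hr
  have hπ := Real.pi_pos
  have key : ∀ v ∈ Vh (N * r), IsBoundaryCell N i ∨ ∫ x in cell N i, v x = 0 →
      restrictTo (cell N i) v ≠ 0 → 0 < energyForm (cell N i) (fun _ => 1) v v := by
    intro v hv h h0
    have h1 := poincare_cell hN hr hi hv h
    have h2 := massForm_one_pos_of_restrict_ne_zero hi hv h0
    exact pos_of_mul_pos_right (h2.trans_le h1) (sq_nonneg _)
  by_cases hb : IsBoundaryCell N i
  · have := finiteDimensional_VhLoc hn i
    have := Module.finrank_pos_iff.1 hdim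
    obtain ⟨⟨_, v, hv, rfl⟩, hne⟩ := exists_ne (0 : VhLoc N r i)
    exact ⟨v, hv, key v hv (Or.inl hb) fun h => hne (Subtype.ext h)⟩
  · obtain ⟨e, he, he1⟩ := exists_one_on_cell hN hr hi hb
    have hi' := hi
    simp only [cells, Finset.mem_product, Finset.mem_range] at hi'
    simp only [IsBoundaryCell, not_or] at hb
    obtain ⟨b1, b2, b3, b4⟩ := hb
    have hp : IsInteriorNode (N * r) (i.1 * r, i.2 * r) :=
      ⟨Nat.mul_pos (by omega) hr, Nat.mul_lt_mul_of_pos_right hi'.1 hr,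
        Nat.mul_pos (by omega) hr, Nat.mul_lt_mul_of_pos_right hi'.2 hr⟩
    have hw := hat_mem_Vh hn hp
    set w := hat (N * r) (i.1 * r, i.2 * r) with hwdef
    set m : ℝ := (∫ x in cell N i, w x) / ∫ x in cell N i, (1 : ℝ) with hm
    have hle : ∀ k : ℕ, (k : ℝ) / N ≤ ((k : ℝ) + 1) / N := fun k =>
      div_le_div_of_nonneg_right (by linarith) (Nat.cast_nonneg N)
    have hone : 0 < ∫ x in cell N i, (1 : ℝ) := by
      have h := massForm_one_pos_of_restrict_ne_zero hi he (fun h => by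
        have hx : ((i.1 : ℝ) / N, (i.2 : ℝ) / N) ∈ cell N i :=
          ⟨⟨le_rfl, hle _⟩, ⟨le_rfl, hle _⟩⟩
        have := restrictTo_eq_zero_iff.1 h _ hx
        rw [he1 _ hx] at this
        exact one_ne_zero this)
      rw [massForm] at h
      refine h.trans_eq (setIntegral_congr_fun (measurableSet_cell N i) fun x hx => ?_)
      simp [he1 x hx]
    have hu : w - m • e ∈ Vh (N * r) := sub_mem hw ((Vh _).smul_mem m he)
    refine ⟨w - m • e, hu, key _ hu (Or.inr ?_) fun h => ?_⟩
    · have : ∫ x in cell N i, (w - m • e) x = ∫ x in cell N i, (w x - m * 1) :=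
        setIntegral_congr_fun (measurableSet_cell N i) fun x hx => by simp [he1 x hx]
      rw [this, integral_sub, integral_const_mul, hm]
      · field_simp; simp
      · exact ((memLp_top_of_continuous hw.1).integrable le_top).mono_measure (restrict_cell_le hi)
      · exact (((memLp_top_of_continuous (v := fun _ => m * 1) continuous_const)).integrable
          le_top).mono_measure (restrict_cell_le hi)
    · have hN' : (0 : ℝ) < N := Nat.cast_pos.2 hN
      have hr' : (0 : ℝ) < r := Nat.cast_pos.2 hr
      have h1 := restrictTo_eq_zero_iff.1 h
      have g1 : gridPt (N * r) (i.1 * r, i.2 * r) ∈ cell N i := by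
        simp only [gridPt, Nat.cast_mul, mul_div_mul_right _ _ hr'.ne']
        exact ⟨⟨le_rfl, hle _⟩, ⟨le_rfl, hle _⟩⟩
      have g2 : gridPt (N * r) ((i.1 + 1) * r, i.2 * r) ∈ cell N i := by
        simp only [gridPt, Nat.cast_mul, mul_div_mul_right _ _ hr'.ne']
        push_cast
        exact ⟨⟨hle _, le_rfl⟩, ⟨le_rfl, hle _⟩⟩
      have e1 := h1 _ g1
      have e2 := h1 _ g2
      have hne : i.1 * r ≠ (i.1 + 1) * r := fun h => by
        have := Nat.eq_of_mul_eq_mul_right hr h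
        omega
      simp only [Pi.sub_apply, Pi.smul_apply, smul_eq_mul, he1 _ g1, he1 _ g2, hwdef,
        hat_gridPt hn] at e1 e2
      simp only [Prod.mk.injEq, hne, false_and, if_false] at e1 e2
      simp at e1 e2
      linarith

/-- `μ_i ≥ π² / 4`. -/
theorem muLoc_ge (hN : 0 < N) (hr : 0 < r) (hi : i ∈ cells N) (hdim : 0 < dimLoc N r i) :
    Real.pi ^ 2 / 4 ≤ muLoc N r i := by
  have hn : 0 < N * r := Nat.mul_pos hN hr
  have hH := meshSize_pos hN
  have hπ := Real.pi_pos
  have := finiteDimensional_VhLoc hn i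
  apply le_csInf
  -- Nonemptiness is essential, since the infimum of the empty set would be 0. The eigenvalue is
  -- rescaled by H² because s_i carries the factor H⁻².
  · obtain ⟨v, hv, hpos⟩ := exists_pos_energy hN hr hi hdim
    obtain ⟨μ, hμ, u, hu, h⟩ := exists_pos_eigenvalue (energyLocB hn coeffBounds_one hi)
      (massLocB r coeffBounds_one hi) (fun v w => energyForm_comm _ _)
      (fun v w => massForm_comm _ _)
      (by
        rintro ⟨_, v, hv, rfl⟩ h0
        simp only [massLocB_apply, massForm_restrictTo, massForm_restrictTo_right]
        exact massForm_one_pos_of_restrict_ne_zero hi hv fun h => h0 (Subtype.ext h))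
      ⟨⟨restrictTo (cell N i) v, v, hv, rfl⟩, by
        simpa only [energyLocB_apply, energyForm_restrictTo, energyForm_restrictTo_right]⟩
    refine ⟨μ * meshSize N ^ 2, by positivity, u, u.2, fun h => hu (Subtype.ext h), fun w hw => ?_⟩
    have h1 := h ⟨w, hw⟩
    rw [energyLocB_apply, massLocB_apply] at h1
    change energyForm (cell N i) (fun _ => 1) u w =
      μ * meshSize N ^ 2 * ((meshSize N ^ 2)⁻¹ * massForm (cell N i) (fun _ => 1) u w)
    rw [h1]
    field_simp
  · rintro μ ⟨hμ, _, ⟨v, hv, rfl⟩, hne, heig⟩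
    have heig' : ∀ w ∈ Vh (N * r), energyForm (cell N i) (fun _ => 1) v w =
        μ * ((meshSize N ^ 2)⁻¹ * massForm (cell N i) (fun _ => 1) v w) := by
      intro w hw
      have h := heig _ ⟨w, hw, rfl⟩
      change energyForm (cell N i) _ _ _ = μ * ((meshSize N ^ 2)⁻¹ * massForm (cell N i) _ _ _) at h
      rwa [energyForm_restrictTo, energyForm_restrictTo_right, massForm_restrictTo,
        massForm_restrictTo_right] at h
    have hpos := massForm_one_pos_of_restrict_ne_zero hi hv hne
    have hP := poincare_cell hN hr hi hv (by
      by_cases hb : IsBoundaryCell N i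
      · exact Or.inl hb
      -- Testing the eigenvalue equation with a function equal to 1 on K_i gives 0 = μ H⁻² ∫ v, so v
      -- has mean zero.
      · right
        obtain ⟨e, he, he1⟩ := exists_one_on_cell hN hr hi hb
        have h := heig' e he
        rw [energyForm_one_const_on_cell v he1] at h
        have h2 : massForm (cell N i) (fun _ => 1) v e = 0 := by
          have : 0 < μ * (meshSize N ^ 2)⁻¹ := by positivity
          rw [← mul_assoc] at h
          exact (mul_eq_zero.1 h.symm).resolve_left this.ne'
        rw [← h2]
        exact setIntegral_congr_fun (measurableSet_cell N i) fun x hx => by simp [he1 x hx])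
    rw [heig' v hv] at hP
    have h3 : (2 * meshSize N / Real.pi) ^ 2 *
        (μ * ((meshSize N ^ 2)⁻¹ * massForm (cell N i) (fun _ => 1) v v)) =
        4 / Real.pi ^ 2 * μ * massForm (cell N i) (fun _ => 1) v v := by
      field_simp; ring
    rw [h3] at hP
    have h4 : 1 ≤ 4 / Real.pi ^ 2 * μ := by
      by_contra! h
      nlinarith
    rw [div_mul_eq_mul_div, le_div_iff₀ (by positivity)] at h4
    linarith

/-! ### Consequences of the spectral decomposition -/

variable (S : SpectralData N r κ)

theorem sLoc_eq (u v : Fn) : sLoc N κ i u v = (meshSize N ^ 2)⁻¹ * massForm (cell N i) κ u v := rfl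

theorem sLoc_restrictTo (u v : Fn) : sLoc N κ i (restrictTo (cell N i) u) v = sLoc N κ i u v := by
  rw [sLoc_eq, sLoc_eq, massForm_restrictTo]

theorem sLoc_restrictTo_right (u v : Fn) :
    sLoc N κ i u (restrictTo (cell N i) v) = sLoc N κ i u v := by
  rw [sLoc_eq, sLoc_eq, massForm_restrictTo_right]

/-- The form `s_i` on `V_h(K_i)`. -/
noncomputable def sLocB (r : ℕ) (hκ : CoeffBounds κ β) (hi : i ∈ cells N) :
    LinearMap.BilinForm ℝ (VhLoc N r i) := (meshSize N ^ 2)⁻¹ • massLocB r hκ hi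

@[simp] theorem sLocB_apply (hκ : CoeffBounds κ β) (hi : i ∈ cells N)
    (u v : VhLoc N r i) : sLocB r hκ hi u v = sLoc N κ i u v := rfl

theorem exists_psi_lift (hi : i ∈ cells N) :
    ∃ ψ : ℕ → VhLoc N r i, ∀ j < dimLoc N r i, (ψ j : Fn) = S.psi i j := by
  classical
  exact ⟨fun j => if h : j < dimLoc N r i then ⟨S.psi i j, S.psi_mem i hi j h⟩ else 0,
    fun j hj => by simp [hj]⟩

theorem psi_lift_expansion (hn : 0 < N * r) (hκ : CoeffBounds κ β) (hi : i ∈ cells N)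
    {ψ : ℕ → VhLoc N r i} (hψ : ∀ j < dimLoc N r i, (ψ j : Fn) = S.psi i j) (v : VhLoc N r i) :
    v = ∑ j ∈ Finset.range (dimLoc N r i), sLoc N κ i v (S.psi i j) • ψ j := by
  have := finiteDimensional_VhLoc hn i
  have h := eq_sum_of_orthonormal (sLocB r hκ hi) rfl ψ (fun j hj k hk => by
    rw [sLocB_apply, hψ j hj, hψ k hk]
    exact S.orthonormal i hi j hj k hk) v
  refine h.trans (Finset.sum_congr rfl fun j hj => ?_)
  rw [sLocB_apply, hψ j (Finset.mem_range.1 hj)]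

/-- Parseval's identity for the complete s_i-orthonormal eigenbasis of V_h(K_i). -/
theorem sLoc_eq_sum (hn : 0 < N * r) (hκ : CoeffBounds κ β) (hi : i ∈ cells N) {u v : Fn}
    (hu : u ∈ Vh (N * r)) (hv : v ∈ Vh (N * r)) :
    sLoc N κ i v u =
      ∑ j ∈ Finset.range (dimLoc N r i), sLoc N κ i u (S.psi i j) * sLoc N κ i v (S.psi i j) := by
  obtain ⟨ψ, hψ⟩ := exists_psi_lift S hi
  have h := psi_lift_expansion S hn hκ hi hψ ⟨restrictTo (cell N i) u, u, hu, rfl⟩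
  have h1 : sLoc N κ i v u = sLocB r hκ hi ⟨restrictTo (cell N i) v, v, hv, rfl⟩
      ⟨restrictTo (cell N i) u, u, hu, rfl⟩ := by
    rw [sLocB_apply, sLoc_restrictTo, sLoc_restrictTo_right]
  rw [h1, h, map_sum]
  refine Finset.sum_congr rfl fun j hj => ?_
  rw [map_smul, sLocB_apply, hψ j (Finset.mem_range.1 hj), sLoc_restrictTo, sLoc_restrictTo,
    smul_eq_mul]

/-- Expanding one argument and using the eigenvalue equation on each term diagonalizes a_i in the
same basis. -/
theorem aLoc_eq_sum (hn : 0 < N * r) (hκ : CoeffBounds κ β) (hi : i ∈ cells N) {v : Fn}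
    (hv : v ∈ Vh (N * r)) :
    aLoc N κ i v v =
      ∑ j ∈ Finset.range (dimLoc N r i), S.lam i j * sLoc N κ i v (S.psi i j) ^ 2 := by
  obtain ⟨ψ, hψ⟩ := exists_psi_lift S hi
  have h := psi_lift_expansion S hn hκ hi hψ ⟨restrictTo (cell N i) v, v, hv, rfl⟩
  have h1 : aLoc N κ i v v = energyLocB hn hκ hi ⟨restrictTo (cell N i) v, v, hv, rfl⟩
      ⟨restrictTo (cell N i) v, v, hv, rfl⟩ := by
    rw [energyLocB_apply, energyForm_restrictTo, energyForm_restrictTo_right]; rfl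
  rw [h1]
  nth_rewrite 2 [h]
  rw [map_sum]
  refine Finset.sum_congr rfl fun j hj => ?_
  have hj' := Finset.mem_range.1 hj
  have h2 := S.eigen i hi j hj' _ (⟨v, hv, rfl⟩ : restrictTo (cell N i) v ∈ VhLoc N r i)
  rw [sLoc_restrictTo_right, sLoc_eq, massForm_comm, ← sLoc_eq] at h2
  rw [map_smul, energyLocB_apply, hψ j hj', energyForm_comm,
    show energyForm (cell N i) κ (S.psi i j) (restrictTo (cell N i) v) = _ from h2,
    sLoc_restrictTo, smul_eq_mul]
  ring

theorem proj_eq_zero_iff (hκ : CoeffBounds κ β) (hi : i ∈ cells N) (v : Fn) :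
    S.proj i v = 0 ↔ ∀ j < S.L i, sLoc N κ i v (S.psi i j) = 0 := by
  obtain ⟨ψ, hψ⟩ := exists_psi_lift S hi
  have hL := S.L_le i hi
  constructor
  · intro h k hk
    have h1 : ∑ j ∈ Finset.range (S.L i), sLoc N κ i v (S.psi i j) • ψ j = 0 := by
      apply Subtype.ext
      rw [Submodule.coe_sum, Submodule.coe_zero, ← h]
      refine Finset.sum_congr rfl fun j hj => ?_
      rw [Submodule.coe_smul, hψ j ((Finset.mem_range.1 hj).trans_le hL)]
    have h2 := congrArg (fun w => sLocB r hκ hi w (ψ k)) h1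
    simp only [map_sum, map_smul, LinearMap.sum_apply, LinearMap.smul_apply, map_zero,
      LinearMap.zero_apply] at h2
    rw [Finset.sum_eq_single k] at h2
    · rw [sLocB_apply, hψ k (hk.trans_le hL),
        S.orthonormal i hi k (hk.trans_le hL) k (hk.trans_le hL), if_pos rfl, smul_eq_mul,
        mul_one] at h2
      exact h2
    · intro j hj hjk
      have hj' := (Finset.mem_range.1 hj).trans_le hL
      rw [sLocB_apply, hψ j hj', hψ k (hk.trans_le hL),
        S.orthonormal i hi j hj' k (hk.trans_le hL), if_neg hjk, smul_zero]
    · exact fun h' => absurd (Finset.mem_range.2 hk) h'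
  · intro h
    exact Finset.sum_eq_zero fun j hj => by rw [h j (Finset.mem_range.1 hj), zero_smul]

theorem mem_kerPi_iff (hκ : CoeffBounds κ β) (v : Fn) :
    v ∈ S.kerPi ↔ v ∈ Vh (N * r) ∧ ∀ i ∈ cells N, ∀ j < S.L i, sLoc N κ i v (S.psi i j) = 0 :=
  and_congr_right fun _ => forall₂_congr fun _ hi => proj_eq_zero_iff S hκ hi v

theorem sum_sq_sLoc_le (hn : 0 < N * r) (hκ : CoeffBounds κ β) (hi : i ∈ cells N) {v : Fn}
    (hv : v ∈ Vh (N * r)) :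
    ∑ j ∈ Finset.range (S.L i), sLoc N κ i v (S.psi i j) ^ 2 ≤ sLoc N κ i v v := by
  rw [sLoc_eq_sum S hn hκ hi hv hv]
  simp only [← pow_two]
  exact Finset.sum_le_sum_of_subset_of_nonneg (Finset.range_mono (S.L_le i hi))
    fun _ _ _ => sq_nonneg _

/-- Only modes j ≥ L_i survive, and for them the eigenvalue exceeds μ_i/2 ≥ π²/8. -/
theorem sLoc_le_of_mem_kerPi (hN : 0 < N) (hr : 0 < r) (hκ : CoeffBounds κ β) (hi : i ∈ cells N)
    {v : Fn} (hv : v ∈ S.kerPi) :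
    sLoc N κ i v v ≤ 8 / Real.pi ^ 2 * aLoc N κ i v v := by
  have hn : 0 < N * r := Nat.mul_pos hN hr
  have hπ := Real.pi_pos
  obtain ⟨hv, h0⟩ := (mem_kerPi_iff S hκ v).1 hv
  rw [sLoc_eq_sum S hn hκ hi hv hv, aLoc_eq_sum S hn hκ hi hv, Finset.mul_sum]
  refine Finset.sum_le_sum fun j hj => ?_
  have hj' := Finset.mem_range.1 hj
  rcases lt_or_ge j (S.L i) with h | h
  · rw [h0 i hi j h]; simp
  · have h1 := S.choice i hi j h hj'
    have h2 := muLoc_ge hN hr hi (by omega)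
    have h3 : 1 ≤ 8 / Real.pi ^ 2 * S.lam i j := by
      rw [div_mul_eq_mul_div, le_div_iff₀ (by positivity)]
      linarith
    rw [← pow_two, ← mul_assoc]
    exact le_mul_of_one_le_left (sq_nonneg _) h3

theorem Cstar_sq : Cstar ^ 2 = 8 / Real.pi ^ 2 := by
  rw [Cstar, div_pow, ← Real.rpow_natCast, ← Real.rpow_mul (by norm_num)]
  norm_num

theorem Cstar_pos : 0 < Cstar := by
  have := Real.pi_pos
  unfold Cstar
  positivity

/-- On the kernel of the projections the weighted `L²` norm is bounded by `C_* H` times the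
energy norm. -/
theorem massForm_le_of_mem_kerPi (hN : 0 < N) (hr : 0 < r) (hκ : CoeffBounds κ β) {v : Fn}
    (hv : v ∈ S.kerPi) :
    massForm Omega κ v v ≤ (Cstar * meshSize N) ^ 2 * aForm κ v v := by
  have hn : 0 < N * r := Nat.mul_pos hN hr
  have hH := meshSize_pos hN
  rw [massForm_Omega_eq_sum hN hκ hv.1.1 hv.1.1, aForm, energyForm_Omega_eq_sum hN hn hκ hv.1 hv.1,
    Finset.mul_sum]
  refine Finset.sum_le_sum fun i hi => ?_
  have h := sLoc_le_of_mem_kerPi S hN hr hκ hi hv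
  rw [sLoc_eq, ← Cstar_sq, inv_mul_le_iff₀ (by positivity)] at h
  rw [mul_pow]
  refine h.trans_eq ?_
  rw [aLoc]; ring

/-- Friedrichs' inequality on the unit square, from the vanishing on the side x = 0. Its constant
(2/π)² is below 1, so it disappears from all later estimates. -/
theorem massForm_one_le_energy (hn : 0 < n) (hκ : CoeffBounds κ β) {v : Fn} (hv : v ∈ Vh n) :
    massForm Omega (fun _ => 1) v v ≤ aForm κ v v := by
  have h := poincare_rect_one_side hn hv (le_refl 0) one_pos le_rfl (le_refl 0) one_pos le_rfl
    fun y => Or.inl (hv.2.1 _ fun h' => by simp [Omega] at h')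
  have hr : (volume : Measure (ℝ × ℝ)).restrict (Set.Icc (0 : ℝ) 1 ×ˢ Set.Icc (0 : ℝ) 1) =
      volume.restrict Omega := (Measure.restrict_congr_set Omega_ae_eq).symm
  have h' : massForm Omega (fun _ => 1) v v ≤ (2 * (1 - 0) / Real.pi) ^ 2 *
      energyForm Omega (fun _ => 1) v v := by
    simpa only [massForm, energyForm, hr] using h
  refine h'.trans (le_trans ?_ (energyForm_one_le hn hκ le_rfl hv))
  have hπ := Real.pi_gt_three
  refine mul_le_of_le_one_left (energyForm_one_self_nonneg v) ?_
  rw [sq_le_one_iff₀ (by positivity), div_le_one (by positivity)]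
  linarith

theorem aForm_pos (hn : 0 < n) (hκ : CoeffBounds κ β) {v : Fn} (hv : v ∈ Vh n) (h0 : v ≠ 0) :
    0 < aForm κ v v := by
  refine lt_of_lt_of_le (lt_of_le_of_ne (massForm_one_self_nonneg v) fun h => h0 ?_)
    (massForm_one_le_energy hn hκ hv)
  exact eq_zero_of_massForm_one_Omega hv h.symm

end SpectralLOD


/-! ### Convergence of the conjugate gradient algorithm at the Chebyshev rate. -/

namespace SpectralLOD

/-! ### Krylov spaces and the conjugate gradient algorithm -/

section ConjugateGradient

variable {l : ℕ} {G : Matrix (Fin l) (Fin l) ℝ} {b : Fin l → ℝ}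

/-- The Krylov space spanned by `b, G b, …, G ^ (k - 1) b`. -/
def krylov (G : Matrix (Fin l) (Fin l) ℝ) (b : Fin l → ℝ) (k : ℕ) : Submodule ℝ (Fin l → ℝ) :=
  Submodule.span ℝ ((fun j => (G ^ j).mulVec b) '' Set.Iio k)

theorem pow_mulVec_mem_krylov {j k : ℕ} (h : j < k) : (G ^ j).mulVec b ∈ krylov G b k :=
  Submodule.subset_span ⟨j, h, rfl⟩

theorem krylov_mono {j k : ℕ} (h : j ≤ k) : krylov G b j ≤ krylov G b k :=
  Submodule.span_mono (Set.image_mono (Set.Iio_subset_Iio h))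

theorem krylov_succ (k : ℕ) :
    krylov G b (k + 1) = krylov G b k ⊔ Submodule.span ℝ {(G ^ k).mulVec b} := by
  have h : Set.Iio (k + 1) = Set.Iio k ∪ {k} := by
    ext j
    simp only [Set.mem_Iio, Set.mem_union, Set.mem_singleton_iff]
    omega
  rw [krylov, krylov, ← Submodule.span_union, h, Set.image_union, Set.image_singleton]

theorem mulVec_mem_krylov {k : ℕ} {y : Fin l → ℝ} (hy : y ∈ krylov G b k) :
    G.mulVec y ∈ krylov G b (k + 1) := by
  induction hy using Submodule.span_induction with
  | mem x hx =>
    obtain ⟨j, hj, rfl⟩ := hx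
    simp only [Matrix.mulVec_mulVec, ← pow_succ']
    exact pow_mulVec_mem_krylov (Nat.succ_lt_succ hj)
  | zero => simp
  | add x y _ _ hx hy => rw [Matrix.mulVec_add]; exact add_mem hx hy
  | smul t x _ hx => rw [Matrix.mulVec_smul]; exact Submodule.smul_mem _ _ hx

theorem dotProduct_mulVec_comm (hG : G.IsSymm) (x y : Fin l → ℝ) :
    x ⬝ᵥ G.mulVec y = y ⬝ᵥ G.mulVec x := by
  rw [Matrix.dotProduct_mulVec, ← Matrix.mulVec_transpose, hG, dotProduct_comm]

theorem eq_zero_of_dotProduct_self {x : Fin l → ℝ} (h : x ⬝ᵥ x = 0) : x = 0 :=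
  dotProduct_self_eq_zero.1 h

/-- The properties of the `k`-th state of the conjugate gradient algorithm. -/
structure CGInvariant (G : Matrix (Fin l) (Fin l) ℝ) (b : Fin l → ℝ) (k : ℕ) (s : CGState l) :
    Prop where
  x_mem : s.x ∈ krylov G b k
  res_eq : s.res = b - G.mulVec s.x
  res_mem : s.res ∈ krylov G b (k + 1)
  dir_mem : s.dir ∈ krylov G b (k + 1)
  res_orth : ∀ y ∈ krylov G b k, s.res ⬝ᵥ y = 0
  dir_orth : ∀ y ∈ krylov G b k, s.dir ⬝ᵥ G.mulVec y = 0
  sub_mem : s.dir - s.res ∈ krylov G b k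

/-- The direction has a nonzero component along Gᵏb: otherwise it and the residual would lie in the
k-th Krylov space, to which the residual is orthogonal, and the residual would vanish. -/
theorem krylov_succ_le_of_invariant {k : ℕ} {s : CGState l} (h : CGInvariant G b k s)
    (h0 : s.res ≠ 0) : krylov G b (k + 1) ≤ krylov G b k ⊔ Submodule.span ℝ {s.dir} := by
  have hd := h.dir_mem
  rw [krylov_succ, Submodule.mem_sup] at hd
  obtain ⟨y, hy, z, hz, hyz⟩ := hd
  obtain ⟨c, rfl⟩ := Submodule.mem_span_singleton.1 hz
  have hc : c ≠ 0 := by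
    rintro rfl
    rw [zero_smul, add_zero] at hyz
    have h1 : s.res ∈ krylov G b k := by
      have := sub_mem (hyz ▸ hy) h.sub_mem
      rwa [sub_sub_cancel] at this
    exact h0 (eq_zero_of_dotProduct_self (h.res_orth _ h1))
  rw [krylov_succ]
  refine sup_le le_sup_left ?_
  rw [Submodule.span_singleton_le_iff_mem]
  have : (G ^ k).mulVec b = -(c⁻¹ • y) + c⁻¹ • s.dir := by
    rw [← hyz, smul_add, smul_smul, inv_mul_cancel₀ hc, one_smul]; abel
  rw [this]
  exact add_mem (Submodule.mem_sup_left (neg_mem (Submodule.smul_mem _ _ hy)))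
    (Submodule.mem_sup_right (Submodule.smul_mem _ _ (Submodule.mem_span_singleton_self _)))

/-- The two orthogonality relations propagate together. Each need only be checked on the old Krylov
space and on the current direction, which span the next one. -/
theorem cg_invariant (hG : G.IsSymm) (hpos : ∀ x, x ≠ 0 → 0 < x ⬝ᵥ G.mulVec x)
    (b : Fin l → ℝ) (k : ℕ) : CGInvariant G b k (cg G b k) := by
  induction k with
  | zero =>
    have hb : b ∈ krylov G b 1 := by
      have := pow_mulVec_mem_krylov (G := G) (b := b) Nat.zero_lt_one
      simpa using this
    have h0 : krylov G b 0 = ⊥ := by simp [krylov]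
    refine ⟨zero_mem _, by simp [cg], hb, hb, ?_, ?_, by simp [cg]⟩ <;>
    · intro y hy
      rw [h0, Submodule.mem_bot] at hy
      simp [hy]
  | succ k ih =>
    obtain ⟨s, hs⟩ : ∃ s, s = cg G b k := ⟨_, rfl⟩
    rw [← hs] at ih
    have hx : (cg G b (k + 1)).x =
        s.x + ((s.res ⬝ᵥ s.res) / (s.dir ⬝ᵥ G.mulVec s.dir)) • s.dir := by rw [hs]; rfl
    have hr : (cg G b (k + 1)).res =
        s.res - ((s.res ⬝ᵥ s.res) / (s.dir ⬝ᵥ G.mulVec s.dir)) • G.mulVec s.dir := by rw [hs]; rfl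
    have hp : (cg G b (k + 1)).dir = (cg G b (k + 1)).res +
        (((cg G b (k + 1)).res ⬝ᵥ (cg G b (k + 1)).res) / (s.res ⬝ᵥ s.res)) • s.dir := by
      rw [hs]; rfl
    set t := cg G b (k + 1)
    set α := (s.res ⬝ᵥ s.res) / (s.dir ⬝ᵥ G.mulVec s.dir) with hα
    set γ := (t.res ⬝ᵥ t.res) / (s.res ⬝ᵥ s.res) with hγ
    have hx_mem : t.x ∈ krylov G b (k + 1) := by
      rw [hx]
      exact add_mem (krylov_mono k.le_succ ih.x_mem) (Submodule.smul_mem _ _ ih.dir_mem)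
    have hr_mem : t.res ∈ krylov G b (k + 1 + 1) := by
      rw [hr]
      exact sub_mem (krylov_mono (k + 1).le_succ ih.res_mem)
        (Submodule.smul_mem _ _ (mulVec_mem_krylov ih.dir_mem))
    have hp_mem : t.dir ∈ krylov G b (k + 1 + 1) := by
      rw [hp]
      exact add_mem hr_mem (Submodule.smul_mem _ _ (krylov_mono (k + 1).le_succ ih.dir_mem))
    have hr_eq : t.res = b - G.mulVec t.x := by
      rw [hr, hx, ih.res_eq, Matrix.mulVec_add, Matrix.mulVec_smul]; abel
    have hsub : t.dir - t.res ∈ krylov G b (k + 1) := by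
      rw [hp, add_sub_cancel_left]
      exact Submodule.smul_mem _ _ ih.dir_mem
    -- After termination the direction lies in the k-th Krylov space and is G-orthogonal to it,
    -- hence is zero; then 0 / 0 = 0 freezes the state.
    by_cases h0 : s.res = 0
    · have hd0 : s.dir = 0 := by
        have h1 := ih.sub_mem
        rw [h0, sub_zero] at h1
        by_contra h2
        exact (hpos _ h2).ne' (ih.dir_orth _ h1)
      have hr0 : t.res = 0 := by rw [hr, h0, hd0]; simp
      have hp0 : t.dir = 0 := by rw [hp, hr0, hd0]; simp
      exact ⟨hx_mem, hr_eq, hr_mem, hp_mem, fun y _ => by rw [hr0, zero_dotProduct],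
        fun y _ => by rw [hp0, zero_dotProduct], hsub⟩
    · have hle := krylov_succ_le_of_invariant ih h0
      have hrr : s.res ⬝ᵥ s.res ≠ 0 := fun h => h0 (eq_zero_of_dotProduct_self h)
      have hrp : s.res ⬝ᵥ s.dir = s.res ⬝ᵥ s.res := by
        have := ih.res_orth _ ih.sub_mem
        rw [dotProduct_sub] at this
        linarith
      have hd0 : s.dir ≠ 0 := fun h => by
        rw [h, dotProduct_zero] at hrp
        exact hrr hrp.symm
      have hpp := (hpos _ hd0).ne'
      have hα0 : α ≠ 0 := div_ne_zero hrr hpp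
      have orth1 : ∀ y ∈ krylov G b (k + 1), t.res ⬝ᵥ y = 0 := by
        intro y hy
        obtain ⟨z, hz, w, hw, rfl⟩ := Submodule.mem_sup.1 (hle hy)
        obtain ⟨c, rfl⟩ := Submodule.mem_span_singleton.1 hw
        have e1 : t.res ⬝ᵥ z = 0 := by
          rw [hr, sub_dotProduct, smul_dotProduct, ih.res_orth z hz, dotProduct_comm,
            dotProduct_mulVec_comm hG, ih.dir_orth z hz]; simp
        have e2 : t.res ⬝ᵥ s.dir = 0 := by
          rw [hr, sub_dotProduct, smul_dotProduct, hrp, dotProduct_comm (G.mulVec s.dir), hα,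
            smul_eq_mul, div_mul_cancel₀ _ hpp, sub_self]
        rw [dotProduct_add, dotProduct_smul, e1, e2]; simp
      have orth2 : ∀ y ∈ krylov G b (k + 1), t.dir ⬝ᵥ G.mulVec y = 0 := by
        intro y hy
        obtain ⟨z, hz, w, hw, rfl⟩ := Submodule.mem_sup.1 (hle hy)
        obtain ⟨c, rfl⟩ := Submodule.mem_span_singleton.1 hw
        have e1 : t.dir ⬝ᵥ G.mulVec z = 0 := by
          rw [hp, add_dotProduct, smul_dotProduct, ih.dir_orth z hz,
            orth1 _ (mulVec_mem_krylov hz)]; simp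
        have e2 : t.dir ⬝ᵥ G.mulVec s.dir = 0 := by
          -- The new residual is orthogonal to the old one, so only the update term contributes to
          -- its square. This identity is what makes the coefficient γ enforce G-orthogonality to
          -- the previous direction.
          have e3 : t.res ⬝ᵥ t.res = -(α * (t.res ⬝ᵥ G.mulVec s.dir)) := by
            nth_rewrite 2 [hr]
            rw [dotProduct_sub, dotProduct_smul, orth1 _ ih.res_mem, smul_eq_mul, zero_sub]
          have e4 : γ * (s.dir ⬝ᵥ G.mulVec s.dir) = t.res ⬝ᵥ t.res / α := by
            rw [hγ, hα]; field_simp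
          rw [hp, add_dotProduct, smul_dotProduct, smul_eq_mul, e4, e3]
          field_simp; ring
        rw [Matrix.mulVec_add, Matrix.mulVec_smul, dotProduct_add, dotProduct_smul, e1, e2]; simp
      exact ⟨hx_mem, hr_eq, hr_mem, hp_mem, orth1, orth2, hsub⟩

/-- The conjugate gradient iterate is the best approximation in the Krylov space. -/
theorem cg_optimal (hG : G.IsSymm) (hpos : ∀ x, x ≠ 0 → 0 < x ⬝ᵥ G.mulVec x)
    {x : Fin l → ℝ} (hx : G.mulVec x = b) (k : ℕ) {y : Fin l → ℝ} (hy : y ∈ krylov G b k) :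
    (x - (cg G b k).x) ⬝ᵥ G.mulVec (x - (cg G b k).x) ≤ (x - y) ⬝ᵥ G.mulVec (x - y) := by
  have h := cg_invariant hG hpos b k
  set z := (cg G b k).x
  have h1 : G.mulVec (x - z) = (cg G b k).res := by rw [h.res_eq, Matrix.mulVec_sub, hx]
  have h2 : (z - y) ⬝ᵥ G.mulVec (x - z) = 0 := by
    rw [h1, dotProduct_comm]
    exact h.res_orth _ (sub_mem h.x_mem hy)
  have h3 : x - y = (x - z) + (z - y) := by abel
  have h4 : 0 ≤ (z - y) ⬝ᵥ G.mulVec (z - y) := by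
    by_cases h0 : z - y = 0
    · simp [h0]
    · exact (hpos _ h0).le
  rw [h3, Matrix.mulVec_add, dotProduct_add, add_dotProduct, add_dotProduct, h2,
    dotProduct_mulVec_comm hG (x - z) (z - y), h2]
  linarith

open Polynomial in
-- Writing P = Q X + 1 gives P(G)x = x + Q(G)b, so P(G)x is the error of the competitor -Q(G)b,
-- which lies in the Krylov space.
theorem cg_le_polynomial (hG : G.IsSymm) (hpos : ∀ x, x ≠ 0 → 0 < x ⬝ᵥ G.mulVec x)
    {x : Fin l → ℝ} (hx : G.mulVec x = b) {k : ℕ} {P : ℝ[X]} (hP : P.natDegree ≤ k)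
    (hP0 : P.eval 0 = 1) :
    (x - (cg G b k).x) ⬝ᵥ G.mulVec (x - (cg G b k).x) ≤
      ((aeval G P).mulVec x) ⬝ᵥ G.mulVec ((aeval G P).mulVec x) := by
  have hdeg : (P.divX).natDegree = P.natDegree - 1 := natDegree_divX_eq_natDegree_tsub_one
  have hsplit : P = P.divX * X + 1 := by
    conv_lhs => rw [← divX_mul_X_add P]
    rw [coeff_zero_eq_eval_zero, hP0, C_1]
  have hval : (aeval G P).mulVec x = x + (aeval G P.divX).mulVec b := by
    conv_lhs => rw [hsplit]
    rw [map_add, map_mul, aeval_X, map_one, Matrix.add_mulVec, Matrix.one_mulVec,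
      ← Matrix.mulVec_mulVec, hx, add_comm]
  have hmem : -(aeval G P.divX).mulVec b ∈ krylov G b k := by
    apply neg_mem
    -- For k = 0 the truncated degree of `P.divX` does not show that it vanishes, so this case is
    -- treated directly.
    rcases Nat.eq_zero_or_pos k with rfl | hk
    · have h1 : P.divX = 0 := by
        rw [divX_eq_zero_iff]
        exact eq_C_of_natDegree_le_zero hP
      rw [h1, map_zero, Matrix.zero_mulVec]
      exact zero_mem _
    · rw [aeval_eq_sum_range' (n := k) (by omega), Matrix.sum_mulVec]
      refine sum_mem fun j hj => ?_
      rw [Matrix.smul_mulVec]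
      exact Submodule.smul_mem _ _ (pow_mulVec_mem_krylov (Finset.mem_range.1 hj))
  have h := cg_optimal hG hpos hx k hmem
  rwa [sub_neg_eq_add, ← hval] at h

open Polynomial in
-- In the orthonormal eigenbasis of G, applying P(G) multiplies each coefficient by the value of P
-- at the eigenvalue, and the energy is a sum of squares weighted by the eigenvalues.
theorem polynomial_energy_le (hG : G.IsHermitian) (h0 : ∀ j, 0 ≤ hG.eigenvalues j) {P : ℝ[X]}
    {δ : ℝ} (hP : ∀ j, |P.eval (hG.eigenvalues j)| ≤ δ) (x : Fin l → ℝ) :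
    ((aeval G P).mulVec x) ⬝ᵥ G.mulVec ((aeval G P).mulVec x) ≤
      δ ^ 2 * (x ⬝ᵥ G.mulVec x) := by
  have hsym : G.IsSymm := by
    have := hG
    rwa [Matrix.IsHermitian, Matrix.conjTranspose_eq_transpose_of_trivial] at this
  let u : Fin l → Fin l → ℝ := fun j => (hG.eigenvectorBasis j).ofLp
  have hu : ∀ j, G.mulVec (u j) = hG.eigenvalues j • u j := fun j => hG.mulVec_eigenvectorBasis j
  have hpars : ∀ y z : Fin l → ℝ, y ⬝ᵥ z = ∑ j, (u j ⬝ᵥ y) * (u j ⬝ᵥ z) := by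
    intro y z
    have h := hG.eigenvectorBasis.sum_inner_mul_inner (WithLp.toLp 2 y) (WithLp.toLp 2 z)
    simp only [EuclideanSpace.inner_eq_star_dotProduct, star_trivial] at h
    rw [dotProduct_comm, ← h]
    refine Finset.sum_congr rfl fun j _ => ?_
    rw [dotProduct_comm z]
  have hGu : ∀ j y, u j ⬝ᵥ G.mulVec y = hG.eigenvalues j * (u j ⬝ᵥ y) := fun j y => by
    rw [dotProduct_mulVec_comm hsym, hu, dotProduct_smul, dotProduct_comm, smul_eq_mul]
  have hpow : ∀ (m : ℕ) j y, u j ⬝ᵥ (G ^ m).mulVec y = hG.eigenvalues j ^ m * (u j ⬝ᵥ y) := by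
    intro m j
    induction m with
    | zero => simp
    | succ m ih => 
      intro y
      rw [pow_succ, ← Matrix.mulVec_mulVec, ih, hGu]; ring
  have hPu : ∀ j y, u j ⬝ᵥ (aeval G P).mulVec y = P.eval (hG.eigenvalues j) * (u j ⬝ᵥ y) := by
    intro j y
    rw [aeval_eq_sum_range, Matrix.sum_mulVec, dotProduct_sum, eval_eq_sum_range, Finset.sum_mul]
    refine Finset.sum_congr rfl fun m _ => ?_
    rw [Matrix.smul_mulVec, dotProduct_smul, hpow, smul_eq_mul]; ring
  rw [hpars _ (G.mulVec _), hpars x, Finset.mul_sum]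
  refine Finset.sum_le_sum fun j _ => ?_
  rw [hGu, hGu, hPu]
  have h1 : P.eval (hG.eigenvalues j) ^ 2 ≤ δ ^ 2 := by
    rw [← sq_abs]
    exact pow_le_pow_left₀ (abs_nonneg _) (hP j) 2
  have h2 : 0 ≤ hG.eigenvalues j * (u j ⬝ᵥ x) ^ 2 := mul_nonneg (h0 j) (sq_nonneg _)
  have h3 := mul_le_mul_of_nonneg_right h1 h2
  linarith

open Polynomial in
/-- The Chebyshev bound of the conjugate gradient algorithm. -/
theorem exists_chebyshev_polynomial {a c : ℝ} (ha : 0 < a) (hac : a ≤ c) (k : ℕ) :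
    ∃ P : ℝ[X], P.natDegree ≤ k ∧ P.eval 0 = 1 ∧ ∀ t ∈ Set.Icc a c,
      |P.eval t| ≤ 2 * ((√(c / a) - 1) / (√(c / a) + 1)) ^ k := by
  -- For a = c the affine map to [-1, 1] degenerates. Here the rate is 0, and (1 - X/a)^k vanishes
  -- at a for k > 0.
  rcases eq_or_lt_of_le hac with rfl | hlt
  · refine ⟨(1 - C a⁻¹ * X) ^ k, ?_, by simp, fun t ht => ?_⟩
    · refine natDegree_pow_le.trans ?_
      have : (1 - C a⁻¹ * X : ℝ[X]).natDegree ≤ 1 := by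
        refine (natDegree_sub_le _ _).trans ?_
        simpa using (natDegree_C_mul_le a⁻¹ (X : ℝ[X])).trans natDegree_X_le
      nlinarith
    · obtain rfl : t = a := le_antisymm ht.2 ht.1
      simp only [div_self ha.ne', Real.sqrt_one, sub_self, zero_div, eval_pow, eval_sub, eval_one,
        eval_mul, eval_C, eval_X, inv_mul_cancel₀ ha.ne']
      rw [abs_of_nonneg (pow_nonneg le_rfl k)]
      linarith [pow_nonneg (le_refl (0 : ℝ)) k]
  · set s := √(c / a) with hs
    have hs2 : s ^ 2 = c / a := Real.sq_sqrt (div_nonneg (ha.le.trans hac) ha.le)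
    have hs1 : 1 < s := by
      rw [hs, Real.lt_sqrt zero_le_one, one_pow, one_lt_div ha]; exact hlt
    set q := (s - 1) / (s + 1) with hq
    have hq0 : 0 < q := div_pos (by linarith) (by linarith)
    set σ := (c + a) / (c - a) with hσ
    have hca : 0 < c - a := sub_pos.2 hlt
    -- Thus σ = cosh(log q⁻¹), and the Chebyshev polynomial takes the value cosh(k log q⁻¹) ≥ q⁻ᵏ /
    -- 2 there.
    have hσq : σ = (q⁻¹ + q) / 2 := by
      have hc : c = s ^ 2 * a := by rw [hs2]; field_simp
      have h1 : s - 1 ≠ 0 := by linarith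
      have h2 : s + 1 ≠ 0 := by linarith
      have h3 : s ^ 2 * a - a ≠ 0 := by rw [← hc]; exact hca.ne'
      have h4 : s ^ 2 - 1 ≠ 0 := by nlinarith
      rw [hσ, hq, hc]
      field_simp
      ring
    have hT : q⁻¹ ^ k / 2 ≤ (Chebyshev.T ℝ k).eval σ := by
      have h1 : σ = Real.cosh (Real.log q⁻¹) := by
        rw [Real.cosh_eq, Real.exp_neg, Real.exp_log (inv_pos.2 hq0), inv_inv, hσq]
      rw [h1, Chebyshev.T_real_cosh, Real.cosh_eq]
      have h2 : Real.exp (((k : ℤ) : ℝ) * Real.log q⁻¹) = q⁻¹ ^ k := by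
        rw [Int.cast_natCast, Real.exp_nat_mul, Real.exp_log (inv_pos.2 hq0)]
      rw [h2]
      linarith [Real.exp_pos (-(((k : ℤ) : ℝ) * Real.log q⁻¹))]
    have hTpos : 0 < (Chebyshev.T ℝ k).eval σ := lt_of_lt_of_le (by positivity) hT
    -- The affine argument sends a to 1, c to -1 and 0 to σ; dividing by the value at σ normalizes
    -- the polynomial at 0.
    refine ⟨C ((Chebyshev.T ℝ k).eval σ)⁻¹ *
      (Chebyshev.T ℝ k).comp (C σ - C (2 / (c - a)) * X), ?_, ?_, fun t ht => ?_⟩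
    · refine (natDegree_C_mul_le _ _).trans (natDegree_comp_le.trans ?_)
      have h1 : (C σ - C (2 / (c - a)) * X : ℝ[X]).natDegree ≤ 1 := by
        refine (natDegree_sub_le _ _).trans ?_
        simpa using (natDegree_C_mul_le (2 / (c - a)) (X : ℝ[X])).trans natDegree_X_le
      have h2 : (Chebyshev.T ℝ k).natDegree = k := by
        rw [Chebyshev.natDegree_T]; simp
      rw [h2]
      nlinarith
    · simp [eval_comp, hTpos.ne']
    · have h1 : |σ - 2 / (c - a) * t| ≤ 1 := by
        have h2 : σ - 2 / (c - a) * t = (c + a - 2 * t) / (c - a) := by rw [hσ]; ring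
        rw [h2, abs_div, abs_of_pos hca, div_le_one hca, abs_le]
        constructor <;> linarith [ht.1, ht.2]
      have h3 := Chebyshev.abs_eval_T_real_le_one k h1
      simp only [eval_mul, eval_C, eval_comp, eval_sub, eval_X]
      rw [abs_mul, abs_of_pos (inv_pos.2 hTpos)]
      calc _ ≤ ((Chebyshev.T ℝ k).eval σ)⁻¹ * 1 :=
            mul_le_mul_of_nonneg_left h3 (inv_pos.2 hTpos).le
        _ ≤ (q⁻¹ ^ k / 2)⁻¹ := by
            rw [mul_one]
            exact inv_anti₀ (by positivity) hT
        _ = 2 * q ^ k := by rw [inv_div, inv_pow]; field_simp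

/-- The convergence rate of the conjugate gradient algorithm. -/
theorem cg_error_le (hG : G.IsHermitian) (hpos : ∀ x, x ≠ 0 → 0 < x ⬝ᵥ G.mulVec x) (hl : 0 < l)
    {x : Fin l → ℝ} (hx : G.mulVec x = b) (k : ℕ) :
    0 ≤ (√(condNumber G) - 1) / (√(condNumber G) + 1) ∧
    (x - (cg G b k).x) ⬝ᵥ G.mulVec (x - (cg G b k).x) ≤
      (2 * ((√(condNumber G) - 1) / (√(condNumber G) + 1)) ^ k) ^ 2 * (x ⬝ᵥ G.mulVec x) := by
  have hsym : G.IsSymm := by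
    have := hG
    rwa [Matrix.IsHermitian, Matrix.conjTranspose_eq_transpose_of_trivial] at this
  have hpd : G.PosDef := Matrix.PosDef.of_dotProduct_mulVec_pos hG fun x hx => by
    simpa using hpos x hx
  have hev : ∀ j, 0 < hG.eigenvalues j := hpd.eigenvalues_pos
  have hspec : spectrum ℝ G = Set.range hG.eigenvalues := hG.spectrum_real_eq_range_eigenvalues
  have hfin : (spectrum ℝ G).Finite := hspec ▸ Set.finite_range _
  have hne : (spectrum ℝ G).Nonempty := hspec ▸ ⟨_, ⟨⟨0, hl⟩, rfl⟩⟩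
  have hm : 0 < sInf (spectrum ℝ G) := by
    have := hne.csInf_mem hfin
    rw [hspec] at this
    obtain ⟨j, hj⟩ := this
    rw [hspec, ← hj]
    exact hev j
  have hmM : sInf (spectrum ℝ G) ≤ sSup (spectrum ℝ G) :=
    csInf_le_csSup hne hfin.bddBelow hfin.bddAbove
  refine ⟨div_nonneg (sub_nonneg.2 ?_) (by positivity), ?_⟩
  · rw [Real.one_le_sqrt, condNumber, one_le_div hm]
    exact hmM
  · obtain ⟨P, hdeg, hP0, hP⟩ := exists_chebyshev_polynomial hm hmM k
    refine (cg_le_polynomial hsym hpos hx hdeg hP0).trans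
      (polynomial_energy_le hG (fun j => (hev j).le) (fun j => hP _ ?_) x)
    have hj : hG.eigenvalues j ∈ spectrum ℝ G := hspec ▸ ⟨j, rfl⟩
    exact ⟨csInf_le hfin.bddBelow hj, le_csSup hfin.bddAbove hj⟩

end ConjugateGradient

end SpectralLOD


/-! ### Spans under Gram-Schmidt; dual interpolation and the functions g_p. -/

namespace SpectralLOD

/-! ### The modified Gram-Schmidt algorithm preserves lengths and spans -/

/-- The span of the members of a list. -/
def listSpan (l : List Fn) : Submodule ℝ Fn := Submodule.span ℝ {v | v ∈ l}

theorem listSpan_cons (v : Fn) (l : List Fn) :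
    listSpan (v :: l) = Submodule.span ℝ {v} ⊔ listSpan l := by
  rw [listSpan, listSpan, ← Submodule.span_union]
  congr 1
  ext w; simp

theorem listSpan_append (l m : List Fn) : listSpan (l ++ m) = listSpan l ⊔ listSpan m := by
  rw [listSpan, listSpan, listSpan, ← Submodule.span_union]
  congr 1
  ext w; simp

theorem listSpan_mono {l m : List Fn} (h : l ⊆ m) : listSpan l ≤ listSpan m :=
  Submodule.span_mono fun _ hv => h hv

theorem mem_listSpan {l : List Fn} {v : Fn} (h : v ∈ l) : v ∈ listSpan l :=
  Submodule.subset_span h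

theorem listSpan_le {l : List Fn} {W : Submodule ℝ Fn} : listSpan l ≤ W ↔ ∀ v ∈ l, v ∈ W :=
  Submodule.span_le

theorem sup_listSpan_map (W : Submodule ℝ Fn) (f : Fn → Fn) (l : List Fn)
    (h : ∀ w ∈ l, f w - w ∈ W) : W ⊔ listSpan (l.map f) = W ⊔ listSpan l := by
  apply le_antisymm <;> refine sup_le le_sup_left (listSpan_le.2 fun v hv => ?_)
  · obtain ⟨w, hw, rfl⟩ := List.mem_map.1 hv
    rw [← sub_add_cancel (f w) w]
    exact add_mem (Submodule.mem_sup_left (h w hw)) (Submodule.mem_sup_right (mem_listSpan hw))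
  · rw [← sub_sub_cancel (f v) v]
    exact sub_mem (Submodule.mem_sup_right (mem_listSpan (List.mem_map.2 ⟨v, hv, rfl⟩)))
      (Submodule.mem_sup_left (h v hv))

variable {n N r : ℕ} {κ : Fn} {β : ℝ} {i : ℕ × ℕ}

theorem length_mgs (κ : Fn) (l : List Fn) : (mgs κ l).length = l.length := by
  induction h : l.length generalizing l with
  | zero => rw [List.length_eq_zero_iff.1 h, mgs]; rfl
  | succ m ih =>
    cases l with
    | nil => simp at h
    | cons v vs =>
      rw [mgs, List.length_cons, ih]
      simpa using h

/-- Normalizing keeps the line spanned by v (a zero vector stays zero), and the other members change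
only by multiples of it. The induction is on the length, since the recursive call acts on a modified
tail. -/
theorem listSpan_mgs (hn : 0 < n) (hκ : CoeffBounds κ β) (l : List Fn) (hl : ∀ v ∈ l, v ∈ Vh n) :
    listSpan (mgs κ l) = listSpan l := by
  induction h : l.length generalizing l with
  | zero => rw [List.length_eq_zero_iff.1 h, mgs]
  | succ m ih =>
    cases l with
    | nil => simp at h
    | cons v vs =>
      have hv : v ∈ Vh n := hl v (by simp)
      have hvs : ∀ w ∈ vs, w ∈ Vh n := fun w hw => hl w (by simp [hw])
      obtain ⟨e, he⟩ : ∃ e : Fn, e = (√(aForm κ v v))⁻¹ • v := ⟨_, rfl⟩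
      have hev : e ∈ Vh n := he ▸ (Vh n).smul_mem _ hv
      have hspan : Submodule.span ℝ {e} = Submodule.span ℝ {v} := by
        by_cases h0 : v = 0
        · simp [he, h0]
        · have := aForm_pos hn hκ hv h0
          rw [he]
          exact Submodule.span_singleton_smul_eq (by
            rw [isUnit_iff_ne_zero]; positivity) v
      rw [mgs, ← he, listSpan_cons, ih, sup_listSpan_map, hspan, listSpan_cons]
      · intro w _
        rw [sub_sub_cancel_left]
        exact neg_mem (Submodule.smul_mem _ _ (Submodule.mem_span_singleton_self e))
      · intro w hw
        obtain ⟨w', hw', rfl⟩ := List.mem_map.1 hw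
        exact sub_mem (hvs w' hw') ((Vh n).smul_mem _ hev)
      · simpa using h

theorem residual_sub_mem (B : List Fn) (g : Fn) : residual κ B g - g ∈ listSpan B := by
  rw [residual, sub_sub_cancel_left]
  refine neg_mem (list_sum_mem fun v hv => ?_)
  obtain ⟨e, he, rfl⟩ := List.mem_map.1 hv
  exact Submodule.smul_mem _ _ (mem_listSpan he)

theorem length_orthonormalizeAfter (κ : Fn) (prev gs : List Fn) :
    (orthonormalizeAfter κ prev gs).length = gs.length := by
  rw [orthonormalizeAfter, length_mgs, List.length_map]

theorem listSpan_le_Vh {l : List Fn} (hl : ∀ v ∈ l, v ∈ Vh n) : listSpan l ≤ Vh n :=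
  listSpan_le.2 hl

/-- Residuals differ from the original functions by elements of the span of `prev`, so only the sum
with that span is preserved, not the span of the new functions alone. -/
theorem sup_listSpan_orthonormalizeAfter (hn : 0 < n) (hκ : CoeffBounds κ β) {prev gs : List Fn}
    (hp : ∀ v ∈ prev, v ∈ Vh n) (hg : ∀ v ∈ gs, v ∈ Vh n) :
    listSpan prev ⊔ listSpan (orthonormalizeAfter κ prev gs) = listSpan prev ⊔ listSpan gs := by
  have hres : ∀ g, residual κ (mgs κ prev) g - g ∈ listSpan prev := fun g => by
    rw [← listSpan_mgs hn hκ prev hp]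
    exact residual_sub_mem _ g
  rw [orthonormalizeAfter, listSpan_mgs hn hκ, sup_listSpan_map _ _ _ fun w _ => hres w]
  intro v hv
  obtain ⟨g, hg', rfl⟩ := List.mem_map.1 hv
  rw [← sub_add_cancel (residual κ (mgs κ prev) g) g]
  exact add_mem (listSpan_le_Vh hp (hres g)) (hg g hg')

/-! ### Dual functions -/

/-- The functional `s_i(·, ψ_j)` on `V_h`. -/
noncomputable def SpectralData.coeff (S : SpectralData N r κ) (hκ : CoeffBounds κ β)
    (hi : i ∈ cells N) {j : ℕ} (hj : j < dimLoc N r i) : Vh (N * r) →ₗ[ℝ] ℝ :=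
  (sLocB r hκ hi).flip ⟨S.psi i j, S.psi_mem i hi j hj⟩ ∘ₗ
    (restrictTo (cell N i)).submoduleMap (Vh (N * r))

theorem SpectralData.coeff_apply (S : SpectralData N r κ) (hκ : CoeffBounds κ β)
    (hi : i ∈ cells N) {j : ℕ} (hj : j < dimLoc N r i) (v : Vh (N * r)) :
    S.coeff hκ hi hj v = sLoc N κ i v (S.psi i j) := sLoc_restrictTo _ _

theorem sLoc_psi_sum (S : SpectralData N r κ) (hκ : CoeffBounds κ β) (hi : i ∈ cells N) {j : ℕ}
    (hj : j < dimLoc N r i) {ι : Type*} (s : Finset ι) (c : ι → ℝ) (v : ι → Fn)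
    (hv : ∀ k ∈ s, v k ∈ Vh (N * r)) :
    sLoc N κ i (∑ k ∈ s, c k • v k) (S.psi i j) = ∑ k ∈ s, c k * sLoc N κ i (v k) (S.psi i j) := by
  classical
  have h1 : ∑ k ∈ s, c k • v k =
      ((∑ k ∈ s.attach, c k • (⟨v k, hv k k.2⟩ : Vh (N * r)) : Vh (N * r)) : Fn) := by
    rw [Submodule.coe_sum, ← Finset.sum_attach]
    rfl
  rw [h1, ← S.coeff_apply hκ hi hj, map_sum, ← Finset.sum_attach s]
  refine Finset.sum_congr rfl fun k _ => ?_
  rw [map_smul, S.coeff_apply, smul_eq_mul]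

theorem sLoc_psi_sub (S : SpectralData N r κ) (hκ : CoeffBounds κ β) (hi : i ∈ cells N) {j : ℕ}
    (hj : j < dimLoc N r i) {u v : Fn} (hu : u ∈ Vh (N * r)) (hv : v ∈ Vh (N * r)) :
    sLoc N κ i (u - v) (S.psi i j) = sLoc N κ i u (S.psi i j) - sLoc N κ i v (S.psi i j) := by
  have := map_sub (S.coeff hκ hi hj) ⟨u, hu⟩ ⟨v, hv⟩
  simpa only [S.coeff_apply, Submodule.coe_sub] using this

/-- `Ker Π_aux` as a subspace. -/
def SpectralData.kerSub (S : SpectralData N r κ) (hκ : CoeffBounds κ β) : Submodule ℝ Fn where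
  carrier := S.kerPi
  zero_mem' := (mem_kerPi_iff S hκ _).2 ⟨zero_mem _, fun i hi j hj => by
    have := map_zero (S.coeff hκ hi (hj.trans_le (S.L_le i hi)))
    rwa [S.coeff_apply] at this⟩
  add_mem' := by
    intro u v hu hv
    rw [mem_kerPi_iff S hκ] at hu hv ⊢
    refine ⟨add_mem hu.1 hv.1, fun i hi j hj => ?_⟩
    have := map_add (S.coeff hκ hi (hj.trans_le (S.L_le i hi))) ⟨u, hu.1⟩ ⟨v, hv.1⟩
    simp only [S.coeff_apply] at this
    rw [hu.2 i hi j hj, hv.2 i hi j hj, add_zero] at this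
    exact this
  smul_mem' := by
    intro t v hv
    rw [mem_kerPi_iff S hκ] at hv ⊢
    refine ⟨(Vh _).smul_mem t hv.1, fun i hi j hj => ?_⟩
    have := map_smul (S.coeff hκ hi (hj.trans_le (S.L_le i hi))) t ⟨v, hv.1⟩
    simp only [S.coeff_apply] at this
    rw [hv.2 i hi j hj, smul_zero] at this
    exact this

theorem isInteriorNode_of_inInterior {p : ℕ × ℕ} (hi : i ∈ cells N) (h : InInterior r i p) :
    IsInteriorNode (N * r) p := by
  simp only [cells, Finset.mem_product, Finset.mem_range] at hi
  obtain ⟨h1, h2, h3, h4⟩ := h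
  have e1 : (i.1 + 1) * r ≤ N * r := Nat.mul_le_mul_right r hi.1
  have e2 : (i.2 + 1) * r ≤ N * r := Nat.mul_le_mul_right r hi.2
  exact ⟨by omega, by omega, by omega, by omega⟩

/-- All fine squares around a vertex in the interior of a coarse square belong to that coarse
square. -/
theorem hat_eq_zero_on_other_cell (hN : 0 < N) (hr : 0 < r) {i' p : ℕ × ℕ}
    (h : InInterior r i' p) (hne : i' ≠ i) : ∀ x ∈ cell N i, hat (N * r) p x = 0 := by
  intro x hx
  obtain ⟨l, hl1, hl2, hl⟩ := exists_fine_Icc hN hr hx.1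
  obtain ⟨m, hm1, hm2, hm⟩ := exists_fine_Icc hN hr hx.2
  refine hat_eq_zero_on_cell (Nat.mul_pos hN hr) (c := (l, m)) (fun hv => hne ?_) x ⟨hl, hm⟩
  obtain ⟨h1, h2, h3, h4⟩ := h
  simp only [IsVertexOf] at hv
  have aux : ∀ {k k' t s : ℕ}, k' * r < t → t < (k' + 1) * r → k * r ≤ s → s < (k + 1) * r →
      (t = s ∨ t = s + 1) → k' = k := by
    intro k k' t s a1 a2 a3 a4 a5
    have b1 : k' < k + 1 := Nat.lt_of_mul_lt_mul_right (a := r) (by omega)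
    have b2 : k < k' + 1 := Nat.lt_of_mul_lt_mul_right (a := r) (by omega)
    omega
  exact Prod.ext (aux h1 h2 hl1 hl2 hv.1) (aux h3 h4 hm1 hm2 hv.2)

variable {S : SpectralData N r κ} (D : DualNodes S)

theorem dualHat_mem (hN : 0 < N) (hr : 0 < r) (hi : i ∈ cells N) {j : ℕ} (hj : j < S.L i) :
    D.dualHat i j ∈ Vh (N * r) :=
  (Vh _).smul_mem _ (hat_mem_Vh (Nat.mul_pos hN hr)
    (isInteriorNode_of_inInterior hi (D.interior i hi j hj)))

theorem dualFun_mem (hN : 0 < N) (hr : 0 < r) (hi : i ∈ cells N) (j : Fin (S.L i)) :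
    D.dualFun i j ∈ Vh (N * r) :=
  sum_mem fun l _ => (Vh _).smul_mem _ (dualHat_mem D hN hr hi l.2)

theorem dualHat_eq_zero_on_other_cell (hN : 0 < N) (hr : 0 < r) {i' : ℕ × ℕ} (hi' : i' ∈ cells N)
    {j : ℕ} (hj : j < S.L i') (hne : i' ≠ i) : ∀ x ∈ cell N i, D.dualHat i' j x = 0 := by
  intro x hx
  have := hat_eq_zero_on_other_cell hN hr (D.interior i' hi' j hj) hne x hx
  simp [DualNodes.dualHat, hatLocNormalized, this]

theorem sLoc_eq_zero_of_eq_zero_on_cell {u : Fn} (hu : ∀ x ∈ cell N i, u x = 0) (v : Fn) :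
    sLoc N κ i u v = 0 := by
  rw [sLoc, setIntegral_congr_fun (g := fun _ => 0) (measurableSet_cell N i)
    (fun x hx => by simp [hu x hx])]
  simp

/-- Biorthogonality of dual functions and eigenfunctions is the identity S_i⁻¹ S_i = 1. -/
theorem sLoc_dualFun (hN : 0 < N) (hr : 0 < r) (hκ : CoeffBounds κ β) (hi : i ∈ cells N)
    (j k : Fin (S.L i)) : sLoc N κ i (D.dualFun i j) (S.psi i k) = if j = k then 1 else 0 := by
  rw [DualNodes.dualFun, sLoc_psi_sum S hκ hi (k.2.trans_le (S.L_le i hi)) _ _ _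
    fun l _ => dualHat_mem D hN hr hi l.2]
  have h := Matrix.nonsing_inv_mul (S.dualMatrix D.node i)
    (isUnit_iff_ne_zero.2 (D.nonsingular i hi))
  have h2 := congrFun (congrFun h j) k
  rw [Matrix.mul_apply, Matrix.one_apply] at h2
  exact h2

/-- The interpolation `∑_i ∑_j s_i(v, ψ_j) φ̃_j` of `v` by dual functions. -/
noncomputable def DualNodes.dualInterp (D : DualNodes S) (v : Fn) : Fn :=
  ∑ i ∈ cells N, ∑ j : Fin (S.L i), sLoc N κ i v (S.psi i j) • D.dualFun i j

theorem dualInterp_mem (hN : 0 < N) (hr : 0 < r) (v : Fn) : D.dualInterp v ∈ Vh (N * r) :=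
  sum_mem fun _ hi => sum_mem fun j _ => (Vh _).smul_mem _ (dualFun_mem D hN hr hi j)

/-- By biorthogonality the interpolant has the moments of v; dual functions of other squares vanish
on K_i. It follows that v minus its interpolant lies in Ker Π_aux. -/
theorem sLoc_dualInterp (hN : 0 < N) (hr : 0 < r) (hκ : CoeffBounds κ β) (hi : i ∈ cells N)
    (k : Fin (S.L i)) (v : Fn) :
    sLoc N κ i (D.dualInterp v) (S.psi i k) = sLoc N κ i v (S.psi i k) := by
  have hk := k.2.trans_le (S.L_le i hi)
  have h1 := sLoc_psi_sum S hκ hi hk (cells N) (fun _ => 1)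
    (fun i => ∑ j : Fin (S.L i), sLoc N κ i v (S.psi i j) • D.dualFun i j)
    (fun i hi => sum_mem fun j _ => (Vh _).smul_mem _ (dualFun_mem D hN hr hi j))
  simp only [one_smul, one_mul] at h1
  rw [DualNodes.dualInterp, h1, Finset.sum_eq_single_of_mem i hi]
  · rw [sLoc_psi_sum S hκ hi hk _ _ _ fun j _ => dualFun_mem D hN hr hi j]
    simp [sLoc_dualFun D hN hr hκ hi]
  · intro i' hi' hne
    apply sLoc_eq_zero_of_eq_zero_on_cell
    intro x hx
    rw [Finset.sum_apply]
    refine Finset.sum_eq_zero fun j _ => ?_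
    rw [Pi.smul_apply, DualNodes.dualFun, Finset.sum_apply, Finset.sum_eq_zero, smul_zero]
    intro l _
    rw [Pi.smul_apply, dualHat_eq_zero_on_other_cell D hN hr hi' l.2 hne x hx, smul_zero]

theorem sub_dualInterp_mem_kerPi (hN : 0 < N) (hr : 0 < r) (hκ : CoeffBounds κ β) {v : Fn}
    (hv : v ∈ Vh (N * r)) : v - D.dualInterp v ∈ S.kerPi := by
  rw [mem_kerPi_iff S hκ]
  refine ⟨sub_mem hv (dualInterp_mem D hN hr v), fun i hi j hj => ?_⟩
  rw [sLoc_psi_sub S hκ hi (hj.trans_le (S.L_le i hi)) hv (dualInterp_mem D hN hr v),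
    sLoc_dualInterp D hN hr hκ hi ⟨j, hj⟩, sub_self]

theorem dualInterp_of_mem_kerPi (hκ : CoeffBounds κ β) {v : Fn} (hv : v ∈ S.kerPi) :
    D.dualInterp v = 0 := by
  rw [mem_kerPi_iff S hκ] at hv
  exact Finset.sum_eq_zero fun i hi => Finset.sum_eq_zero fun j _ => by
    rw [hv.2 i hi j j.2, zero_smul]

/-- The reverse product S_i S_i⁻¹ = 1: interpolation reproduces the dual hats, so it is a projection
onto their span along Ker Π_aux. -/
theorem sum_dualMatrix_dualFun (hi : i ∈ cells N) (j : Fin (S.L i)) :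
    ∑ k : Fin (S.L i), sLoc N κ i (D.dualHat i j) (S.psi i k) • D.dualFun i k = D.dualHat i j := by
  have h := Matrix.mul_nonsing_inv (S.dualMatrix D.node i)
    (isUnit_iff_ne_zero.2 (D.nonsingular i hi))
  have h2 : ∀ l, ∑ k : Fin (S.L i), sLoc N κ i (D.dualHat i j) (S.psi i k) * (S.dualMatrix D.node i)⁻¹ k l =
      if j = l then 1 else 0 := fun l => by
    have := congrFun (congrFun h j) l
    rwa [Matrix.mul_apply, Matrix.one_apply] at this
  simp only [DualNodes.dualFun, Finset.smul_sum, smul_smul]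
  rw [Finset.sum_comm]
  simp only [← Finset.sum_smul, h2]
  simp

theorem dualInterp_dualHat (hN : 0 < N) (hr : 0 < r) (hi : i ∈ cells N) {j : ℕ} (hj : j < S.L i) :
    D.dualInterp (D.dualHat i j) = D.dualHat i j := by
  rw [DualNodes.dualInterp, Finset.sum_eq_single_of_mem i hi]
  · exact sum_dualMatrix_dualFun D hi ⟨j, hj⟩
  · intro i' _ hne
    refine Finset.sum_eq_zero fun k _ => ?_
    rw [sLoc_eq_zero_of_eq_zero_on_cell (dualHat_eq_zero_on_other_cell D hN hr hi hj hne.symm),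
      zero_smul]

theorem dualInterp_sum (hκ : CoeffBounds κ β) {ι : Type*} (s : Finset ι) (c : ι → ℝ) (v : ι → Fn)
    (hv : ∀ k ∈ s, v k ∈ Vh (N * r)) :
    D.dualInterp (∑ k ∈ s, c k • v k) = ∑ k ∈ s, c k • D.dualInterp (v k) := by
  simp only [DualNodes.dualInterp, Finset.smul_sum, smul_smul]
  rw [Finset.sum_comm]
  refine Finset.sum_congr rfl fun i hi => ?_
  rw [Finset.sum_comm]
  refine Finset.sum_congr rfl fun j _ => ?_
  rw [sLoc_psi_sum S hκ hi (j.2.trans_le (S.L_le i hi)) s c v hv, Finset.sum_smul]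

theorem kerFun_eq (p : ℕ × ℕ) : D.kerFun p = hatNormalized N r κ p -
    D.dualInterp (hatNormalized N r κ p) := rfl

theorem hatNormalized_mem (hN : 0 < N) (hr : 0 < r) (κ : Fn) {p : ℕ × ℕ}
    (hp : IsInteriorNode (N * r) p) : hatNormalized N r κ p ∈ Vh (N * r) :=
  (Vh _).smul_mem _ (hat_mem_Vh (Nat.mul_pos hN hr) hp)

theorem kerFun_mem_kerPi (hN : 0 < N) (hr : 0 < r) (hκ : CoeffBounds κ β) {p : ℕ × ℕ}
    (hp : IsInteriorNode (N * r) p) : D.kerFun p ∈ S.kerPi :=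
  sub_dualInterp_mem_kerPi D hN hr hκ (hatNormalized_mem hN hr κ hp)

theorem hat_ne_zero (hn : 0 < n) (p : ℕ × ℕ) : hat n p ≠ 0 := fun h => by
  have := hat_gridPt hn p p
  rw [h] at this
  simp at this

theorem hat_eq_smul_hatNormalized (hN : 0 < N) (hr : 0 < r) (hκ : CoeffBounds κ β) {p : ℕ × ℕ}
    (hp : IsInteriorNode (N * r) p) :
    hat (N * r) p = √(aForm κ (hat (N * r) p) (hat (N * r) p)) • hatNormalized N r κ p := by
  have hn := Nat.mul_pos hN hr
  have := aForm_pos hn hκ (hat_mem_Vh hn hp) (hat_ne_zero hn p)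
  rw [hatNormalized, smul_smul, mul_inv_cancel₀ (by positivity), one_smul]

theorem energyForm_of_eq_zero_other {u v : Fn} (hN : 0 < N) (hn : 0 < n) (hκ : CoeffBounds κ β)
    (hi : i ∈ cells N)
    (hu : u ∈ Vh n) (hv : v ∈ Vh n) (h : ∀ i' ∈ cells N, i' ≠ i → ∀ x ∈ cell N i', v x = 0) :
    aForm κ u v = aLoc N κ i u v := by
  rw [aForm, energyForm_Omega_eq_sum hN hn hκ hu hv, Finset.sum_eq_single_of_mem i hi]
  · rfl
  · exact fun i' hi' hne => energyForm_one_const_on_cell u (h i' hi' hne)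

/-- The hat is supported in K_i, so its local and global energies coincide. -/
theorem dualHat_eq_hatNormalized (hN : 0 < N) (hr : 0 < r) (hκ : CoeffBounds κ β)
    (hi : i ∈ cells N) {j : ℕ} (hj : j < S.L i) :
    D.dualHat i j = hatNormalized N r κ (D.node i j) := by
  have hn := Nat.mul_pos hN hr
  have hp := hat_mem_Vh hn (isInteriorNode_of_inInterior hi (D.interior i hi j hj))
  rw [DualNodes.dualHat, hatLocNormalized, hatNormalized,
    energyForm_of_eq_zero_other hN hn hκ hi hp hp fun i' _ hne =>
      hat_eq_zero_on_other_cell hN hr (D.interior i hi j hj) hne.symm]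

open Classical in
/-- The functions `g_p` span `Ker Π_aux`. -/
theorem kerPi_eq_span (hN : 0 < N) (hr : 0 < r) (hκ : CoeffBounds κ β) :
    S.kerSub hκ = Submodule.span ℝ
      (D.kerFun '' {p | IsInteriorNode (N * r) p ∧ ¬ D.IsDual p}) := by
  have hn := Nat.mul_pos hN hr
  apply le_antisymm
  · intro v hv
    have hvV : v ∈ Vh (N * r) := hv.1
    obtain ⟨c, hc⟩ : ∃ c : ℕ × ℕ → ℝ,
        v = ∑ p ∈ nodes (N * r), c p • hatNormalized N r κ p := by
      refine ⟨fun p => v (gridPt (N * r) p) * √(aForm κ (hat (N * r) p) (hat (N * r) p)), ?_⟩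
      conv_lhs => rw [Vh_eq_sum_hat hn hvV]
      refine Finset.sum_congr rfl fun p hp => ?_
      rw [mul_smul, ← hat_eq_smul_hatNormalized hN hr hκ (mem_nodes.1 hp)]
    -- For v in the kernel the interpolant is zero. Subtracting it term by term from the nodal
    -- expansion of v turns each φ_p into g_p, and g_p = 0 at the dual nodes.
    have h2 := dualInterp_sum D hκ (nodes (N * r)) c (hatNormalized N r κ)
      fun p hp => hatNormalized_mem hN hr κ (mem_nodes.1 hp)
    rw [← hc, dualInterp_of_mem_kerPi D hκ hv] at h2
    rw [← sub_zero v, h2, hc, ← Finset.sum_sub_distrib]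
    refine sum_mem fun p hp => ?_
    rw [← smul_sub, ← kerFun_eq]
    apply Submodule.smul_mem
    by_cases hd : D.IsDual p
    · obtain ⟨i, hi, j, hj, rfl⟩ := hd
      rw [kerFun_eq, ← dualHat_eq_hatNormalized D hN hr hκ hi hj, dualInterp_dualHat D hN hr hi hj,
        sub_self]
      exact zero_mem _
    · exact Submodule.subset_span ⟨p, ⟨mem_nodes.1 hp, hd⟩, rfl⟩
  · rw [Submodule.span_le]
    rintro _ ⟨p, hp, rfl⟩
    exact kerFun_mem_kerPi D hN hr hκ hp.1

theorem dualInterp_gridPt (hn : 0 < N * r) {q : ℕ × ℕ} (hq : ¬ D.IsDual q) (v : Fn) :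
    D.dualInterp v (gridPt (N * r) q) = 0 := by
  simp only [DualNodes.dualInterp, DualNodes.dualFun, DualNodes.dualHat, hatLocNormalized,
    Finset.sum_apply, Pi.smul_apply, smul_eq_mul]
  refine Finset.sum_eq_zero fun i hi => Finset.sum_eq_zero fun j _ => ?_
  rw [Finset.sum_eq_zero, mul_zero]
  intro l _
  rw [hat_gridPt hn, if_neg fun h => hq ⟨i, hi, l, l.2, h⟩]
  simp

/-- Dual functions vanish at all vertices that are not dual nodes, so evaluation at such a vertex q
isolates the coefficient of g_q. -/
theorem linearIndependent_kerFun (hN : 0 < N) (hr : 0 < r) (hκ : CoeffBounds κ β) :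
    LinearIndependent ℝ fun p : {p | IsInteriorNode (N * r) p ∧ ¬ D.IsDual p} => D.kerFun p := by
  classical
  have hn := Nat.mul_pos hN hr
  rw [linearIndependent_iff']
  intro s c hc q hq
  have h := congrFun hc (gridPt (N * r) q)
  rw [Finset.sum_apply, Finset.sum_eq_single_of_mem q hq] at h
  · rw [Pi.smul_apply, kerFun_eq, Pi.sub_apply, dualInterp_gridPt D hn q.2.2, hatNormalized,
      Pi.smul_apply, hat_gridPt hn, if_pos rfl] at h
    have := aForm_pos hn hκ (hat_mem_Vh hn q.2.1) (hat_ne_zero hn q)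
    have h' : (√(aForm κ (hat (N * r) q) (hat (N * r) q)))⁻¹ ≠ 0 := by positivity
    simpa [h'] using h
  · intro p _ hpq
    rw [Pi.smul_apply, kerFun_eq, Pi.sub_apply, dualInterp_gridPt D hn q.2.2, hatNormalized,
      Pi.smul_apply, hat_gridPt hn, if_neg fun h => hpq (Subtype.ext h)]
    simp

end SpectralLOD


/-! ### The constructed functions form a basis of Ker Π_aux: spanning, then counting. -/

namespace SpectralLOD

/-! ### The special basis spans the kernel and is linearly independent -/

variable {n N r : ℕ} {κ : Fn} {β : ℝ} {i : ℕ × ℕ} {S : SpectralData N r κ} (D : DualNodes S)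

open Classical in
/-- The vertices of the functions in `elemBasis`. -/
noncomputable def DualNodes.elemNodes (D : DualNodes S) (order : List (ℕ × ℕ)) (i : ℕ × ℕ) :
    List (ℕ × ℕ) :=
  order.filter fun p => InInterior r i p ∧ ¬ D.IsDual p

open Classical in
/-- The vertices in the interior of a vertical edge. -/
noncomputable def vEdgeNodes (r : ℕ) (order : List (ℕ × ℕ)) (e : ℕ × ℕ) : List (ℕ × ℕ) :=
  order.filter fun p => p.1 = (e.1 + 1) * r ∧ e.2 * r < p.2 ∧ p.2 < (e.2 + 1) * r

open Classical in
/-- The vertices in the interior of a horizontal edge. -/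
noncomputable def hEdgeNodes (r : ℕ) (order : List (ℕ × ℕ)) (e : ℕ × ℕ) : List (ℕ × ℕ) :=
  order.filter fun p => e.1 * r < p.1 ∧ p.1 < (e.1 + 1) * r ∧ p.2 = (e.2 + 1) * r

theorem elemBasis_eq (order : List (ℕ × ℕ)) (i : ℕ × ℕ) :
    D.elemBasis order i = mgs κ ((D.elemNodes order i).map D.kerFun) := rfl

theorem vEdgeBasis_eq (order : List (ℕ × ℕ)) (e : ℕ × ℕ) :
    D.vEdgeBasis order e = orthonormalizeAfter κ
      (D.elemBasis order e ++ D.elemBasis order (e.1 + 1, e.2))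
      ((vEdgeNodes r order e).map D.kerFun) := rfl

theorem hEdgeBasis_eq (order : List (ℕ × ℕ)) (e : ℕ × ℕ) :
    D.hEdgeBasis order e = orthonormalizeAfter κ
      (D.elemBasis order e ++ D.elemBasis order (e.1, e.2 + 1))
      ((hEdgeNodes r order e).map D.kerFun) := rfl

theorem mem_elemNodes {order : List (ℕ × ℕ)} {i p : ℕ × ℕ} :
    p ∈ D.elemNodes order i ↔ p ∈ order ∧ InInterior r i p ∧ ¬ D.IsDual p := by
  simp [DualNodes.elemNodes]

theorem mem_vEdgeNodes {order : List (ℕ × ℕ)} {e p : ℕ × ℕ} : p ∈ vEdgeNodes r order e ↔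
    p ∈ order ∧ p.1 = (e.1 + 1) * r ∧ e.2 * r < p.2 ∧ p.2 < (e.2 + 1) * r := by
  simp [vEdgeNodes]

theorem mem_hEdgeNodes {order : List (ℕ × ℕ)} {e p : ℕ × ℕ} : p ∈ hEdgeNodes r order e ↔
    p ∈ order ∧ e.1 * r < p.1 ∧ p.1 < (e.1 + 1) * r ∧ p.2 = (e.2 + 1) * r := by
  simp [hEdgeNodes]

theorem mem_range_product {a b : ℕ} {c : ℕ × ℕ} :
    c ∈ List.range a ×ˢ List.range b ↔ c.1 < a ∧ c.2 < b := by
  obtain ⟨c1, c2⟩ := c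
  exact List.pair_mem_product.trans (and_congr List.mem_range List.mem_range)

section Span

variable {order : List (ℕ × ℕ)}

theorem kerSub_le_Vh (S : SpectralData N r κ) (hκ : CoeffBounds κ β) :
    S.kerSub hκ ≤ Vh (N * r) := fun _ hv => hv.1

theorem listSpan_map_kerFun_le (hN : 0 < N) (hr : 0 < r) (hκ : CoeffBounds κ β)
    {l : List (ℕ × ℕ)} (hl : ∀ p ∈ l, IsInteriorNode (N * r) p) :
    listSpan (l.map D.kerFun) ≤ S.kerSub hκ := by
  refine listSpan_le.2 fun v hv => ?_
  obtain ⟨p, hp, rfl⟩ := List.mem_map.1 hv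
  exact kerFun_mem_kerPi D hN hr hκ (hl p hp)

theorem mem_Vh_of_listSpan_le {l : List Fn} {hκ : CoeffBounds κ β}
    (h : listSpan l ≤ S.kerSub hκ) : ∀ v ∈ l, v ∈ Vh (N * r) :=
  fun _ hv => kerSub_le_Vh S hκ (h (mem_listSpan hv))

variable (hN : 0 < N) (hr : 0 < r) (hκ : CoeffBounds κ β)
  (ho : ∀ p, p ∈ order ↔ IsInteriorNode (N * r) p)

include hN hr ho

theorem listSpan_elemBasis (i : ℕ × ℕ) :
    listSpan (D.elemBasis order i) = listSpan ((D.elemNodes order i).map D.kerFun) ∧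
      listSpan (D.elemBasis order i) ≤ S.kerSub hκ := by
  have h := listSpan_map_kerFun_le D hN hr hκ (l := D.elemNodes order i)
    fun p hp => (ho p).1 ((mem_elemNodes D).1 hp).1
  have h2 : listSpan (D.elemBasis order i) = listSpan ((D.elemNodes order i).map D.kerFun) := by
    rw [elemBasis_eq, listSpan_mgs (Nat.mul_pos hN hr) hκ _ (mem_Vh_of_listSpan_le h)]
  exact ⟨h2, h2 ▸ h⟩

/-- Common to edges and vertices: the new functions stay in the kernel, and together with the
earlier ones they recover the g_p from which they were made. -/
theorem listSpan_orthonormalizeAfter_kerFun {prev : List Fn} (hp : listSpan prev ≤ S.kerSub hκ)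
    {l : List (ℕ × ℕ)} (hl : ∀ p ∈ l, p ∈ order) :
    listSpan (orthonormalizeAfter κ prev (l.map D.kerFun)) ≤ S.kerSub hκ ∧
      ∀ p ∈ l, D.kerFun p ∈
        listSpan prev ⊔ listSpan (orthonormalizeAfter κ prev (l.map D.kerFun)) := by
  have h := listSpan_map_kerFun_le D hN hr hκ (l := l) fun p hp => (ho p).1 (hl p hp)
  have h2 := sup_listSpan_orthonormalizeAfter (Nat.mul_pos hN hr) hκ
    (mem_Vh_of_listSpan_le hp) (mem_Vh_of_listSpan_le h)
  refine ⟨le_sup_right.trans (h2.le.trans (sup_le hp h)), fun p hp => ?_⟩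
  rw [h2]
  exact Submodule.mem_sup_right (mem_listSpan (List.mem_map_of_mem hp))

theorem listSpan_vEdgeBasis (e : ℕ × ℕ) : listSpan (D.vEdgeBasis order e) ≤ S.kerSub hκ ∧
    ∀ p ∈ vEdgeNodes r order e, D.kerFun p ∈ listSpan (D.elemBasis order e) ⊔
      listSpan (D.elemBasis order (e.1 + 1, e.2)) ⊔ listSpan (D.vEdgeBasis order e) := by
  rw [← listSpan_append, vEdgeBasis_eq]
  refine listSpan_orthonormalizeAfter_kerFun D hN hr hκ ho ?_ fun p hp => (mem_vEdgeNodes.1 hp).1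
  rw [listSpan_append]
  exact sup_le (listSpan_elemBasis D hN hr hκ ho _).2 (listSpan_elemBasis D hN hr hκ ho _).2

theorem listSpan_hEdgeBasis (e : ℕ × ℕ) : listSpan (D.hEdgeBasis order e) ≤ S.kerSub hκ ∧
    ∀ p ∈ hEdgeNodes r order e, D.kerFun p ∈ listSpan (D.elemBasis order e) ⊔
      listSpan (D.elemBasis order (e.1, e.2 + 1)) ⊔ listSpan (D.hEdgeBasis order e) := by
  rw [← listSpan_append, hEdgeBasis_eq]
  refine listSpan_orthonormalizeAfter_kerFun D hN hr hκ ho ?_ fun p hp => (mem_hEdgeNodes.1 hp).1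
  rw [listSpan_append]
  exact sup_le (listSpan_elemBasis D hN hr hκ ho _).2 (listSpan_elemBasis D hN hr hκ ho _).2

theorem listSpan_vertexBasis (c : ℕ × ℕ) (hc : ((c.1 + 1) * r, (c.2 + 1) * r) ∈ order) :
    listSpan (D.vertexBasis order c) ≤ S.kerSub hκ ∧
      D.kerFun ((c.1 + 1) * r, (c.2 + 1) * r) ∈ listSpan
    (D.elemBasis order c ++ D.elemBasis order (c.1 + 1, c.2) ++
      D.elemBasis order (c.1, c.2 + 1) ++ D.elemBasis order (c.1 + 1, c.2 + 1) ++
      D.vEdgeBasis order c ++ D.vEdgeBasis order (c.1, c.2 + 1) ++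
      D.hEdgeBasis order c ++ D.hEdgeBasis order (c.1 + 1, c.2)) ⊔
      listSpan (D.vertexBasis order c) := by
  have he := fun i => (listSpan_elemBasis D hN hr hκ ho i).2
  have hv := fun i => (listSpan_vEdgeBasis D hN hr hκ ho i).1
  have hh := fun i => (listSpan_hEdgeBasis D hN hr hκ ho i).1
  have h := listSpan_orthonormalizeAfter_kerFun D hN hr hκ ho
    (prev := D.elemBasis order c ++ D.elemBasis order (c.1 + 1, c.2) ++
      D.elemBasis order (c.1, c.2 + 1) ++ D.elemBasis order (c.1 + 1, c.2 + 1) ++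
      D.vEdgeBasis order c ++ D.vEdgeBasis order (c.1, c.2 + 1) ++
      D.hEdgeBasis order c ++ D.hEdgeBasis order (c.1 + 1, c.2))
    (l := [((c.1 + 1) * r, (c.2 + 1) * r)])
    (by simp only [listSpan_append, sup_le_iff, he, hv, hh, and_self])
    (by simpa using hc)
  exact ⟨h.1, h.2 _ (by simp)⟩

omit hN ho in
theorem line_or_interior {t : ℕ} (h0 : 0 < t) (ht : t < N * r) :
    (∃ k < N, k * r < t ∧ t < (k + 1) * r) ∨ ∃ k < N - 1, t = (k + 1) * r := by
  have h1 := Nat.div_add_mod t r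
  have h2 := Nat.mod_lt t hr
  have h3 : t / r < N := Nat.div_lt_of_lt_mul (by rwa [mul_comm])
  rw [mul_comm] at h1
  generalize t / r = d at h1 h3
  rcases Nat.eq_zero_or_pos (t % r) with h | h
  · right
    have h4 : d ≠ 0 := fun h' => by rw [h', h] at h1; omega
    refine ⟨d - 1, by omega, ?_⟩
    rw [Nat.sub_add_cancel (Nat.one_le_iff_ne_zero.2 h4)]
    omega
  · left
    refine ⟨d, h3, by omega, ?_⟩
    rw [add_mul]; omega

omit hN hr ho in
-- Quotient and remainder modulo r tell coarse mesh lines from open coarse intervals; this separates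
-- the four families of vertices.
theorem div_mod_of_interior {k t : ℕ} (h1 : k * r < t) (h2 : t < (k + 1) * r) :
    t / r = k ∧ t % r ≠ 0 := by
  have h3 : t / r = k := Nat.div_eq_of_lt_le h1.le h2
  refine ⟨h3, fun h => ?_⟩
  have := Nat.div_add_mod t r
  rw [h3, h, mul_comm] at this
  omega

omit hN ho in
theorem div_mod_of_line (k : ℕ) : (k + 1) * r / r = k + 1 ∧ (k + 1) * r % r = 0 :=
  ⟨Nat.mul_div_cancel _ hr, Nat.mul_mod_left _ _⟩

omit ho in
theorem vertex_interior {c : ℕ × ℕ} (h : c ∈ List.range (N - 1) ×ˢ List.range (N - 1)) :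
    IsInteriorNode (N * r) ((c.1 + 1) * r, (c.2 + 1) * r) := by
  rw [mem_range_product] at h
  exact ⟨Nat.mul_pos (Nat.succ_pos _) hr, Nat.mul_lt_mul_of_pos_right (by omega) hr,
    Nat.mul_pos (Nat.succ_pos _) hr, Nat.mul_lt_mul_of_pos_right (by omega) hr⟩

/-- Each interior vertex that is not dual is interior to a square, interior to an edge, or a coarse
vertex. Its g_p is recovered from the function made for it and those of the adjacent squares and
edges, all of which occur in the list. -/
theorem listSpan_kerBasis : listSpan (D.kerBasis order) = S.kerSub hκ := by
  have he := listSpan_elemBasis D hN hr hκ ho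
  have hv := listSpan_vEdgeBasis D hN hr hκ ho
  have hh := listSpan_hEdgeBasis D hN hr hκ ho
  have hx := fun c h => listSpan_vertexBasis D hN hr hκ ho c ((ho _).2 (vertex_interior hN hr h))
  apply le_antisymm
  · refine listSpan_le.2 fun v hv' => ?_
    simp only [DualNodes.kerBasis, List.mem_append, List.mem_flatMap] at hv'
    rcases hv' with ((⟨c, _, h⟩ | ⟨c, _, h⟩) | ⟨c, _, h⟩) | ⟨c, hc, h⟩
    · exact (he c).2 (mem_listSpan h)
    · exact (hv c).1 (mem_listSpan h)
    · exact (hh c).1 (mem_listSpan h)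
    · exact (hx c hc).1 (mem_listSpan h)
  · have be : ∀ c : ℕ × ℕ, c.1 < N → c.2 < N →
        listSpan (D.elemBasis order c) ≤ listSpan (D.kerBasis order) := fun c h1 h2 =>
      listSpan_mono fun v hv => by
        simp only [DualNodes.kerBasis, List.mem_append, List.mem_flatMap]
        exact Or.inl (Or.inl (Or.inl ⟨c, mem_range_product.2 ⟨h1, h2⟩, hv⟩))
    have bv : ∀ c : ℕ × ℕ, c.1 < N - 1 → c.2 < N →
        listSpan (D.vEdgeBasis order c) ≤ listSpan (D.kerBasis order) := fun c h1 h2 =>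
      listSpan_mono fun v hv => by
        simp only [DualNodes.kerBasis, List.mem_append, List.mem_flatMap]
        exact Or.inl (Or.inl (Or.inr ⟨c, mem_range_product.2 ⟨h1, h2⟩, hv⟩))
    have bh : ∀ c : ℕ × ℕ, c.1 < N → c.2 < N - 1 →
        listSpan (D.hEdgeBasis order c) ≤ listSpan (D.kerBasis order) := fun c h1 h2 =>
      listSpan_mono fun v hv => by
        simp only [DualNodes.kerBasis, List.mem_append, List.mem_flatMap]
        exact Or.inl (Or.inr ⟨c, mem_range_product.2 ⟨h1, h2⟩, hv⟩)
    have bx : ∀ c : ℕ × ℕ, c.1 < N - 1 → c.2 < N - 1 →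
        listSpan (D.vertexBasis order c) ≤ listSpan (D.kerBasis order) := fun c h1 h2 =>
      listSpan_mono fun v hv => by
        simp only [DualNodes.kerBasis, List.mem_append, List.mem_flatMap]
        exact Or.inr ⟨c, mem_range_product.2 ⟨h1, h2⟩, hv⟩
    rw [kerPi_eq_span D hN hr hκ, Submodule.span_le]
    rintro _ ⟨p, ⟨hp, hd⟩, rfl⟩
    obtain ⟨p1, p2, p3, p4⟩ := id hp
    have hpo := (ho p).2 hp
    rcases line_or_interior hr p1 p2 with ⟨k, hk, k1, k2⟩ | ⟨k, hk, k1⟩ <;>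
      rcases line_or_interior hr p3 p4 with ⟨m, hm, m1, m2⟩ | ⟨m, hm, m1⟩
    · apply be (k, m) hk hm
      rw [(he (k, m)).1]
      exact mem_listSpan (List.mem_map_of_mem
        ((mem_elemNodes D).2 ⟨hpo, ⟨k1, k2, m1, m2⟩, hd⟩))
    · refine sup_le (sup_le (be _ ?_ ?_) (be _ ?_ ?_)) (bh _ ?_ ?_)
        ((hh (k, m)).2 p (mem_hEdgeNodes.2 ⟨hpo, k1, k2, m1⟩)) <;> simp only <;> omega
    · refine sup_le (sup_le (be _ ?_ ?_) (be _ ?_ ?_)) (bv _ ?_ ?_)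
        ((hv (k, m)).2 p (mem_vEdgeNodes.2 ⟨hpo, k1, m1, m2⟩)) <;> simp only <;> omega
    · have h := (hx (k, m) (mem_range_product.2 ⟨hk, hm⟩)).2
      rw [show p = ((k + 1) * r, (m + 1) * r) from Prod.ext k1 m1]
      refine sup_le ?_ (bx (k, m) hk hm) h
      simp only [listSpan_append, sup_le_iff]
      refine ⟨⟨⟨⟨⟨⟨⟨be _ ?_ ?_, be _ ?_ ?_⟩, be _ ?_ ?_⟩, be _ ?_ ?_⟩, bv _ ?_ ?_⟩, bv _ ?_ ?_⟩,
        bh _ ?_ ?_⟩, bh _ ?_ ?_⟩ <;> simp only <;> omega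

omit hN hr ho in
/-- The vertices of the functions in `kerBasis`. -/
noncomputable def DualNodes.kerNodes (D : DualNodes S) (order : List (ℕ × ℕ)) : List (ℕ × ℕ) :=
  (List.range N ×ˢ List.range N).flatMap (D.elemNodes order) ++
    (List.range (N - 1) ×ˢ List.range N).flatMap (vEdgeNodes r order) ++
    (List.range N ×ˢ List.range (N - 1)).flatMap (hEdgeNodes r order) ++
    (List.range (N - 1) ×ˢ List.range (N - 1)).map fun c => ((c.1 + 1) * r, (c.2 + 1) * r)

omit hN hr ho in
theorem length_kerBasis : (D.kerBasis order).length = (D.kerNodes order).length := by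
  simp only [DualNodes.kerBasis, DualNodes.kerNodes, List.length_append, List.length_flatMap,
    elemBasis_eq, vEdgeBasis_eq, hEdgeBasis_eq, DualNodes.vertexBasis, length_mgs,
    length_orthonormalizeAfter, List.length_map, List.length_singleton]
  simp

theorem kerNodes_subset {p : ℕ × ℕ} (hp : p ∈ D.kerNodes order) :
    IsInteriorNode (N * r) p ∧ ¬ D.IsDual p := by
  -- Dual nodes lie off the coarse mesh lines, so no vertex on an edge or at a coarse vertex has to
  -- be excluded from the construction.
  have key : ∀ {q : ℕ × ℕ}, D.IsDual q → q.1 % r ≠ 0 ∧ q.2 % r ≠ 0 := by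
    rintro q ⟨i, hi, j, hj, rfl⟩
    obtain ⟨h1, h2, h3, h4⟩ := D.interior i hi j hj
    exact ⟨(div_mod_of_interior h1 h2).2, (div_mod_of_interior h3 h4).2⟩
  simp only [DualNodes.kerNodes, List.mem_append, List.mem_flatMap, List.mem_map] at hp
  rcases hp with ((⟨c, _, h⟩ | ⟨c, _, h⟩) | ⟨c, _, h⟩) | ⟨c, hc, rfl⟩
  · rw [mem_elemNodes] at h
    exact ⟨(ho p).1 h.1, h.2.2⟩
  · rw [mem_vEdgeNodes] at h
    exact ⟨(ho p).1 h.1, fun hd => (key hd).1 (h.2.1 ▸ (div_mod_of_line hr c.1).2)⟩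
  · rw [mem_hEdgeNodes] at h
    exact ⟨(ho p).1 h.1, fun hd => (key hd).2 (h.2.2.2 ▸ (div_mod_of_line hr c.2).2)⟩
  · exact ⟨vertex_interior hN hr hc, fun hd => (key hd).1 (div_mod_of_line hr c.1).2⟩

omit hN ho in
-- Quotients and remainders of the coordinates identify both the family of a vertex and its square,
-- edge or coarse vertex.
theorem nodup_kerNodes (hnd : order.Nodup) : (D.kerNodes order).Nodup := by
  have de : ∀ {c p : ℕ × ℕ}, p ∈ D.elemNodes order c →
      p.1 / r = c.1 ∧ p.1 % r ≠ 0 ∧ p.2 / r = c.2 ∧ p.2 % r ≠ 0 := by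
    intro c p h
    obtain ⟨-, ⟨h1, h2, h3, h4⟩, -⟩ := (mem_elemNodes D).1 h
    have a1 := div_mod_of_interior h1 h2
    have a2 := div_mod_of_interior h3 h4
    exact ⟨a1.1, a1.2, a2.1, a2.2⟩
  have dv : ∀ {c p : ℕ × ℕ}, p ∈ vEdgeNodes r order c →
      p.1 / r = c.1 + 1 ∧ p.1 % r = 0 ∧ p.2 / r = c.2 ∧ p.2 % r ≠ 0 := by
    intro c p h
    obtain ⟨-, h1, h3, h4⟩ := mem_vEdgeNodes.1 h
    have a1 := div_mod_of_line hr c.1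
    rw [← h1] at a1
    have a2 := div_mod_of_interior h3 h4
    exact ⟨a1.1, a1.2, a2.1, a2.2⟩
  have dh : ∀ {c p : ℕ × ℕ}, p ∈ hEdgeNodes r order c →
      p.1 / r = c.1 ∧ p.1 % r ≠ 0 ∧ p.2 / r = c.2 + 1 ∧ p.2 % r = 0 := by
    intro c p h
    obtain ⟨-, h3, h4, h1⟩ := mem_hEdgeNodes.1 h
    have a1 := div_mod_of_line hr c.2
    rw [← h1] at a1
    have a2 := div_mod_of_interior h3 h4
    exact ⟨a2.1, a2.2, a1.1, a1.2⟩
  have dx : ∀ c : ℕ × ℕ, (c.1 + 1) * r / r = c.1 + 1 ∧ (c.1 + 1) * r % r = 0 ∧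
      (c.2 + 1) * r / r = c.2 + 1 ∧ (c.2 + 1) * r % r = 0 := fun c =>
    ⟨(div_mod_of_line hr c.1).1, (div_mod_of_line hr c.1).2, (div_mod_of_line hr c.2).1,
      (div_mod_of_line hr c.2).2⟩
  have hprod : ∀ a b : ℕ, (List.range a ×ˢ List.range b).Nodup := fun a b =>
    (List.nodup_range (n := a)).product (List.nodup_range (n := b))
  have hflat : ∀ (l : List (ℕ × ℕ)) (f : ℕ × ℕ → List (ℕ × ℕ)), l.Nodup →
      (∀ c, (f c).Nodup) → (∀ c d p, p ∈ f c → p ∈ f d → c = d) → (l.flatMap f).Nodup := by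
    intro l f hl hf hd
    rw [List.nodup_flatMap]
    refine ⟨fun c _ => hf c, hl.imp ?_⟩
    intro c d hcd p hp hp'
    exact hcd (hd c d p hp hp')
  rw [DualNodes.kerNodes, List.nodup_append', List.nodup_append', List.nodup_append']
  refine ⟨⟨⟨?_, ?_, ?_⟩, ?_, ?_⟩, ?_, ?_⟩
  · refine hflat _ _ (hprod _ _) (fun c => hnd.filter _) fun c d p h h' => ?_
    have a := de h
    have b := de h'
    exact Prod.ext (a.1.symm.trans b.1) (a.2.2.1.symm.trans b.2.2.1)
  · refine hflat _ _ (hprod _ _) (fun c => hnd.filter _) fun c d p h h' => ?_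
    have a := dv h
    have b := dv h'
    exact Prod.ext (by omega) (by omega)
  · intro p hp hp'
    obtain ⟨c, -, h⟩ := List.mem_flatMap.1 hp
    obtain ⟨d, -, h'⟩ := List.mem_flatMap.1 hp'
    exact (de h).2.1 (dv h').2.1
  · refine hflat _ _ (hprod _ _) (fun c => hnd.filter _) fun c d p h h' => ?_
    have a := dh h
    have b := dh h'
    exact Prod.ext (by omega) (by omega)
  · intro p hp hp'
    obtain ⟨d, -, h'⟩ := List.mem_flatMap.1 hp'
    rcases List.mem_append.1 hp with hp | hp <;> obtain ⟨c, -, h⟩ := List.mem_flatMap.1 hp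
    · exact (de h).2.2.2 (dh h').2.2.2
    · exact (dv h).2.2.2 (dh h').2.2.2
  · refine (hprod _ _).map fun c d h => ?_
    have a := dx c
    have b := dx d
    simp only [Prod.mk.injEq] at h
    rw [h.1, h.2] at a
    exact Prod.ext (by omega) (by omega)
  · intro p hp hp'
    obtain ⟨d, -, rfl⟩ := List.mem_map.1 hp'
    have b := dx d
    simp only [List.mem_append] at hp
    rcases hp with (hp | hp) | hp <;> obtain ⟨c, -, h⟩ := List.mem_flatMap.1 hp
    · exact (de h).2.1 b.2.1
    · exact (dv h).2.2.2 b.2.2.2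
    · exact (dh h).2.1 b.2.1

include hκ in
-- A spanning list no longer than the dimension is independent. The dimension is the number of
-- interior vertices that are not dual, and the list has one entry for each of certain distinct such
-- vertices. No residual has to be shown nonzero separately.
theorem linearIndependent_kerBasis (hnd : order.Nodup) :
    LinearIndependent ℝ (D.kerBasis order).get := by
  classical
  have hn := Nat.mul_pos hN hr
  let T : Set (ℕ × ℕ) := {p | IsInteriorNode (N * r) p ∧ ¬ D.IsDual p}
  have hfin : T.Finite := (nodes (N * r)).finite_toSet.subset fun p hp => mem_nodes.2 hp.1
  have := hfin.fintype
  have h1 := finrank_span_eq_card (linearIndependent_kerFun D hN hr hκ)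
  rw [linearIndependent_iff_card_le_finrank_span, Fintype.card_fin, Set.finrank,
    Set.range_list_get]
  have h2 : Submodule.span ℝ {v | v ∈ D.kerBasis order} =
      Submodule.span ℝ (Set.range fun p : T => D.kerFun p) := by
    rw [show Submodule.span ℝ {v | v ∈ D.kerBasis order} = S.kerSub hκ from
      listSpan_kerBasis D hN hr hκ ho, kerPi_eq_span D hN hr hκ]
    congr 1
    ext v
    simp [T]
  rw [h2, h1, length_kerBasis, ← List.toFinset_card_of_nodup (nodup_kerNodes D hr hnd), ← Set.toFinset_card]
  refine Finset.card_le_card fun p hp => ?_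
  rw [Set.mem_toFinset]
  exact kerNodes_subset D hN hr ho (List.mem_toFinset.1 hp)

end Span

end SpectralLOD


/-! ### Energy estimates for the computed corrections and for the dual coefficients. -/

namespace SpectralLOD

/-! ### Positive bilinear forms -/

section BilinForm

variable {E : Type*} [AddCommGroup E] [Module ℝ E] (B : LinearMap.BilinForm ℝ E)
  (hs : ∀ v w, B v w = B w v) (h0 : ∀ v, 0 ≤ B v v)

include hs h0

theorem bilin_cauchy_schwarz (x y : E) : |B x y| ≤ √(B x x) * √(B y y) := by
  rw [← Real.sqrt_mul (h0 x)]
  apply Real.abs_le_sqrt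
  have h : ∀ t : ℝ, 0 ≤ B x x * (t * t) + 2 * B x y * t + B y y := fun t => by
    have := h0 (t • x + y)
    simp only [map_add, map_smul, LinearMap.add_apply, LinearMap.smul_apply, smul_eq_mul,
      hs y x] at this
    linarith
  have hd := discrim_le_zero h
  rw [discrim] at hd
  nlinarith

theorem bilin_sqrt_add_le (x y : E) : √(B (x + y) (x + y)) ≤ √(B x x) + √(B y y) := by
  rw [Real.sqrt_le_left (by positivity), add_sq, Real.sq_sqrt (h0 x), Real.sq_sqrt (h0 y)]
  have h := (le_abs_self _).trans (bilin_cauchy_schwarz B hs h0 x y)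
  simp only [map_add, LinearMap.add_apply, hs y x]
  linarith

/-- All entries |B(e_k, e_m)| are at most ε², and (Σ |d_k|)² ≤ card · Σ d_k². The cardinality
becomes the factor √L of the condition on k. -/
theorem bilin_sum_le {ι : Type*} (s : Finset ι) (d : ι → ℝ) (e : ι → E) {ε : ℝ}
    (he : ∀ k ∈ s, B (e k) (e k) ≤ ε ^ 2) :
    B (∑ k ∈ s, d k • e k) (∑ k ∈ s, d k • e k) ≤ ε ^ 2 * (s.card * ∑ k ∈ s, d k ^ 2) := by
  have h1 : ∀ k ∈ s, ∀ m ∈ s, |B (e k) (e m)| ≤ ε ^ 2 := by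
    intro k hk m hm
    refine (bilin_cauchy_schwarz B hs h0 _ _).trans ?_
    rw [← Real.sqrt_mul (h0 _), Real.sqrt_le_left (sq_nonneg _), sq (ε ^ 2)]
    exact mul_le_mul (he k hk) (he m hm) (h0 _) (sq_nonneg _)
  have h2 : B (∑ k ∈ s, d k • e k) (∑ k ∈ s, d k • e k) ≤
      ∑ k ∈ s, ∑ m ∈ s, |d k| * (|d m| * ε ^ 2) := by
    simp only [map_sum, LinearMap.sum_apply, map_smul, LinearMap.smul_apply, smul_eq_mul,
      Finset.mul_sum]
    refine Finset.sum_le_sum fun k hk => Finset.sum_le_sum fun m hm => ?_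
    refine (le_abs_self _).trans ?_
    rw [abs_mul, abs_mul]
    refine (mul_le_mul_of_nonneg_left (mul_le_mul_of_nonneg_left (h1 _ hm _ hk) (abs_nonneg _))
      (abs_nonneg _)).trans_eq ?_
    ring
  have h3 : ∑ k ∈ s, ∑ m ∈ s, |d k| * (|d m| * ε ^ 2) = ε ^ 2 * (∑ k ∈ s, |d k|) ^ 2 := by
    rw [sq (∑ k ∈ s, |d k|), Finset.sum_mul_sum, Finset.mul_sum]
    refine Finset.sum_congr rfl fun k _ => ?_
    rw [Finset.mul_sum]
    exact Finset.sum_congr rfl fun m _ => by ring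
  rw [h3] at h2
  refine h2.trans (mul_le_mul_of_nonneg_left ?_ (sq_nonneg _))
  have := sq_sum_le_card_mul_sum_sq (s := s) (f := fun k => |d k|)
  simpa only [sq_abs] using this

end BilinForm

theorem bilin_riesz {E : Type*} [AddCommGroup E] [Module ℝ E] [FiniteDimensional ℝ E]
    (B : LinearMap.BilinForm ℝ E) (hpos : ∀ v, v ≠ 0 → 0 < B v v) (f : E →ₗ[ℝ] ℝ) :
    ∃ z, ∀ w, B z w = f w := by
  have hnd : B.Nondegenerate := by
    refine ⟨fun v hv => ?_, fun v hv => ?_⟩ <;>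
    · by_contra h
      exact (hpos v h).ne' (hv v)
  exact ⟨(LinearMap.BilinForm.toDual B hnd).symm f, fun w =>
    LinearMap.BilinForm.apply_toDual_symm_apply (hB := hnd) f w⟩

/-- The projection is the Riesz representative of B(v, ·) for the form restricted to K. -/
theorem bilin_projection {E : Type*} [AddCommGroup E] [Module ℝ E] [FiniteDimensional ℝ E]
    (B : LinearMap.BilinForm ℝ E) (hpos : ∀ v, v ≠ 0 → 0 < B v v) (K : Submodule ℝ E) (v : E) :
    ∃ k ∈ K, ∀ w ∈ K, B (v - k) w = 0 := by
  obtain ⟨k, hk⟩ := bilin_riesz (B.restrict K)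
    (fun w hw => hpos w fun h => hw (Subtype.ext h)) (B v ∘ₗ K.subtype)
  refine ⟨k, k.2, fun w hw => ?_⟩
  have h : B k w = B v w := hk ⟨w, hw⟩
  rw [map_sub, LinearMap.sub_apply, h, sub_self]

theorem bilin_gram {E : Type*} [AddCommGroup E] [Module ℝ E] (B : LinearMap.BilinForm ℝ E)
    {l : ℕ} (χ : Fin l → E) (x y : Fin l → ℝ) :
    B (∑ s, x s • χ s) (∑ t, y t • χ t) =
      x ⬝ᵥ (Matrix.of fun s t => B (χ s) (χ t)).mulVec y := by
  simp only [map_sum, LinearMap.sum_apply, map_smul, LinearMap.smul_apply, smul_eq_mul,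
    dotProduct, Matrix.mulVec, Matrix.of_apply, Finset.mul_sum]
  rw [Finset.sum_comm]
  exact Finset.sum_congr rfl fun s _ => Finset.sum_congr rfl fun t _ => by ring

variable {n N r : ℕ} {κ : Fn} {β : ℝ} {i : ℕ × ℕ}

/-- The form `a` on `V_h`. -/
noncomputable abbrev aB (hn : 0 < n) (hκ : CoeffBounds κ β) : LinearMap.BilinForm ℝ (Vh n) :=
  energyB hn hκ le_rfl

theorem aB_apply (hn : 0 < n) (hκ : CoeffBounds κ β) (u v : Vh n) :
    aB hn hκ u v = aForm κ u v := rfl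

theorem aB_symm (hn : 0 < n) (hκ : CoeffBounds κ β) (u v : Vh n) :
    aB hn hκ u v = aB hn hκ v u := energyForm_comm _ _

theorem aB_nonneg (hn : 0 < n) (hκ : CoeffBounds κ β) (v : Vh n) : 0 ≤ aB hn hκ v v :=
  energyForm_self_nonneg hn hκ le_rfl v.2

theorem aB_pos (hn : 0 < n) (hκ : CoeffBounds κ β) (v : Vh n) (h : v ≠ 0) : 0 < aB hn hκ v v :=
  aForm_pos hn hκ v.2 fun h' => h (Subtype.ext h')

variable {S : SpectralData N r κ} (D : DualNodes S)

/-! ### The error of the approximate corrections -/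

/-- Here w is the exact a-projection of v onto the kernel and w' the computed one. The Gram matrix
turns vector errors into energy errors, and the initial error satisfies ‖w‖_a ≤ ‖v‖_a. The number ε
stands for 2 q^k; the implication about A and B transfers the condition on k to ε without requiring
q to be meaningful when the basis is empty. -/
theorem exists_corrector_bound (hN : 0 < N) (hr : 0 < r) (hκ : CoeffBounds κ β)
    {order : List (ℕ × ℕ)} (ho : ∀ p, p ∈ order ↔ IsInteriorNode (N * r) p) (hnd : order.Nodup)
    (k : ℕ) : ∃ ε : ℝ, 0 ≤ ε ∧ (∀ A B : ℝ, 0 ≤ B → 2 * D.q order ^ k * A ≤ B → ε * A ≤ B) ∧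
      ∀ v : Vh (N * r), ∃ w ∈ (S.kerSub hκ).comap (Vh (N * r)).subtype,
        (∀ z ∈ (S.kerSub hκ).comap (Vh (N * r)).subtype, aB (Nat.mul_pos hN hr) hκ (v - w) z = 0) ∧
        ∃ w' ∈ (S.kerSub hκ).comap (Vh (N * r)).subtype,
          (w' : Fn) = ∑ s, (cg (D.gram order)
            (fun t => aForm κ ((D.kerBasis order).get t) v) k).x s • (D.kerBasis order).get s ∧
          aB (Nat.mul_pos hN hr) hκ (w' - w) (w' - w) ≤
            ε ^ 2 * aB (Nat.mul_pos hN hr) hκ v v := by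
  have hn := Nat.mul_pos hN hr
  obtain ⟨l, hl⟩ : ∃ l, l = (D.kerBasis order).length := ⟨_, rfl⟩
  have hspan : Submodule.span ℝ (Set.range (D.kerBasis order).get) = S.kerSub hκ := by
    rw [← listSpan_kerBasis D hN hr hκ ho, listSpan, Set.range_list_get]
  have hli := linearIndependent_kerBasis D hN hr hκ ho hnd
  have hmem : ∀ s, (D.kerBasis order).get s ∈ S.kerSub hκ := fun s =>
    hspan ▸ Submodule.subset_span ⟨s, rfl⟩
  let χ : Fin (D.kerBasis order).length → Vh (N * r) := fun s =>
    ⟨(D.kerBasis order).get s, (hmem s).1⟩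
  have hχ : ∀ x : Fin (D.kerBasis order).length → ℝ,
      ((∑ s, x s • χ s : Vh (N * r)) : Fn) = ∑ s, x s • (D.kerBasis order).get s := fun x => by
    rw [Submodule.coe_sum]; rfl
  have hχK : ∀ x : Fin (D.kerBasis order).length → ℝ,
      ∑ s, x s • χ s ∈ (S.kerSub hκ).comap (Vh (N * r)).subtype := fun x =>
    sum_mem fun s _ => Submodule.smul_mem _ _ (hmem s)
  have hG : D.gram order = Matrix.of fun s t => aB hn hκ (χ s) (χ t) := rfl
  have hsymm : (D.gram order).IsSymm := by
    ext s t
    exact energyForm_comm _ _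
  have hherm : (D.gram order).IsHermitian := by
    rw [Matrix.IsHermitian, Matrix.conjTranspose_eq_transpose_of_trivial]
    exact hsymm
  have hpos : ∀ x, x ≠ 0 → 0 < x ⬝ᵥ (D.gram order).mulVec x := by
    intro x hx
    rw [hG, ← bilin_gram]
    refine aB_pos hn hκ _ fun h => hx ?_
    have h' := congrArg Subtype.val h
    rw [hχ] at h'
    funext s
    exact Fintype.linearIndependent_iff.1 hli x h' s
  have hpd : (D.gram order).PosDef := Matrix.PosDef.of_dotProduct_mulVec_pos hherm fun x hx => by
    simpa using hpos x hx
  have hdet : IsUnit (D.gram order).det := isUnit_iff_ne_zero.2 hpd.det_pos.ne'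
  have hq : D.q order = (√(condNumber (D.gram order)) - 1) / (√(condNumber (D.gram order)) + 1) :=
    rfl
  have main : ∀ v : Vh (N * r), ∃ x : Fin (D.kerBasis order).length → ℝ,
      (D.gram order).mulVec x = (fun t => aForm κ ((D.kerBasis order).get t) v) ∧
      (∀ z ∈ (S.kerSub hκ).comap (Vh (N * r)).subtype,
        aB hn hκ (v - ∑ s, x s • χ s) z = 0) ∧
      aB hn hκ (∑ s, x s • χ s) (∑ s, x s • χ s) ≤ aB hn hκ v v := by
    intro v
    refine ⟨(D.gram order)⁻¹.mulVec (fun t => aForm κ ((D.kerBasis order).get t) v), ?_, ?_⟩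
    · rw [Matrix.mulVec_mulVec, Matrix.mul_nonsing_inv _ hdet, Matrix.one_mulVec]
    set x := (D.gram order)⁻¹.mulVec (fun t => aForm κ ((D.kerBasis order).get t) v) with hx
    have hGx : (D.gram order).mulVec x = (fun t => aForm κ ((D.kerBasis order).get t) v) := by
      rw [hx, Matrix.mulVec_mulVec, Matrix.mul_nonsing_inv _ hdet, Matrix.one_mulVec]
    have horth : ∀ y : Fin (D.kerBasis order).length → ℝ,
        aB hn hκ (v - ∑ s, x s • χ s) (∑ s, y s • χ s) = 0 := by
      intro y
      rw [map_sub, LinearMap.sub_apply, sub_eq_zero, aB_symm hn hκ (∑ s, x s • χ s), bilin_gram,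
        ← hG, hGx, map_sum, dotProduct]
      refine Finset.sum_congr rfl fun s _ => ?_
      rw [map_smul, smul_eq_mul, aB_symm]
      rfl
    refine ⟨fun z hz => ?_, ?_⟩
    · have hz' : (z : Fn) ∈ Submodule.span ℝ (Set.range (D.kerBasis order).get) := hspan ▸ hz
      obtain ⟨y, hy⟩ := (Submodule.mem_span_range_iff_exists_fun ℝ).1 hz'
      rw [show z = ∑ s, y s • χ s from Subtype.ext (by rw [hχ, hy])]
      exact horth y
    · set w := ∑ s, x s • χ s
      have h1 : aB hn hκ (v - w) w = 0 := horth x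
      have h2 := aB_nonneg hn hκ (v - w)
      have h3 : aB hn hκ v v = aB hn hκ (v - w) (v - w) + 2 * aB hn hκ (v - w) w +
          aB hn hκ w w := by
        simp only [map_sub, LinearMap.sub_apply, aB_symm hn hκ w v]
        ring
      linarith
  have hdiff : ∀ x y : Fin (D.kerBasis order).length → ℝ,
      aB hn hκ (∑ s, y s • χ s - ∑ s, x s • χ s) (∑ s, y s • χ s - ∑ s, x s • χ s) =
        (x - y) ⬝ᵥ (D.gram order).mulVec (x - y) := by
    intro x y
    have : ∑ s, y s • χ s - ∑ s, x s • χ s = -∑ s, (x - y) s • χ s := by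
      rw [← Finset.sum_sub_distrib, ← Finset.sum_neg_distrib]
      exact Finset.sum_congr rfl fun s _ => by
        rw [Pi.sub_apply]; module
    rw [this, hG, ← bilin_gram]
    simp only [map_neg, LinearMap.neg_apply, neg_neg]
  rcases Nat.eq_zero_or_pos l with h0 | h0
  -- With an empty basis the spectrum is empty, `condNumber` is 0 / 0 = 0 and q = -1, so 2 q^k may
  -- be negative. The corrections are exact, and ε = 0 serves.
  · refine ⟨0, le_rfl, fun A B hB _ => by simpa using hB, fun v => ?_⟩
    obtain ⟨x, -, hx2, -⟩ := main v
    have hem : IsEmpty (Fin (D.kerBasis order).length) := by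
      rw [← hl, h0]; infer_instance
    refine ⟨_, hχK x, hx2, _, hχK _, hχ _, ?_⟩
    simp
  · rw [hl] at h0
    refine ⟨2 * D.q order ^ k, ?_, fun A B _ h => h, fun v => ?_⟩
    · have := (cg_error_le hherm hpos h0 (x := 0) (b := 0) (by simp) k).1
      rw [← hq] at this
      positivity
    · obtain ⟨x, hx1, hx2, hx3⟩ := main v
      refine ⟨_, hχK x, hx2, _, hχK _, hχ _, ?_⟩
      rw [hdiff]
      refine (cg_error_le hherm hpos h0 hx1 k).2.trans ?_
      rw [hG, ← bilin_gram]
      exact mul_le_mul_of_nonneg_left hx3 (sq_nonneg _)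

/-! ### Orthonormality of the dual hat functions -/

theorem aForm_dualHat_self (hN : 0 < N) (hr : 0 < r) (hκ : CoeffBounds κ β) (hi : i ∈ cells N)
    {j : ℕ} (hj : j < S.L i) : aForm κ (D.dualHat i j) (D.dualHat i j) = 1 := by
  have hn := Nat.mul_pos hN hr
  have hp := hat_mem_Vh hn (isInteriorNode_of_inInterior hi (D.interior i hi j hj))
  have hpos := aForm_pos hn hκ hp (hat_ne_zero hn _)
  rw [dualHat_eq_hatNormalized D hN hr hκ hi hj, hatNormalized]
  have h := aB_apply hn hκ
    ((√(aForm κ (hat (N * r) (D.node i j)) (hat (N * r) (D.node i j))))⁻¹ • ⟨_, hp⟩)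
    ((√(aForm κ (hat (N * r) (D.node i j)) (hat (N * r) (D.node i j))))⁻¹ • ⟨_, hp⟩)
  rw [map_smul, map_smul, LinearMap.smul_apply, aB_apply] at h
  refine h.symm.trans ?_
  simp only [smul_eq_mul]
  rw [← mul_assoc, ← mul_inv, Real.mul_self_sqrt hpos.le, inv_mul_cancel₀ hpos.ne']

/-- By separation at most one dual hat is nonzero on each fine square, so the gradients are never
active together. -/
theorem aForm_dualHat_ne (hN : 0 < N) (hr : 0 < r) (hi : i ∈ cells N)
    {j j' : ℕ} (hj : j < S.L i) (hj' : j' < S.L i) (hne : j ≠ j') :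
    aForm κ (D.dualHat i j) (D.dualHat i j') = 0 := by
  have hn := Nat.mul_pos hN hr
  rw [aForm, energyForm, ← integral_zero (ℝ × ℝ) ℝ (μ := volume.restrict Omega)]
  apply integral_congr_ae
  filter_upwards [ae_mem_offGrid (N * r)] with x hx
  obtain ⟨c, hc, hxc⟩ := exists_ocell_of_mem_offGrid hn hx
  have hzero : ∀ j, ¬ IsVertexOf (D.node i j) c → D.dualHat i j =ᶠ[nhds x] fun _ => 0 := by
    intro j hv
    filter_upwards [(isOpen_ocell (N * r) c).mem_nhds hxc] with z hz
    simp [DualNodes.dualHat, hatLocNormalized,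
      hat_eq_zero_on_cell hn hv z (ocell_subset_cell _ _ hz)]
  have h : ¬ IsVertexOf (D.node i j) c ∨ ¬ IsVertexOf (D.node i j') c := by
    by_contra! h
    exact hne (D.separated c hc i hi j hj i hi j' hj' h.1 h.2).2
  rcases h with h | h
  · rw [pd1_congr (hzero _ h), pd2_congr (hzero _ h), pd1_const, pd2_const]; simp
  · rw [pd1_congr (hzero _ h), pd2_congr (hzero _ h), pd1_const, pd2_const]; simp

/-- The coefficients of a combination of the dual functions with respect to the dual hats. -/
theorem sum_sq_dual_coeff_le (hN : 0 < N) (hr : 0 < r) (hκ : CoeffBounds κ β) (hi : i ∈ cells N)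
    (c : Fin (S.L i) → ℝ) :
    ∑ l : Fin (S.L i), (∑ j, c j * (S.dualMatrix D.node i)⁻¹ j l) ^ 2 ≤
      D.MLoc i * ∑ j, c j ^ 2 := by
  have hn := Nat.mul_pos hN hr
  let φ : Fin (S.L i) → Vh (N * r) := fun l => ⟨D.dualHat i l, dualHat_mem D hN hr hi l.2⟩
  let φt : Fin (S.L i) → Vh (N * r) := fun j => ⟨D.dualFun i j, dualFun_mem D hN hr hi j⟩
  have hφt : ∀ j, φt j = ∑ l, (S.dualMatrix D.node i)⁻¹ j l • φ l := fun j => by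
    apply Subtype.ext
    rw [Submodule.coe_sum]; rfl
  have hsum : ∑ j, c j • φt j = ∑ l, (∑ j, c j * (S.dualMatrix D.node i)⁻¹ j l) • φ l := by
    simp only [hφt, Finset.smul_sum, smul_smul, Finset.sum_smul]
    rw [Finset.sum_comm]
  have horth : (Matrix.of fun s t => aB hn hκ (φ s) (φ t)) = 1 := by
    ext s t
    rw [Matrix.of_apply, Matrix.one_apply]
    split_ifs with h
    · rw [h]; exact aForm_dualHat_self D hN hr hκ hi t.2
    · exact aForm_dualHat_ne D hN hr hi s.2 t.2 fun h' => h (Fin.ext h')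
  -- The sum of squares is the energy of Σ c_j φ̃_j, because the dual hats are a-orthonormal. The
  -- same energy is the quadratic form of the matrix defining M_i, bounded by its 2-norm.
  have h1 : aB hn hκ (∑ j, c j • φt j) (∑ j, c j • φt j) =
      ∑ l : Fin (S.L i), (∑ j, c j * (S.dualMatrix D.node i)⁻¹ j l) ^ 2 := by
    rw [hsum, bilin_gram, horth, Matrix.one_mulVec, dotProduct]
    exact Finset.sum_congr rfl fun l _ => by ring
  rw [← h1, bilin_gram]
  set A : Matrix (Fin (S.L i)) (Fin (S.L i)) ℝ := Matrix.of fun s t => aB hn hκ (φt s) (φt t)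
  have hM : (D.MLoc i : ℝ) = ‖Matrix.toEuclideanCLM (𝕜 := ℝ) (n := Fin (S.L i)) A‖ := rfl
  have h2 : c ⬝ᵥ A.mulVec c = inner ℝ
      (Matrix.toEuclideanCLM (𝕜 := ℝ) (n := Fin (S.L i)) A (WithLp.toLp 2 c)) (WithLp.toLp 2 c) := by
    rw [EuclideanSpace.inner_eq_star_dotProduct, star_trivial]
    rfl
  have h3 : ∑ j, c j ^ 2 = ‖WithLp.toLp 2 c‖ ^ 2 := by
    rw [EuclideanSpace.norm_sq_eq]
    simp
  rw [h2, hM, h3]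
  refine (real_inner_le_norm _ _).trans ?_
  rw [sq, ← mul_assoc]
  exact mul_le_mul_of_nonneg_right (ContinuousLinearMap.le_opNorm _ _) (norm_nonneg _)

end SpectralLOD


/-! ### Integral inequalities and the error of the ideal method. -/

namespace SpectralLOD

/-! ### Estimates in `L²` -/

theorem integral_mul_le_sqrt_mul_sqrt {α : Type*} [MeasurableSpace α] {μ : Measure α} {f g : α → ℝ}
    (hf : MemLp f 2 μ) (hg : MemLp g 2 μ) :
    ∫ x, f x * g x ∂μ ≤ √(∫ x, f x ^ 2 ∂μ) * √(∫ x, g x ^ 2 ∂μ) := by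
  have hff := hf.integrable_sq
  have hgg := hg.integrable_sq
  have hfg : Integrable (fun x => f x * g x) μ := hf.integrable_mul hg
  have h0 : 0 ≤ ∫ x, f x ^ 2 ∂μ := integral_nonneg fun x => sq_nonneg _
  rw [← Real.sqrt_mul h0]
  apply Real.le_sqrt_of_sq_le
  have h : ∀ t : ℝ, 0 ≤ (∫ x, f x ^ 2 ∂μ) * (t * t) + 2 * (∫ x, f x * g x ∂μ) * t +
      ∫ x, g x ^ 2 ∂μ := fun t => by
    have h1 : 0 ≤ ∫ x, (t * f x + g x) ^ 2 ∂μ := integral_nonneg fun x => sq_nonneg _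
    have h2 : (fun x => (t * f x + g x) ^ 2) =
        fun x => (t * t * f x ^ 2 + 2 * t * (f x * g x)) + g x ^ 2 := by
      funext x; ring
    have h3 : Integrable (fun x => t * t * f x ^ 2 + 2 * t * (f x * g x)) μ :=
      (hff.const_mul _).add (hfg.const_mul _)
    rw [h2, integral_add h3 hgg,
      integral_add (hff.const_mul _) (hfg.const_mul _), integral_const_mul,
      integral_const_mul] at h1
    linarith
  have hd := discrim_le_zero h
  rw [discrim] at hd
  nlinarith

variable {n N r : ℕ} {κ f : Fn} {β : ℝ}

theorem l2Norm_eq_sqrt_massForm (v : Fn) : l2Norm v = √(massForm Omega (fun _ => 1) v v) := by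
  rw [l2Norm, massForm_one_eq]

theorem l2NormW_eq_sqrt_massForm (v : Fn) : l2NormW κ v = √(massForm Omega κ v v) := by
  unfold l2NormW massForm
  congr 2
  funext x
  ring

theorem memLp_two_of_continuous {v : Fn} (hv : Continuous v) :
    MemLp v 2 (volume.restrict Omega) :=
  (memLp_top_of_continuous hv).mono_exponent le_top

theorem integral_mul_le_l2Norm (hf : MemLp f 2 (volume.restrict Omega)) {v : Fn}
    (hv : Continuous v) : ∫ x in Omega, f x * v x ≤ l2Norm f * l2Norm v :=
  integral_mul_le_sqrt_mul_sqrt hf (memLp_two_of_continuous hv)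

theorem aemeasurable_rpow_coeff (hκ : CoeffBounds κ β) (s : ℝ) :
    AEMeasurable (fun x => κ x ^ s) (volume.restrict Omega) :=
  hκ.aemeasurable.pow_const s

theorem memLp_weighted (hκ : CoeffBounds κ β) (hf : MemLp f 2 (volume.restrict Omega)) :
    MemLp (fun x => κ x ^ (-(1 / 2) : ℝ) * f x) 2 (volume.restrict Omega) := by
  refine hf.mono ((aemeasurable_rpow_coeff hκ _).aestronglyMeasurable.mul hf.1) ?_
  filter_upwards [hκ.bounds] with x hx
  rw [norm_mul]
  refine mul_le_of_le_one_left (norm_nonneg _) ?_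
  rw [Real.norm_eq_abs, abs_of_nonneg (Real.rpow_nonneg (by linarith) _)]
  exact Real.rpow_le_one_of_one_le_of_nonpos hx.1 (by norm_num)

theorem l2Norm_weighted_le (hκ : CoeffBounds κ β) (hf : MemLp f 2 (volume.restrict Omega)) :
    l2Norm (fun x => κ x ^ (-(1 / 2) : ℝ) * f x) ≤ l2Norm f := by
  apply Real.sqrt_le_sqrt
  apply integral_mono_ae (memLp_weighted hκ hf).integrable_sq hf.integrable_sq
  filter_upwards [hκ.bounds] with x hx
  rw [mul_pow]
  refine mul_le_of_le_one_left (sq_nonneg _) (pow_le_one₀ (Real.rpow_nonneg (by linarith) _) ?_)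
  exact Real.rpow_le_one_of_one_le_of_nonpos hx.1 (by norm_num)

/-- Cauchy-Schwarz after the splitting f v = (κ^{-1/2} f)(κ^{1/2} v); it keeps β out of the ideal
estimate. -/
theorem integral_mul_le_l2NormW (hκ : CoeffBounds κ β) (hf : MemLp f 2 (volume.restrict Omega))
    {v : Fn} (hv : Continuous v) :
    ∫ x in Omega, f x * v x ≤
      l2Norm (fun x => κ x ^ (-(1 / 2) : ℝ) * f x) * l2NormW κ v := by
  have hv2 := memLp_two_of_continuous hv
  have hint : Integrable (fun x => κ x * v x ^ 2) (volume.restrict Omega) := by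
    refine (integrable_mass hκ le_rfl hv hv).congr (Filter.Eventually.of_forall fun x => ?_)
    dsimp only; ring
  have hsq : ∀ᵐ x ∂volume.restrict Omega, (κ x ^ (1 / 2 : ℝ) * v x) ^ 2 = κ x * v x ^ 2 := by
    filter_upwards [hκ.bounds] with x hx
    rw [mul_pow, ← Real.sqrt_eq_rpow, Real.sq_sqrt (by linarith)]
  have hmem : MemLp (fun x => κ x ^ (1 / 2 : ℝ) * v x) 2 (volume.restrict Omega) := by
    refine (memLp_two_iff_integrable_sq
      ((aemeasurable_rpow_coeff hκ _).aestronglyMeasurable.mul hv2.1)).2 ?_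
    exact hint.congr (hsq.mono fun x hx => hx.symm)
  have h := integral_mul_le_sqrt_mul_sqrt (memLp_weighted hκ hf) hmem
  rw [integral_congr_ae hsq] at h
  refine (integral_congr_ae ?_).trans_le h
  filter_upwards [hκ.bounds] with x hx
  have h0 : 0 < κ x := by linarith
  have : κ x ^ (-(1 / 2) : ℝ) * κ x ^ (1 / 2 : ℝ) = 1 := by
    rw [← Real.rpow_add h0]; norm_num
  linear_combination (-(f x * v x)) * this

/-- The functional `v ↦ ∫_Ω f v` on `V_h`. -/
noncomputable def loadFunctional (n : ℕ) (hf : MemLp f 2 (volume.restrict Omega)) :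
    Vh n →ₗ[ℝ] ℝ where
  toFun v := ∫ x in Omega, f x * (v : Fn) x
  map_add' u v := by
    refine (integral_congr_ae (Filter.Eventually.of_forall fun x => mul_add _ _ _)).trans ?_
    exact integral_add (hf.integrable_mul (memLp_two_of_continuous u.2.1))
      (hf.integrable_mul (memLp_two_of_continuous v.2.1))
  map_smul' t v := by
    rw [RingHom.id_apply, smul_eq_mul, ← integral_const_mul]
    congr 1; funext x
    simp [mul_left_comm]

/-- Cancels one factor of a norm without separating the case in which the norm is zero. -/
theorem le_of_sq_le_mul {x c : ℝ} (hc : 0 ≤ c) (h : x ^ 2 ≤ c * x) : x ≤ c := by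
  by_contra! hx
  nlinarith

theorem aForm_self_nonneg (hn : 0 < n) (hκ : CoeffBounds κ β) {v : Fn} (hv : v ∈ Vh n) :
    0 ≤ aForm κ v v :=
  energyForm_self_nonneg hn hκ le_rfl hv

/-! ### The ideal method -/

variable {S : SpectralData N r κ}

theorem sqrt_massForm_le_of_mem_kerPi (hN : 0 < N) (hr : 0 < r) (hκ : CoeffBounds κ β) {e : Fn}
    (he : e ∈ S.kerPi) : l2NormW κ e ≤ Cstar * meshSize N * √(aForm κ e e) := by
  have hC : 0 ≤ Cstar * meshSize N := (mul_pos Cstar_pos (meshSize_pos hN)).le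
  rw [l2NormW_eq_sqrt_massForm, Real.sqrt_le_left (by positivity), mul_pow,
    Real.sq_sqrt (aForm_self_nonneg (Nat.mul_pos hN hr) hκ he.1)]
  exact massForm_le_of_mem_kerPi S hN hr hκ he

/-- The energy norm of the part in the kernel of the projection. -/
theorem energyNorm_le_of_mem_kerPi (hN : 0 < N) (hr : 0 < r) (hκ : CoeffBounds κ β)
    (hf : MemLp f 2 (volume.restrict Omega)) {e : Fn} (he : e ∈ S.kerPi)
    (h : aForm κ e e = ∫ x in Omega, f x * e x) :
    √(aForm κ e e) ≤
      Cstar * meshSize N * l2Norm (fun x => κ x ^ (-(1 / 2) : ℝ) * f x) := by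
  have hC : 0 ≤ Cstar * meshSize N := (mul_pos Cstar_pos (meshSize_pos hN)).le
  have hF : 0 ≤ l2Norm (fun x => κ x ^ (-(1 / 2) : ℝ) * f x) := Real.sqrt_nonneg _
  apply le_of_sq_le_mul (mul_nonneg hC hF)
  rw [Real.sq_sqrt (aForm_self_nonneg (Nat.mul_pos hN hr) hκ he.1)]
  refine (h.trans_le (integral_mul_le_l2NormW hκ hf he.1.1)).trans ?_
  refine (mul_le_mul_of_nonneg_left (sqrt_massForm_le_of_mem_kerPi hN hr hκ he) hF).trans_eq ?_
  ring

theorem exists_decomposition (hN : 0 < N) (hr : 0 < r) (hκ : CoeffBounds κ β) {z : Fn}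
    (hz : z ∈ Vh (N * r)) : ∃ e ∈ S.kerPi, z - e ∈ S.idealSpace := by
  have hn := Nat.mul_pos hN hr
  have := finiteDimensional_Vh hn
  obtain ⟨e, he, h⟩ := bilin_projection (aB hn hκ) (aB_pos hn hκ)
    ((S.kerSub hκ).comap (Vh (N * r)).subtype) ⟨z, hz⟩
  exact ⟨e, he, sub_mem hz e.2, fun w hw => h ⟨w, hw.1⟩ hw⟩

/-- Let e be the kernel component of u_h. Then d = (u_h - e) - u lies in the ideal space, Galerkin
orthogonality gives a(u_h - u, d) = 0, and a(e, d) = 0 as well; hence a(d, d) = 0 and u_h - u = e.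
-/
theorem sub_mem_kerPi_of_isGalerkin (hN : 0 < N) (hr : 0 < r) (hκ : CoeffBounds κ β) {uh u : Fn}
    (huh : IsGalerkin κ f (Vh (N * r) : Set Fn) uh) (hu : IsGalerkin κ f S.idealSpace u) :
    uh - u ∈ S.kerPi := by
  have hn := Nat.mul_pos hN hr
  obtain ⟨e, he, hw⟩ := exists_decomposition (S := S) hN hr hκ huh.1
  let U : Vh (N * r) := ⟨uh, huh.1⟩
  let E : Vh (N * r) := ⟨e, he.1⟩
  let V : Vh (N * r) := ⟨u, hu.1.1⟩
  have hd : (((U - E) - V : Vh (N * r)) : Fn) ∈ S.idealSpace := by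
    refine ⟨sub_mem hw.1 hu.1.1, fun z hz => ?_⟩
    have h1 : aB hn hκ (U - E) ⟨z, hz.1⟩ = 0 := hw.2 z hz
    have h2 : aB hn hκ V ⟨z, hz.1⟩ = 0 := hu.1.2 z hz
    have h3 : aB hn hκ ((U - E) - V) ⟨z, hz.1⟩ = 0 := by
      rw [map_sub, LinearMap.sub_apply, h1, h2, sub_zero]
    exact h3
  have h1 : aB hn hκ U ((U - E) - V) = aB hn hκ V ((U - E) - V) :=
    (huh.2 _ hd.1).trans (hu.2 _ hd).symm
  have h2 : aB hn hκ E ((U - E) - V) = 0 := by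
    rw [aB_symm]
    exact hd.2 e he
  have h3 : aB hn hκ ((U - E) - V) ((U - E) - V) = 0 := by
    have : aB hn hκ ((U - E) - V) ((U - E) - V) =
        aB hn hκ U ((U - E) - V) - aB hn hκ E ((U - E) - V) - aB hn hκ V ((U - E) - V) := by
      rw [map_sub (aB hn hκ) (U - E) V, LinearMap.sub_apply, map_sub (aB hn hκ) U E,
        LinearMap.sub_apply]
    rw [this, h1, h2]; ring
  have h4 : (U - E) - V = 0 := by
    by_contra h
    exact (aB_pos hn hκ _ h).ne' h3
  have h5 : uh - u = e := by
    have := congrArg Subtype.val h4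
    have h6 : uh - e - u = 0 := this
    rw [sub_right_comm] at h6
    exact sub_eq_zero.1 h6
  rw [h5]
  exact he

/-- The kernel inequality is used twice on the error e: once for ‖e‖_a, from a(e,e) = ∫ f e, and
once to pass from ‖e‖_a to the weighted L² norm. -/
theorem l2NormW_ideal_error_le (hN : 0 < N) (hr : 0 < r) (hκ : CoeffBounds κ β)
    (hf : MemLp f 2 (volume.restrict Omega)) {uh u : Fn}
    (huh : IsGalerkin κ f (Vh (N * r) : Set Fn) uh) (hu : IsGalerkin κ f S.idealSpace u) :
    l2NormW κ (uh - u) ≤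
      (Cstar * meshSize N) ^ 2 * l2Norm (fun x => κ x ^ (-(1 / 2) : ℝ) * f x) := by
  have hn := Nat.mul_pos hN hr
  have he := sub_mem_kerPi_of_isGalerkin hN hr hκ huh hu
  have hC : 0 ≤ Cstar * meshSize N := (mul_pos Cstar_pos (meshSize_pos hN)).le
  have ha : aForm κ (uh - u) (uh - u) = ∫ x in Omega, f x * (uh - u) x := by
    have h1 : aB hn hκ (⟨uh, huh.1⟩ - ⟨u, hu.1.1⟩) ⟨uh - u, he.1⟩ =
        aForm κ uh (uh - u) - aForm κ u (uh - u) := by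
      rw [map_sub, LinearMap.sub_apply, aB_apply, aB_apply]
    rw [huh.2 _ he.1, hu.1.2 _ he, sub_zero] at h1
    exact h1
  refine (sqrt_massForm_le_of_mem_kerPi hN hr hκ he).trans ?_
  rw [sq, mul_assoc (Cstar * meshSize N)]
  exact mul_le_mul_of_nonneg_left (energyNorm_le_of_mem_kerPi hN hr hκ hf he ha) hC

theorem l2Norm_le_l2NormW (hκ : CoeffBounds κ β) {v : Fn} (hv : Continuous v) :
    l2Norm v ≤ l2NormW κ v := by
  rw [l2Norm_eq_sqrt_massForm, l2NormW_eq_sqrt_massForm]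
  exact Real.sqrt_le_sqrt (massForm_one_le hκ le_rfl hv)

end SpectralLOD


/-! ### The localized method: approximation in energy, then duality. -/

namespace SpectralLOD

/-! ### The localized method -/

variable {N r : ℕ} {κ f : Fn} {β : ℝ} {S : SpectralData N r κ} (D : DualNodes S)

theorem sum_sLoc_self_le (hN : 0 < N) (hr : 0 < r) (hκ : CoeffBounds κ β) {v : Fn}
    (hv : v ∈ Vh (N * r)) :
    ∑ i ∈ cells N, sLoc N κ i v v ≤ (meshSize N ^ 2)⁻¹ * (β * aForm κ v v) := by
  have h : ∑ i ∈ cells N, sLoc N κ i v v = (meshSize N ^ 2)⁻¹ * massForm Omega κ v v := by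
    rw [massForm_Omega_eq_sum hN hκ hv.1 hv.1, Finset.mul_sum]
    rfl
  rw [h]
  have hβ := hκ.one_le
  refine mul_le_mul_of_nonneg_left ((massForm_le hκ le_rfl hv.1).trans ?_) (by positivity)
  exact mul_le_mul_of_nonneg_left (massForm_one_le_energy (Nat.mul_pos hN hr) hκ hv) (by linarith)

/-- Once w is written in terms of exactly corrected dual hats, the same coefficients with the
computed corrections give v. The error is a combination of at most L correction errors, with
coefficients controlled by M and β. -/
theorem exists_msSpace_approx (hN : 0 < N) (hr : 0 < r) (hκ : CoeffBounds κ β)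
    {order : List (ℕ × ℕ)} (ho : ∀ p, p ∈ order ↔ IsInteriorNode (N * r) p) (hnd : order.Nodup)
    {k : ℕ}
    (hk : 2 * D.q order ^ k * √(S.totalL : ℝ) * √(D.M : ℝ) * √β ≤ meshSize N ^ 2)
    {w : Fn} (hw : w ∈ S.idealSpace) :
    ∃ v ∈ D.msSpace order k, v ∈ Vh (N * r) ∧
      √(aForm κ (w - v) (w - v)) ≤ meshSize N * √(aForm κ w w) := by
  have hn := Nat.mul_pos hN hr
  have hH := meshSize_pos hN
  have hβ := hκ.one_le
  obtain ⟨ε, hε0, hε, hcorr⟩ := exists_corrector_bound D hN hr hκ ho hnd k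
  let ι := Σ i : {i // i ∈ cells N}, Fin (S.L i)
  let φ : ι → Vh (N * r) := fun x => ⟨D.dualHat x.1 x.2, dualHat_mem D hN hr x.1.2 x.2.2⟩
  choose vs hvsK hvs vk hvkK hvk hvkle using fun x : ι => hcorr (φ x)
  let d : ι → ℝ := fun x => ∑ j : Fin (S.L x.1),
    sLoc N κ x.1 w (S.psi x.1 j) * (S.dualMatrix D.node x.1)⁻¹ j x.2
  let W : Vh (N * r) := ⟨w, hw.1⟩
  have hI : D.dualInterp w = ((∑ x, d x • φ x : Vh (N * r)) : Fn) := by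
    rw [Submodule.coe_sum, Fintype.sum_sigma]
    refine Eq.trans ?_ (Finset.sum_coe_sort (cells N) (fun i => ∑ y : Fin (S.L i),
      (∑ j : Fin (S.L i), sLoc N κ i w (S.psi i j) * (S.dualMatrix D.node i)⁻¹ j y) •
        D.dualHat i y)).symm
    unfold DualNodes.dualInterp DualNodes.dualFun
    refine Finset.sum_congr rfl fun i _ => ?_
    simp only [Finset.smul_sum, smul_smul, Finset.sum_smul]
    rw [Finset.sum_comm]
  have hd : ∑ x, d x ^ 2 ≤ D.M * ((meshSize N ^ 2)⁻¹ * (β * aForm κ w w)) := by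
    rw [Fintype.sum_sigma]
    rw [Finset.sum_coe_sort (cells N) (fun i => ∑ y : Fin (S.L i),
      (∑ j : Fin (S.L i), sLoc N κ i w (S.psi i j) * (S.dualMatrix D.node i)⁻¹ j y) ^ 2)]
    refine le_trans ?_ (mul_le_mul_of_nonneg_left (sum_sLoc_self_le hN hr hκ hw.1) D.M.2)
    rw [Finset.mul_sum]
    refine Finset.sum_le_sum fun i hi => ?_
    refine (sum_sq_dual_coeff_le D hN hr hκ hi _).trans ?_
    have h1 : (D.MLoc i : ℝ) ≤ D.M := by exact_mod_cast Finset.le_sup (f := D.MLoc) hi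
    have h2 := sum_sq_sLoc_le S hn hκ hi hw.1
    rw [Finset.sum_range] at h2
    exact mul_le_mul h1 h2 (Finset.sum_nonneg fun _ _ => sq_nonneg _) D.M.2
  -- Both sides are a-orthogonal to the kernel, and their difference lies in it, because w minus its
  -- dual interpolant and all exact corrections do. Hence the difference vanishes.
  have hdiff : W = ∑ x, d x • (φ x - vs x) := by
    have h1 : W - ∑ x, d x • (φ x - vs x) ∈ (S.kerSub hκ).comap (Vh (N * r)).subtype := by
      have h2 : W - ∑ x, d x • φ x ∈ (S.kerSub hκ).comap (Vh (N * r)).subtype := by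
        have h3 := sub_dualInterp_mem_kerPi D hN hr hκ hw.1
        rw [hI] at h3
        exact h3
      have h4 : W - ∑ x, d x • (φ x - vs x) = (W - ∑ x, d x • φ x) + ∑ x, d x • vs x := by
        simp only [smul_sub, Finset.sum_sub_distrib]
        abel
      rw [h4]
      exact add_mem h2 (sum_mem fun x _ => Submodule.smul_mem _ _ (hvsK x))
    by_contra hne
    refine (aB_pos hn hκ _ (sub_ne_zero.2 hne)).ne' ?_
    set z := W - ∑ x, d x • (φ x - vs x) with hz
    have h5 : aB hn hκ W z = 0 := hw.2 z h1
    have h6 : aB hn hκ z z = aB hn hκ W z - ∑ x, d x * aB hn hκ (φ x - vs x) z := by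
      conv_lhs => rw [hz, LinearMap.map_sub₂, ← hz]
      simp only [map_sum, map_smul, LinearMap.sum_apply, LinearMap.smul_apply, smul_eq_mul]
    rw [h6, h5, zero_sub, neg_eq_zero]
    exact Finset.sum_eq_zero fun x _ => by rw [hvs x z h1, mul_zero]
  refine ⟨(∑ x, d x • (φ x - vk x) : Vh (N * r)), ?_, (∑ x, d x • (φ x - vk x)).2, ?_⟩
  · rw [Submodule.coe_sum]
    refine sum_mem fun x _ => Submodule.smul_mem _ _ (Submodule.subset_span ?_)
    refine ⟨x.1, x.1.2, x.2, x.2.2, ?_⟩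
    rw [Submodule.coe_sub, hvk x]
    rfl
  · have h1 : W - ∑ x, d x • (φ x - vk x) = ∑ x, d x • (vk x - vs x) := by
      rw [hdiff, ← Finset.sum_sub_distrib]
      exact Finset.sum_congr rfl fun x _ => by module
    have h2 : aForm κ (w - (∑ x, d x • (φ x - vk x) : Vh (N * r)))
        (w - (∑ x, d x • (φ x - vk x) : Vh (N * r))) =
        aB hn hκ (∑ x, d x • (vk x - vs x)) (∑ x, d x • (vk x - vs x)) := by
      rw [← h1]; rfl
    have h3 := bilin_sum_le (aB hn hκ) (aB_symm hn hκ) (aB_nonneg hn hκ) Finset.univ d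
      (fun x => vk x - vs x) (ε := ε) fun x _ => by
        refine (hvkle x).trans_eq ?_
        rw [aB_apply, aForm_dualHat_self D hN hr hκ x.1.2 x.2.2, mul_one]
    have hcard : (Finset.univ : Finset ι).card = S.totalL := by
      rw [Finset.card_univ, Fintype.card_sigma]
      simp only [Fintype.card_fin]
      exact Finset.sum_coe_sort (cells N) (fun i => S.L i)
    have hA : ε * (√(S.totalL : ℝ) * √(D.M : ℝ) * √β) ≤ meshSize N ^ 2 :=
      hε _ _ (by positivity) (by simpa only [mul_assoc] using hk)
    have hA2 : ε ^ 2 * (S.totalL * D.M * β) ≤ (meshSize N ^ 2) ^ 2 := by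
      have h4 := pow_le_pow_left₀ (by positivity) hA 2
      rwa [mul_pow, mul_pow, mul_pow, Real.sq_sqrt (Nat.cast_nonneg _), Real.sq_sqrt D.M.coe_nonneg,
        Real.sq_sqrt (by linarith)] at h4
    have ha := aForm_self_nonneg hn hκ hw.1
    rw [Real.sqrt_le_left (by positivity), mul_pow, Real.sq_sqrt ha, h2]
    refine h3.trans ?_
    rw [hcard]
    have h5 : ε ^ 2 * (S.totalL * ∑ x, d x ^ 2) ≤
        ε ^ 2 * (S.totalL * (D.M * ((meshSize N ^ 2)⁻¹ * (β * aForm κ w w)))) := by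
      gcongr
    refine h5.trans ?_
    -- The condition on k bounds the first group by H⁴; one factor H² cancels H⁻², leaving H²
    -- ‖w‖_a².
    have h6 : ε ^ 2 * (S.totalL * (D.M * ((meshSize N ^ 2)⁻¹ * (β * aForm κ w w)))) =
        (ε ^ 2 * (S.totalL * D.M * β)) * ((meshSize N ^ 2)⁻¹ * aForm κ w w) := by ring
    rw [h6]
    refine (mul_le_mul_of_nonneg_right hA2 (by positivity)).trans_eq ?_
    field_simp

theorem msSpace_le_Vh (hN : 0 < N) (hr : 0 < r) (hκ : CoeffBounds κ β)
    {order : List (ℕ × ℕ)} (ho : ∀ p, p ∈ order ↔ IsInteriorNode (N * r) p) (k : ℕ) :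
    D.msSpace order k ≤ Vh (N * r) := by
  refine Submodule.span_le.2 ?_
  rintro _ ⟨i, hi, j, hj, rfl⟩
  refine sub_mem (dualHat_mem D hN hr hi hj) (sum_mem fun s _ => (Vh _).smul_mem _ ?_)
  refine kerSub_le_Vh S hκ ?_
  rw [← listSpan_kerBasis D hN hr hκ ho]
  exact mem_listSpan (List.get_mem _ _)

/-- Approximation of the solutions of the finite element problem in the energy norm. -/
theorem exists_msSpace_energy_approx (hN : 0 < N) (hr : 0 < r) (hκ : CoeffBounds κ β)
    {order : List (ℕ × ℕ)} (ho : ∀ p, p ∈ order ↔ IsInteriorNode (N * r) p) (hnd : order.Nodup)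
    {k : ℕ}
    (hk : 2 * D.q order ^ k * √(S.totalL : ℝ) * √(D.M : ℝ) * √β ≤ meshSize N ^ 2)
    (hf : MemLp f 2 (volume.restrict Omega)) {z : Fn}
    (hz : IsGalerkin κ f (Vh (N * r) : Set Fn) z) :
    ∃ v ∈ D.msSpace order k, v ∈ Vh (N * r) ∧
      √(aForm κ (z - v) (z - v)) ≤ (Cstar + 1) * meshSize N * l2Norm f := by
  have hn := Nat.mul_pos hN hr
  have hH := meshSize_pos hN
  have hC := Cstar_pos
  have hF : 0 ≤ l2Norm f := Real.sqrt_nonneg _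
  obtain ⟨e, he, hw⟩ := exists_decomposition (S := S) hN hr hκ hz.1
  obtain ⟨v, hv, hvV, hvle⟩ := exists_msSpace_approx D hN hr hκ ho hnd hk hw
  refine ⟨v, hv, hvV, ?_⟩
  let Z : Vh (N * r) := ⟨z, hz.1⟩
  let E : Vh (N * r) := ⟨e, he.1⟩
  let V : Vh (N * r) := ⟨v, hvV⟩
  have hWE : aB hn hκ (Z - E) E = 0 := hw.2 e he
  have hEE : aForm κ e e = ∫ x in Omega, f x * e x := by
    rw [← hz.2 e he.1]
    rw [map_sub, LinearMap.sub_apply, sub_eq_zero] at hWE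
    exact hWE.symm
  have h1 : √(aForm κ e e) ≤ Cstar * meshSize N * l2Norm f :=
    (energyNorm_le_of_mem_kerPi hN hr hκ hf he hEE).trans
      (mul_le_mul_of_nonneg_left (l2Norm_weighted_le hκ hf) (by positivity))
  -- The ideal component is only bounded by the load through Friedrichs' inequality; the factor H
  -- comes from its approximation by the localized space.
  have h2 : √(aForm κ (z - e) (z - e)) ≤ l2Norm f := by
    apply le_of_sq_le_mul hF
    rw [Real.sq_sqrt (aForm_self_nonneg hn hκ hw.1)]
    have h3 : aForm κ (z - e) (z - e) = ∫ x in Omega, f x * (z - e) x := by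
      rw [← hz.2 _ hw.1]
      have h4 : aB hn hκ (Z - E) (Z - E) = aB hn hκ Z (Z - E) := by
        rw [map_sub (aB hn hκ) Z E, LinearMap.sub_apply, aB_symm hn hκ E (Z - E), hWE, sub_zero]
      exact h4
    refine (h3.trans_le (integral_mul_le_l2Norm hf hw.1.1)).trans ?_
    refine mul_le_mul_of_nonneg_left ?_ hF
    rw [l2Norm_eq_sqrt_massForm]
    exact Real.sqrt_le_sqrt (massForm_one_le_energy hn hκ hw.1)
  have h3 := bilin_sqrt_add_le (aB hn hκ) (aB_symm hn hκ) (aB_nonneg hn hκ) E ((Z - E) - V)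
  rw [show E + ((Z - E) - V) = Z - V by abel] at h3
  have h4 : √(aForm κ (z - v) (z - v)) ≤
      √(aForm κ e e) + √(aForm κ (z - e - v) (z - e - v)) := h3
  have h5 := mul_le_mul_of_nonneg_left h2 hH.le
  linarith

/-- Aubin-Nitsche in V_h: the dual solution Z has load u_h - u, so ‖u_h - u‖² = a(Z - W, u_h - u)
for every W in the localized space. Both energy factors obey the same approximation bound, which
squares (C_* + 1)H without any elliptic regularity. -/
theorem l2Norm_localized_error_le (hN : 0 < N) (hr : 0 < r) (hκ : CoeffBounds κ β)
    {order : List (ℕ × ℕ)} (ho : ∀ p, p ∈ order ↔ IsInteriorNode (N * r) p) (hnd : order.Nodup)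
    {k : ℕ}
    (hk : 2 * D.q order ^ k * √(S.totalL : ℝ) * √(D.M : ℝ) * √β ≤ meshSize N ^ 2)
    (hf : MemLp f 2 (volume.restrict Omega)) {uh u : Fn}
    (huh : IsGalerkin κ f (Vh (N * r) : Set Fn) uh)
    (hu : IsGalerkin κ f (D.msSpace order k : Set Fn) u) :
    l2Norm (uh - u) ≤ ((Cstar + 1) * meshSize N) ^ 2 * l2Norm f := by
  have hn := Nat.mul_pos hN hr
  have hH := meshSize_pos hN
  have hC := Cstar_pos
  have hms : D.msSpace order k ≤ Vh (N * r) := msSpace_le_Vh D hN hr hκ ho k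
  have := finiteDimensional_Vh hn
  let U : Vh (N * r) := ⟨uh, huh.1⟩
  let U' : Vh (N * r) := ⟨u, hms hu.1⟩
  have hcont : Continuous (uh - u) := (U - U').2.1
  have he := memLp_two_of_continuous hcont
  have horth : ∀ v : Vh (N * r), (v : Fn) ∈ D.msSpace order k → aB hn hκ (U - U') v = 0 := by
    intro v hv
    rw [map_sub, LinearMap.sub_apply, sub_eq_zero]
    exact (huh.2 v v.2).trans (hu.2 v hv).symm
  obtain ⟨v, hv, hvV, hvle⟩ := exists_msSpace_energy_approx D hN hr hκ ho hnd hk hf huh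
  let V : Vh (N * r) := ⟨v, hvV⟩
  -- Céa's lemma in the energy norm, where the Galerkin solution is a best approximation and no
  -- factor β appears.
  have h1 : √(aB hn hκ (U - U') (U - U')) ≤ (Cstar + 1) * meshSize N * l2Norm f := by
    refine (le_of_sq_le_mul (c := √(aB hn hκ (U - V) (U - V))) (Real.sqrt_nonneg _) ?_).trans hvle
    rw [Real.sq_sqrt (aB_nonneg hn hκ _)]
    have h2 : aB hn hκ (U - U') (U - U') = aB hn hκ (U - V) (U - U') := by
      have h3 : aB hn hκ (U - U') (U' - V) = 0 := horth _ (sub_mem hu.1 hv)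
      have h4 : aB hn hκ (U - U') (U - V) = aB hn hκ (U - U') (U - U') +
          aB hn hκ (U - U') (U' - V) := by
        rw [← map_add]; congr 1; abel
      rw [aB_symm hn hκ (U - V), h4, h3, add_zero]
    exact (h2.trans_le (le_abs_self _)).trans
      (bilin_cauchy_schwarz (aB hn hκ) (aB_symm hn hκ) (aB_nonneg hn hκ) _ _)
  obtain ⟨Z, hZ⟩ := bilin_riesz (aB hn hκ) (aB_pos hn hκ) (loadFunctional (N * r) he)
  have hZG : IsGalerkin κ (uh - u) (Vh (N * r) : Set Fn) Z := ⟨Z.2, fun w hw => hZ ⟨w, hw⟩⟩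
  obtain ⟨w, hw, hwV, hwle⟩ := exists_msSpace_energy_approx D hN hr hκ ho hnd hk he hZG
  let W : Vh (N * r) := ⟨w, hwV⟩
  have h2 : l2Norm (uh - u) ^ 2 = aB hn hκ (Z - W) (U - U') := by
    rw [LinearMap.map_sub₂, aB_symm hn hκ W, horth W hw, sub_zero, hZ, l2Norm,
      Real.sq_sqrt (integral_nonneg fun x => sq_nonneg _)]
    refine integral_congr_ae (Filter.Eventually.of_forall fun x => ?_)
    exact sq _
  have hF : 0 ≤ l2Norm f := Real.sqrt_nonneg _
  apply le_of_sq_le_mul (mul_nonneg (sq_nonneg _) hF)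
  rw [h2]
  refine (le_abs_self _).trans ((bilin_cauchy_schwarz (aB hn hκ) (aB_symm hn hκ)
    (aB_nonneg hn hκ) _ _).trans ?_)
  refine (mul_le_mul hwle h1 (Real.sqrt_nonneg _) ?_).trans_eq ?_
  · exact mul_nonneg (by positivity) (Real.sqrt_nonneg _)
  · ring

end SpectralLOD

/-! ### The two error estimates combined. -/

theorem mainTheorem8 (N r : ℕ) (hN : 0 < N) (hr : 0 < r)
    (κ : ℝ × ℝ → ℝ) (β : ℝ)
    (hκm : AEMeasurable κ (volume.restrict SpectralLOD.Omega))
    (hκ : ∀ᵐ x ∂(volume.restrict SpectralLOD.Omega), 1 ≤ κ x ∧ κ x ≤ β)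
    (S : SpectralLOD.SpectralData N r κ)
    (f : ℝ × ℝ → ℝ) (hf : MemLp f 2 (volume.restrict SpectralLOD.Omega))
    (uh : ℝ × ℝ → ℝ)
    (huh : SpectralLOD.IsGalerkin κ f (SpectralLOD.Vh (N * r) : Set (ℝ × ℝ → ℝ)) uh) :
    -- the localized method
    (∀ (D : SpectralLOD.DualNodes S) (order : List (ℕ × ℕ)), order.Nodup →
      (∀ p, p ∈ order ↔ SpectralLOD.IsInteriorNode (N * r) p) →
      ∀ k : ℕ,
        2 * D.q order ^ k * √(S.totalL : ℝ) * √(D.M : ℝ) * √β ≤ SpectralLOD.meshSize N ^ 2 →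
        ∀ u : ℝ × ℝ → ℝ,
          SpectralLOD.IsGalerkin κ f (D.msSpace order k : Set (ℝ × ℝ → ℝ)) u →
          SpectralLOD.l2Norm (uh - u) ≤
            ((SpectralLOD.Cstar + 1) * SpectralLOD.meshSize N) ^ 2 * SpectralLOD.l2Norm f) ∧
    -- the ideal method
    (∀ u : ℝ × ℝ → ℝ, SpectralLOD.IsGalerkin κ f S.idealSpace u →
      SpectralLOD.l2NormW κ (uh - u) ≤
          (SpectralLOD.Cstar * SpectralLOD.meshSize N) ^ 2 *
            SpectralLOD.l2Norm (fun x => κ x ^ (-(1 / 2) : ℝ) * f x) ∧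
      (SpectralLOD.Cstar * SpectralLOD.meshSize N) ^ 2 *
            SpectralLOD.l2Norm (fun x => κ x ^ (-(1 / 2) : ℝ) * f x) ≤
          (SpectralLOD.Cstar * SpectralLOD.meshSize N) ^ 2 * SpectralLOD.l2Norm f ∧
      SpectralLOD.l2Norm (uh - u) ≤
          (SpectralLOD.Cstar * SpectralLOD.meshSize N) ^ 2 * SpectralLOD.l2Norm f) := by
  have hc : SpectralLOD.CoeffBounds κ β := ⟨hκm, hκ⟩
  refine ⟨fun D order hnd ho k hk u hu =>
    SpectralLOD.l2Norm_localized_error_le D hN hr hc ho hnd hk hf huh hu, fun u hu => ?_⟩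
  have h1 := SpectralLOD.l2NormW_ideal_error_le hN hr hc hf huh hu
  have h2 := mul_le_mul_of_nonneg_left (SpectralLOD.l2Norm_weighted_le hc hf)
    (sq_nonneg (SpectralLOD.Cstar * SpectralLOD.meshSize N))
  have he := SpectralLOD.sub_mem_kerPi_of_isGalerkin hN hr hc huh hu
  exact ⟨h1, h2, (SpectralLOD.l2Norm_le_l2NormW hc he.1.1).trans (h1.trans h2)⟩
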